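/- Theorem (Transport Hessian Hamiltonian flows). Let $\mathbb T^d=\mathbb R^d/\mathbb Z^d$ be the flat torus, $\mathcal P$ the set of smooth positive probability densities on $\mathbb T^d$, and $\mathcal E,\mathcal F:\mathcal P\to\mathbb R$ smooth functionals (smooth along all smooth finite-dimensional families of densities). Suppose that $\mathcal E$ has $L^2$ first, second and third variations $\delta\mathcal E(\rho)(x)$, $\delta^2\mathcal E(\rho)(x,y)$, $\delta^3\mathcal E(\rho)(x,y,z)$, and $\mathcal F$ has an $L^2$ first variation $\delta\mathcal F(\rho)(x)$, all depending smoothly on $\rho$. That is, along every smooth curve $\rho_s$ in $\mathcal P$ and for all smooth $\varphi,\psi$ of mean zero, $$\tfrac{d}{ds}\mathcal E(\rho_s)=\int\delta\mathcal E(\rho_s)\,\partial_s\rho_s\,dx,\qquad \tfrac{d}{ds}\int\delta\mathcal E(\rho_s)\varphi\,dx=\iint\delta^2\mathcal E(\rho_s)(x,y)\varphi(x)\,\partial_s\rho_s(y)\,dx\,dy,$$ $$\tfrac{d}{ds}\iint\delta^2\mathcal E(\rho_s)(x,y)\varphi(x)\psi(y)\,dx\,dy=\iiint\delta^3\mathcal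 E(\rho_s)(x,y,z)\varphi(x)\psi(y)\,\partial_s\rho_s(z)\,dx\,dy\,dz,$$ and similarly for $\delta\mathcal F$. The kernels $\delta^2\mathcal E,\delta^3\mathcal E$ are smooth in $x$ and may be distributions in $y$, respectively $(y,z)$ (for instance delta functions); integrals against them are dual pairings, and derivatives in $y,z$ are distributional. The transport Hessian metric is $$g^{H}(\rho)(\sigma_1,\sigma_2)=\iint\nabla_x\nabla_y\delta^2\mathcal E(\rho)(x,y)(\nabla\Phi_1(x),\nabla\Phi_2(y))\rho(x)\rho(y)\,dx\,dy+\int\nabla_x^2\delta\mathcal E(\rho)(x)(\nabla\Phi_1(x),\nabla\Phi_2(x))\rho(x)\,dx,$$ where $\sigma_i=-\nabla\cdot(\rho\nabla\Phi_i)$, $i=1,2$. Let $\rho:[0,1]\to\mathcal P$ and $\Phi:[0,1]\times\mathbb T^d\to\mathbb R$ be smooth on $[0,1]\times\mathbb T^d$ with $\partial_t\rho+\nabla\cdot(\rho\nabla\Phi)=0$, and suppose that $(\rho,\Phi)$ is a critical point of $$\int_0^1\tfrac12\,g^H(\rho)(\partial_t\rho,\partial_t\rho)-\mathcal F(\rho)\,dt$$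 under this constraint with fixed initial and terminal densities: for every smooth family $(\rho^s,\Phi^s)_{s\in\mathbb R}$ of pairs satisfying the continuity equation, with $(\rho^0,\Phi^0)=(\rho,\Phi)$, $\rho^s(0)=\rho(0)$ and $\rho^s(1)=\rho(1)$, the derivative of the action of $\rho^s$ at $s=0$ is zero. Then there is a smooth function $\Psi:[0,1]\times\mathbb T^d\to\mathbb R$ such that on $[0,1]\times\mathbb T^d$ $$\begin{aligned} &\partial_t\rho+\nabla\cdot(\rho\nabla\Phi)=0,\\ &\partial_t\Psi+(\nabla\Phi,\nabla\Psi)+\delta\mathcal F(\rho)=\tfrac12\iint\nabla^2_{yz}\delta^3\mathcal E(\rho)(x,y,z)(\nabla\Phi(t,y),\nabla\Phi(t,z))\rho(t,y)\rho(t,z)\,dy\,dz\\ &\qquad+\int\nabla^2_{xy}\delta^2\mathcal E(\rho)(x,y)(\nabla\Phi(t,x),\nabla\Phi(t,y))\rho(t,y)\,dy\\ &\qquad+\tfrac12\int\nabla^2_y\delta^2\mathcal E(\rho)(x,y)(\nabla\Phi(t,y),\nabla\Phi(t,y))\rho(t,y)\,dy+\tfrac12\nabla_x^2\delta\mathcal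 E(\rho)(x)(\nabla\Phi(t,x),\nabla\Phi(t,x)), \end{aligned}$$ and $\Phi,\Psi$ satisfy the Poisson equation $$\nabla\cdot(\rho\nabla\Psi)=\nabla_x\cdot\Big(\rho(t,x)\Big[\nabla_x\int\nabla_y\delta^2\mathcal E(\rho)(x,y)\nabla\Phi(t,y)\rho(t,y)\,dy+\nabla_x^2\delta\mathcal E(\rho)(x)\nabla\Phi(t,x)\Big]\Big).$$ -/

import Mathlib

open scoped ContDiff

noncomputable section

namespace TransportHessian

/-! ### Functions on the flat torus `ℝ^d / ℤ^d` -/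

abbrev X (d : ℕ) : Type := EuclideanSpace ℝ (Fin d)

/-- The `i`-th standard basis vector. -/
abbrev e {d : ℕ} (i : Fin d) : X d := EuclideanSpace.single i (1 : ℝ)

/-- The algebra of smooth real functions on the torus, realized as the smooth functions on
`ℝ^d` that are `1`-periodic in every coordinate. -/
def torusSmooth (d : ℕ) : Subalgebra ℝ (X d → ℝ) where
  carrier := {f | ContDiff ℝ ∞ f ∧ ∀ (i : Fin d) (x : X d), f (x + e i) = f x}
  mul_mem' := fun {f g} hf hg =>
    ⟨hf.1.mul hg.1, fun i x => by simp only [Pi.mul_apply, hf.2 i x, hg.2 i x]⟩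
  add_mem' := fun {f g} hf hg =>
    ⟨hf.1.add hg.1, fun i x => by simp only [Pi.add_apply, hf.2 i x, hg.2 i x]⟩
  algebraMap_mem' := fun r => ⟨contDiff_const, fun _ _ => rfl⟩

/-- `C^∞(𝕋^d)`. -/
abbrev TF (d : ℕ) : Type := torusSmooth d

instance instCoeFunTF (d : ℕ) : CoeFun (TF d) (fun _ => X d → ℝ) := ⟨Subtype.val⟩

theorem TF.differentiable {d : ℕ} (f : TF d) : Differentiable ℝ (f : X d → ℝ) :=
  f.2.1.differentiable (by simp)

/-- The partial derivative `∂_i` on `C^∞(𝕋^d)`. -/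
def pd {d : ℕ} (i : Fin d) : TF d →ₗ[ℝ] TF d where
  toFun f := ⟨fun x => fderiv ℝ (f : X d → ℝ) x (e i), by
    refine ⟨(f.2.1.fderiv_right (m := ∞) (by simp)).clm_apply contDiff_const, fun j x => ?_⟩
    have h : (fun y : X d => (f : X d → ℝ) (y + e j)) = (f : X d → ℝ) :=
      funext fun y => f.2.2 j y
    have h2 : fderiv ℝ (f : X d → ℝ) (x + e j) = fderiv ℝ (f : X d → ℝ) x := by
      rw [← fderiv_comp_add_right, h]
    simp only [h2]⟩
  map_add' f g := by
    apply Subtype.ext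
    funext x
    change fderiv ℝ ((f : X d → ℝ) + (g : X d → ℝ)) x (e i) = _
    rw [fderiv_add (f.differentiable x) (g.differentiable x)]
    rfl
  map_smul' c f := by
    apply Subtype.ext
    funext x
    change fderiv ℝ (c • (f : X d → ℝ)) x (e i) = _
    rw [fderiv_const_smul (f.differentiable x)]
    rfl

/-- A fundamental domain of the torus. -/
def cube (d : ℕ) : Set (X d) := {x | ∀ i, x i ∈ Set.Ico (0 : ℝ) 1}

/-- Integration over the torus. -/
def intT {d : ℕ} (f : X d → ℝ) : ℝ := ∫ x in cube d, f x

/-- The divergence of a vector field given by its components. -/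
def divT {d : ℕ} (v : Fin d → TF d) : TF d := ∑ i, pd i (v i)

/-- The space `𝒫` of smooth positive probability densities on the torus. -/
structure Density (d : ℕ) where
  toTF : TF d
  pos : ∀ x, 0 < toTF x
  mass : intT (toTF : X d → ℝ) = 1

instance instCoeDensity (d : ℕ) : Coe (Density d) (TF d) := ⟨Density.toTF⟩

/-- The operator `Φ ↦ ∇ · (ρ ∇Φ)`. -/
def divGrad {d : ℕ} (ρ : Density d) (Φ : TF d) : TF d := divT fun i => ρ.toTF * pd i Φ

/-! ### Smooth families and smooth functionals -/

/-- The family `v ↦ f v` of smooth functions on the torus is jointly smooth in `(v, x)` for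
`v ∈ S`. -/
def SmoothFam {d : ℕ} {V : Type} [NormedAddCommGroup V] [NormedSpace ℝ V] (S : Set V)
    (f : V → TF d) : Prop :=
  ContDiffOn ℝ ∞ (fun p : V × X d => f p.1 p.2) (S ×ˢ Set.univ)

/-- `E : 𝒫 → ℝ` is smooth: it is smooth along all smooth finite-dimensional families of
densities (with parameters in a convex set with interior points). -/
def SmoothFunctional {d : ℕ} (E : Density d → ℝ) : Prop :=
  ∀ (V : Type) [NormedAddCommGroup V] [NormedSpace ℝ V] [FiniteDimensional ℝ V] (S : Set V),
    Convex ℝ S → (interior S).Nonempty →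
    ∀ ρ : V → Density d, SmoothFam S (fun v => (ρ v).toTF) → ContDiffOn ℝ ∞ (fun v => E (ρ v)) S

/-- `γ : ℝ → 𝒫` is a smooth curve of densities with velocity `γ'`. -/
structure IsCurve {d : ℕ} (γ : ℝ → Density d) (γ' : ℝ → TF d) : Prop where
  smooth : SmoothFam Set.univ (fun s => (γ s).toTF)
  velocity : ∀ s x, HasDerivAt (fun r => (γ r).toTF x) (γ' s x) s

/-- A kernel `K(x, y)` on the torus, smooth in `x` and a distribution in `y`, given by its
action `(K φ)(x) = ∫ K(x, y) φ(y) dy` on test functions. -/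
abbrev Kernel2 (d : ℕ) : Type := TF d →ₗ[ℝ] TF d

/-- A kernel `K(x, y, z)` on the torus, smooth in `x` and a distribution in `(y, z)`, given by
`(K φ ψ)(x) = ∫∫ K(x, y, z) φ(y) ψ(z) dy dz`. -/
abbrev Kernel3 (d : ℕ) : Type := TF d →ₗ[ℝ] TF d →ₗ[ℝ] TF d

/-- `∂_{x_i} K(x, y)`. -/
def Kernel2.dx {d : ℕ} (i : Fin d) (K : Kernel2 d) : Kernel2 d := pd i ∘ₗ K

/-- The distributional derivative `∂_{y_j} K(x, y)`. -/
def Kernel2.dy {d : ℕ} (j : Fin d) (K : Kernel2 d) : Kernel2 d := K ∘ₗ (-pd j)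

/-- The distributional derivative `∂_{y_i} K(x, y, z)`. -/
def Kernel3.dy {d : ℕ} (i : Fin d) (K : Kernel3 d) : Kernel3 d := K ∘ₗ (-pd i)

/-- The distributional derivative `∂_{z_j} K(x, y, z)`. -/
def Kernel3.dz {d : ℕ} (j : Fin d) (K : Kernel3 d) : Kernel3 d := K.compl₂ (-pd j)

/-- `δE` is an `L²` first variation of `E`: `d/ds E(ρ_s) = ∫ δE(ρ_s) ∂_s ρ_s dx`. As all
tangent vectors have mean zero, `δE(ρ)` is determined up to an additive constant. -/
structure IsFirstVariation {d : ℕ} (E : Density d → ℝ) (δE : Density d → TF d) : Prop where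
  smooth : ∀ (V : Type) [NormedAddCommGroup V] [NormedSpace ℝ V] [FiniteDimensional ℝ V]
    (S : Set V), Convex ℝ S → (interior S).Nonempty →
    ∀ ρ : V → Density d, SmoothFam S (fun v => (ρ v).toTF) → SmoothFam S (fun v => δE (ρ v))
  deriv : ∀ γ γ', IsCurve γ γ' → ∀ s,
    HasDerivAt (fun r => E (γ r)) (intT fun x => δE (γ s) x * γ' s x) s

/-- `δ2E` is an `L²` second variation: for every tangent vector `φ`,
`d/ds ∫ δE(ρ_s)(x) φ(x) dx = ∫∫ δ²E(ρ_s)(x, y) φ(x) ∂_s ρ_s(y) dx dy`. -/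
structure IsSecondVariation {d : ℕ} (δE : Density d → TF d) (δ2E : Density d → Kernel2 d) :
    Prop where
  smooth : ∀ (V : Type) [NormedAddCommGroup V] [NormedSpace ℝ V] [FiniteDimensional ℝ V]
    (S : Set V), Convex ℝ S → (interior S).Nonempty →
    ∀ (ρ : V → Density d) (φ : V → TF d), SmoothFam S (fun v => (ρ v).toTF) → SmoothFam S φ →
      SmoothFam S (fun v => δ2E (ρ v) (φ v))
  deriv : ∀ γ γ', IsCurve γ γ' → ∀ φ : TF d, intT (φ : X d → ℝ) = 0 → ∀ s,
    HasDerivAt (fun r => intT fun x => δE (γ r) x * φ x)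
      (intT fun x => δ2E (γ s) (γ' s) x * φ x) s

/-- `δ3E` is an `L²` third variation: for all tangent vectors `φ`, `ψ`,
`d/ds ∫∫ δ²E(ρ_s)(x, y) φ(x) ψ(y) dx dy = ∫∫∫ δ³E(ρ_s)(x, y, z) φ(x) ψ(y) ∂_s ρ_s(z) dx dy dz`. -/
structure IsThirdVariation {d : ℕ} (δ2E : Density d → Kernel2 d) (δ3E : Density d → Kernel3 d) :
    Prop where
  smooth : ∀ (V : Type) [NormedAddCommGroup V] [NormedSpace ℝ V] [FiniteDimensional ℝ V]
    (S : Set V), Convex ℝ S → (interior S).Nonempty →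
    ∀ (ρ : V → Density d) (φ ψ : V → TF d), SmoothFam S (fun v => (ρ v).toTF) →
      SmoothFam S φ → SmoothFam S ψ → SmoothFam S (fun v => δ3E (ρ v) (φ v) (ψ v))
  deriv : ∀ γ γ', IsCurve γ γ' → ∀ φ ψ : TF d, intT (φ : X d → ℝ) = 0 →
    intT (ψ : X d → ℝ) = 0 → ∀ s,
    HasDerivAt (fun r => intT fun x => δ2E (γ r) ψ x * φ x)
      (intT fun x => δ3E (γ s) ψ (γ' s) x * φ x) s

/-! ### The transport Hessian metric and the action -/

/-- `∫∫ ∇_x∇_y δ²E(ρ)(x,y) (∇Φ₁(x), ∇Φ₂(y)) ρ(x) ρ(y) dx dy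
  + ∫ ∇²δE(ρ)(x) (∇Φ₁(x), ∇Φ₂(x)) ρ(x) dx`. -/
def hessStar {d : ℕ} (δE : Density d → TF d) (δ2E : Density d → Kernel2 d) (ρ : Density d)
    (Φ₁ Φ₂ : TF d) : ℝ :=
  (intT fun x => ∑ i, ∑ j,
      ((δ2E ρ).dy j).dx i (ρ.toTF * pd j Φ₂) x * pd i Φ₁ x * ρ.toTF x)
    + intT fun x => ∑ i, ∑ j, pd i (pd j (δE ρ)) x * pd i Φ₁ x * pd j Φ₂ x * ρ.toTF x

open Classical in
/-- A solution `Φ` of `σ = -∇ · (ρ ∇Φ)` (unique up to an additive constant). -/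
def potential {d : ℕ} (ρ : Density d) (σ : X d → ℝ) : TF d :=
  if h : ∃ Φ : TF d, ∀ x, σ x = -divGrad ρ Φ x then h.choose else 0

/-- The transport Hessian metric `g^H(ρ)(σ₁, σ₂)` of the energy with variations `δE`, `δ2E`. -/
def gH {d : ℕ} (δE : Density d → TF d) (δ2E : Density d → Kernel2 d) (ρ : Density d)
    (σ₁ σ₂ : X d → ℝ) : ℝ :=
  hessStar δE δ2E ρ (potential ρ σ₁) (potential ρ σ₂)

/-- The time derivative on `[0, 1]` (one-sided at the end points). -/
def dt {d : ℕ} (f : ℝ → TF d) (t : ℝ) (x : X d) : ℝ :=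
  derivWithin (fun r => f r x) (Set.Icc 0 1) t

/-- The action `∫₀¹ ½ g^H(∂_tρ, ∂_tρ) - F(ρ) dt`. -/
def action {d : ℕ} (δE : Density d → TF d) (δ2E : Density d → Kernel2 d) (F : Density d → ℝ)
    (ρ : ℝ → Density d) : ℝ :=
  ∫ t in (0 : ℝ)..1,
    ((1 / 2) * gH δE δ2E (ρ t) (dt (fun r => (ρ r).toTF) t) (dt (fun r => (ρ r).toTF) t) - F (ρ t))

/-- The continuity equation `∂_tρ + ∇ · (ρ ∇Φ) = 0` on `[0, 1] × 𝕋^d`. -/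
def ContinuityEq {d : ℕ} (ρ : ℝ → Density d) (Φ : ℝ → TF d) : Prop :=
  ∀ t ∈ Set.Icc (0 : ℝ) 1, ∀ x, dt (fun r => (ρ r).toTF) t x + divGrad (ρ t) (Φ t) x = 0

/-- An admissible pair: smooth on `[0, 1] × 𝕋^d` and satisfying the continuity equation. Only
the values at times in `[0, 1]` matter. -/
structure Admissible {d : ℕ} (ρ : ℝ → Density d) (Φ : ℝ → TF d) : Prop where
  smooth_density : SmoothFam (Set.Icc (0 : ℝ) 1) (fun t => (ρ t).toTF)
  smooth_potential : SmoothFam (Set.Icc (0 : ℝ) 1) Φ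
  continuity : ContinuityEq ρ Φ

/-- A smooth family `(ρ^s, Φ^s)` of admissible pairs through `(ρ, Φ)` at `s = 0`, with fixed
initial and terminal densities. -/
structure IsVariation {d : ℕ} (ρ : ℝ → Density d) (Φ : ℝ → TF d)
    (ρs : ℝ → ℝ → Density d) (Φs : ℝ → ℝ → TF d) : Prop where
  smooth_density : SmoothFam ((Set.univ : Set ℝ) ×ˢ Set.Icc (0 : ℝ) 1)
    (fun p : ℝ × ℝ => (ρs p.1 p.2).toTF)
  smooth_potential : SmoothFam ((Set.univ : Set ℝ) ×ˢ Set.Icc (0 : ℝ) 1)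
    (fun p : ℝ × ℝ => Φs p.1 p.2)
  continuity : ∀ s, ContinuityEq (ρs s) (Φs s)
  base_density : ∀ t ∈ Set.Icc (0 : ℝ) 1, ρs 0 t = ρ t
  base_potential : ∀ t ∈ Set.Icc (0 : ℝ) 1, Φs 0 t = Φ t
  initial : ∀ s, ρs s 0 = ρ 0
  terminal : ∀ s, ρs s 1 = ρ 1

/-- `(ρ, Φ)` is a critical point of the action under the continuity equation with gradient
drift, with fixed initial and terminal densities. -/
structure IsCriticalPoint {d : ℕ} (δE : Density d → TF d) (δ2E : Density d → Kernel2 d)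
    (F : Density d → ℝ) (ρ : ℝ → Density d) (Φ : ℝ → TF d) : Prop where
  admissible : Admissible ρ Φ
  critical : ∀ ρs Φs, IsVariation ρ Φ ρs Φs →
    HasDerivAt (fun s => action δE δ2E F (ρs s)) 0 0

/-! ### The equations of the flow -/

/-- The Hamilton–Jacobi type equation
`∂_tΨ + (∇Φ, ∇Ψ) + δF(ρ)
  = ½ ∫∫ ∇²_{yz} δ³E(ρ)(x,y,z) (∇Φ(y), ∇Φ(z)) ρ(y) ρ(z) dy dz
  + ∫ ∇²_{xy} δ²E(ρ)(x,y) (∇Φ(x), ∇Φ(y)) ρ(y) dy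
  + ½ ∫ ∇²_y δ²E(ρ)(x,y) (∇Φ(y), ∇Φ(y)) ρ(y) dy
  + ½ ∇²_x δE(ρ)(x) (∇Φ(x), ∇Φ(x))` on `[0, 1] × 𝕋^d`. -/
def HamiltonJacobiEq {d : ℕ} (δE : Density d → TF d) (δ2E : Density d → Kernel2 d)
    (δ3E : Density d → Kernel3 d) (δF : Density d → TF d)
    (ρ : ℝ → Density d) (Φ Ψ : ℝ → TF d) : Prop :=
  ∀ t ∈ Set.Icc (0 : ℝ) 1, ∀ x,
    dt Ψ t x + ∑ i, pd i (Φ t) x * pd i (Ψ t) x + δF (ρ t) x =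
      (1 / 2) * (∑ i, ∑ j, ((δ3E (ρ t)).dy i).dz j
          ((ρ t).toTF * pd i (Φ t)) ((ρ t).toTF * pd j (Φ t)) x)
      + (∑ i, ∑ j, ((δ2E (ρ t)).dy j).dx i ((ρ t).toTF * pd j (Φ t)) x * pd i (Φ t) x)
      + (1 / 2) * (∑ i, ∑ j, ((δ2E (ρ t)).dy i).dy j
          ((ρ t).toTF * pd i (Φ t) * pd j (Φ t)) x)
      + (1 / 2) * (∑ i, ∑ j, pd i (pd j (δE (ρ t))) x * pd i (Φ t) x * pd j (Φ t) x)

/-- The Poisson equation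
`∇ · (ρ ∇Ψ) = ∇_x · (ρ [∇_x ∫ ∇_y δ²E(ρ)(x,y) ∇Φ(y) ρ(y) dy + ∇²_x δE(ρ) ∇Φ])`
on `[0, 1] × 𝕋^d`. -/
def PoissonEq {d : ℕ} (δE : Density d → TF d) (δ2E : Density d → Kernel2 d)
    (ρ : ℝ → Density d) (Φ Ψ : ℝ → TF d) : Prop :=
  ∀ t ∈ Set.Icc (0 : ℝ) 1,
    divGrad (ρ t) (Ψ t) =
      divT fun i => (ρ t).toTF *
        (pd i (∑ j, (δ2E (ρ t)).dy j ((ρ t).toTF * pd j (Φ t)))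
          + ∑ j, pd i (pd j (δE (ρ t))) * pd j (Φ t))

end TransportHessian

end

noncomputable section

open scoped ContDiff
open Set MeasureTheory Topology Filter

namespace TransportHessian

/-! The statement is an Euler–Lagrange computation in which Ψ is the momentum dual to the density.
Write σ = ∇·(ρ∇Φ) = -∂_tρ. Perturb ρ by sin(s) η with η = θ(t) φ(x), φ of mean zero and θ zero at
both end times. The flux must change with it, ∇·(ρ_s∇Φ_s) = σ - sin(s) κ with κ = θ'φ, so the
velocity χ of Φ_s satisfies ∇·(η∇Φ) + ∇·(ρ∇χ) = -κ. In the derivative of the Lagrangian the unknown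
χ enters only through ∫ ∇²δE(∇χ,∇Φ) ρ. If Ψ solves the Poisson equation, integration by parts
replaces this term by integrals against η and κ; the terms ∫ (δ²E σ) κ cancel, and the derivative
becomes ∫ H η + ∫ Ψ κ, where H collects all the terms of the Hamilton–Jacobi equation except ∂_tΨ
(`hasDerivAt_lagrangian`). Criticality and integration by parts in time show that H - ∂_tΨ is
orthogonal to every φ of mean zero, hence constant in space at each time. Adding to Ψ a primitive in
time of that constant removes it without changing ∇Ψ (`exists_hamiltonian_flow`).

The computation needs the symmetries of δ²E and δ³E on mean-zero functions. They come from equality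
of mixed derivatives along two-parameter families of densities (`variation_symm`,
`thirdVariation_symm_left`).

The analytic input is the solvability of ∇·(ρ∇u) = f for f of mean zero, smoothly in parameters
(`exists_divGrad_eq`). It supplies Ψ and also the potentials Φ_s of the varied paths
(`exists_variation`). Dividing by ρ gives Δu + ∇log ρ·∇u = f/ρ. With y = Δu as unknown, up to the
zero mode, this reads (1 + T) y = f/ρ on the space ℓ¹ of Fourier coefficients. T is compact, 1 + T
is injective by an energy identity, and the Fredholm alternative inverts it
(`isUnit_one_add_driftOp`). Inversion is a smooth map on units, so y depends smoothly on parameters.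
Smoothness in x follows because translation can itself be treated as a parameter
(`solFun_translate`). -/

/-! ### Smooth families as smooth maps into spaces of continuous functions -/

/-- Evaluation of a continuous family of continuous linear maps, as a continuous linear map. -/
def curryEval (K V E : Type) [TopologicalSpace K] [CompactSpace K] [NormedAddCommGroup V]
    [NormedSpace ℝ V] [NormedAddCommGroup E] [NormedSpace ℝ E] :
    C(K, V →L[ℝ] E) →L[ℝ] V →L[ℝ] C(K, E) :=
  LinearMap.mkContinuous₂
    (LinearMap.mk₂ ℝ (fun (G : C(K, V →L[ℝ] E)) (v : V) =>
      (⟨fun k => G k v, by fun_prop⟩ : C(K, E)))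
      (fun _ _ _ => by ext; simp) (fun _ _ _ => by ext; simp) (fun _ _ _ => by ext; simp)
      (fun _ _ _ => by ext; simp)) 1 (fun G v => by
        rw [ContinuousMap.norm_le _ (by positivity)]
        intro k
        refine (ContinuousLinearMap.le_opNorm (G k) v).trans ?_
        rw [one_mul]
        gcongr
        exact G.norm_coe_le_norm k)

@[simp] theorem curryEval_apply {K V E : Type} [TopologicalSpace K] [CompactSpace K]
    [NormedAddCommGroup V] [NormedSpace ℝ V] [NormedAddCommGroup E] [NormedSpace ℝ E]
    (G : C(K, V →L[ℝ] E)) (v : V) (k : K) : curryEval K V E G v k = G k v := rfl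

section Curry

variable {V Z K : Type} [NormedAddCommGroup V] [NormedSpace ℝ V]
  [NormedAddCommGroup Z] [NormedSpace ℝ Z] [TopologicalSpace K] [CompactSpace K]
  {S : Set V} {Q : Set Z}

omit [NormedSpace ℝ V] [NormedSpace ℝ Z] [CompactSpace K] in
theorem continuousOn_curry {E : Type} [NormedAddCommGroup E] (j : C(K, Z)) (hj : ∀ k, j k ∈ Q)
    {f : V × Z → E} (hf : ContinuousOn f (S ×ˢ Q)) {F : V → C(K, E)}
    (hF : ∀ v ∈ S, ∀ k, F v k = f (v, j k)) : ContinuousOn F S := by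
  rw [continuousOn_iff_continuous_domRestrict]
  refine ContinuousMap.continuous_of_continuous_uncurry _ ?_
  have : (Function.uncurry fun (x : S) (y : K) => (S.domRestrict F x) y) =
      fun p : S × K => f (p.1, j p.2) := by
    ext p; exact hF p.1 p.1.2 p.2
  rw [this]
  exact hf.comp_continuous (by fun_prop) fun p => ⟨p.1.2, hj _⟩

/-- The partial derivative in the first variable of a function on a product set. -/
def fstDeriv {E : Type} [NormedAddCommGroup E] [NormedSpace ℝ E] (S : Set V) (Q : Set Z)
    (f : V × Z → E) (p : V × Z) : V →L[ℝ] E :=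
  (fderivWithin ℝ f (S ×ˢ Q) p).comp (ContinuousLinearMap.inl ℝ V Z)

theorem hasFDerivWithinAt_fst {E : Type} [NormedAddCommGroup E] [NormedSpace ℝ E]
    {f : V × Z → E} (hf : DifferentiableOn ℝ f (S ×ˢ Q)) {v : V} (hv : v ∈ S) {z : Z}
    (hz : z ∈ Q) : HasFDerivWithinAt (fun w => f (w, z)) (fstDeriv S Q f (v, z)) S v := by
  have h1 := (hf (v, z) ⟨hv, hz⟩).hasFDerivWithinAt
  have h2 : HasFDerivWithinAt (fun w : V => (w, z)) (ContinuousLinearMap.inl ℝ V Z) S v := by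
    simpa using! (hasFDerivWithinAt_id v S).prodMk (hasFDerivWithinAt_const z v S)
  exact HasFDerivWithinAt.comp (t := S ×ˢ Q) v h1 h2 fun w hw => Set.mk_mem_prod hw hz

/-- The linear approximation must be uniform in k. Continuity of `F'` in the sup norm keeps the
partial derivatives near v within ε of those at v for all k at once, and on the convex set S ∩ ball
the mean value inequality turns this into the required estimate. -/
theorem hasFDerivWithinAt_curry (hS : Convex ℝ S) (hS' : UniqueDiffOn ℝ S)
    (hQ : UniqueDiffOn ℝ Q) (j : C(K, Z)) (hj : ∀ k, j k ∈ Q) {E : Type} [NormedAddCommGroup E]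
    [NormedSpace ℝ E] {f : V × Z → E} (hf : ContDiffOn ℝ 1 f (S ×ˢ Q)) {F : V → C(K, E)}
    (hF : ∀ v ∈ S, ∀ k, F v k = f (v, j k)) {F' : V → C(K, V →L[ℝ] E)}
    (hF' : ∀ v ∈ S, ∀ k, F' v k = fstDeriv S Q f (v, j k)) {v : V} (hv : v ∈ S) :
    HasFDerivWithinAt F (curryEval K V E (F' v)) S v := by
  have hc : ContinuousOn (fstDeriv S Q f) (S ×ˢ Q) :=
    (hf.continuousOn_fderivWithin (hS'.prod hQ) le_rfl).clm_comp continuousOn_const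
  have hcF : ContinuousOn F' S := continuousOn_curry j hj hc hF'
  rw [hasFDerivWithinAt_iff_isLittleO, Asymptotics.isLittleO_iff]
  intro ε hε
  obtain ⟨δ, hδ, hball⟩ : ∃ δ > 0, ∀ ⦃u⦄, u ∈ S → dist u v < δ →
      ∀ k, dist (F' v k) (F' u k) < ε := by
    have h : Tendsto F' (𝓝[S] v) (𝓝 (F' v)) := hcF v hv
    have h2 := Metric.tendstoUniformly_iff.1 (ContinuousMap.tendsto_iff_tendstoUniformly.1 h) ε hε
    obtain ⟨δ, hδ, h3⟩ := Metric.mem_nhdsWithin_iff.1 h2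
    exact ⟨δ, hδ, fun u hu hd => h3 ⟨hd, hu⟩⟩
  filter_upwards [inter_mem self_mem_nhdsWithin (mem_nhdsWithin_of_mem_nhds
    (Metric.ball_mem_nhds v hδ))] with w hw
  rw [ContinuousMap.norm_le _ (by positivity)]
  intro k
  have hcv : Convex ℝ (S ∩ Metric.ball v δ) := hS.inter (convex_ball v δ)
  have key := hcv.norm_image_sub_le_of_norm_hasFDerivWithin_le' (f := fun u => f (u, j k))
    (f' := fun u => fstDeriv S Q f (u, j k)) (φ := fstDeriv S Q f (v, j k)) (C := ε)
    (fun u hu => (hasFDerivWithinAt_fst (hf.differentiableOn (by simp)) hu.1 (hj k)).mono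
      inter_subset_left)
    (fun u hu => by
      rw [← hF' u hu.1, ← hF' v hv, ← dist_eq_norm, dist_comm]
      exact (hball hu.1 hu.2 k).le)
    ⟨hv, Metric.mem_ball_self hδ⟩ hw
  simpa [hF w hw.1, hF v hv, hF' v hv] using! key

/-- The induction quantifies over the target space, because the derivative of an E-valued family is
a family valued in V →L[ℝ] E. `curryEval` then converts the curried derivative into a derivative of
the curried map. -/
theorem contDiffOn_nat_curry (hS : Convex ℝ S) (hS' : UniqueDiffOn ℝ S) (hQ : UniqueDiffOn ℝ Q)
    (j : C(K, Z)) (hj : ∀ k, j k ∈ Q) (n : ℕ) : ∀ {E : Type} [NormedAddCommGroup E]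
    [NormedSpace ℝ E] {f : V × Z → E} (_ : ContDiffOn ℝ n f (S ×ˢ Q)) {F : V → C(K, E)}
    (_ : ∀ v ∈ S, ∀ k, F v k = f (v, j k)), ContDiffOn ℝ n F S := by
  induction n with
  | zero =>
    intro E _ _ f hf F hF
    simp only [Nat.cast_zero, contDiffOn_zero] at hf ⊢
    exact continuousOn_curry j hj hf hF
  | succ n ih =>
    intro E _ _ f hf F hF
    have hd : ContDiffOn ℝ n (fstDeriv S Q f) (S ×ˢ Q) :=
      (hf.fderivWithin (hS'.prod hQ) (by simp)).clm_comp contDiffOn_const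
    have hcont : ∀ v ∈ S, Continuous fun k => fstDeriv S Q f (v, j k) := fun v hv =>
      hd.continuousOn.comp_continuous (by fun_prop) fun k => ⟨hv, hj k⟩
    classical
    -- Off S the slice need not be continuous; the junk value 0 is never used.
    let F' : V → C(K, V →L[ℝ] E) := fun v =>
      if h : Continuous fun k => fstDeriv S Q f (v, j k) then ⟨_, h⟩ else 0
    have hF' : ∀ v ∈ S, ∀ k, F' v k = fstDeriv S Q f (v, j k) := fun v hv k => by
      simp [F', hcont v hv]
    push_cast
    rw [contDiffOn_succ_iff_hasFDerivWithinAt_of_uniqueDiffOn hS']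
    refine ⟨by simp, fun v => curryEval K V E (F' v), ?_, fun v hv => ?_⟩
    · exact (curryEval K V E).contDiff.comp_contDiffOn (ih hd hF')
    · refine hasFDerivWithinAt_curry hS hS' hQ j hj (hf.of_le ?_) hF hF' hv
      exact_mod_cast Nat.succ_le_succ (Nat.zero_le n)

theorem contDiffOn_curry (hS : Convex ℝ S) (hS' : UniqueDiffOn ℝ S) (hQ : UniqueDiffOn ℝ Q)
    (j : C(K, Z)) (hj : ∀ k, j k ∈ Q) {E : Type} [NormedAddCommGroup E] [NormedSpace ℝ E]
    {f : V × Z → E} (hf : ContDiffOn ℝ ∞ f (S ×ˢ Q)) {F : V → C(K, E)}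
    (hF : ∀ v ∈ S, ∀ k, F v k = f (v, j k)) : ContDiffOn ℝ ∞ F S :=
  contDiffOn_infty.2 fun n => contDiffOn_nat_curry hS hS' hQ j hj n
    (hf.of_le (by exact_mod_cast le_top)) hF

end Curry

variable {d : ℕ}

/-! ### Periodic functions and integrals over the torus -/

/-- `1`-periodicity in every coordinate. -/
def Periodic1 {E : Type} (f : X d → E) : Prop := ∀ (i : Fin d) (x : X d), f (x + e i) = f x

theorem Periodic1.add_int {E : Type} {f : X d → E} (hf : Periodic1 f) (n : Fin d → ℤ) (x : X d) :
    f (x + WithLp.toLp 2 (fun i => (n i : ℝ))) = f x := by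
  have key : ∀ (i : Fin d) (m : ℤ) (x : X d), f (x + (m : ℝ) • e i) = f x := by
    intro i m
    induction m using Int.induction_on with
    | zero => intro x; simp
    | succ k ih =>
      intro x
      have : x + (((k : ℤ) + 1 : ℤ) : ℝ) • (e i : X d) = (x + ((k : ℤ) : ℝ) • e i) + e i := by
        push_cast; rw [add_smul, one_smul, add_assoc]
      rw [this, hf, ih]
    | pred k ih =>
      intro x
      have : x + ((-(k : ℤ) : ℤ) : ℝ) • (e i : X d) =
          (x + ((-(k : ℤ) - 1 : ℤ) : ℝ) • e i) + e i := by
        push_cast; rw [sub_smul, one_smul]; abel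
      rw [← ih x, this, hf]
  have h2 : ∀ (s : Finset (Fin d)) (x : X d), f (x + ∑ i ∈ s, (n i : ℝ) • e i) = f x := by
    intro s
    induction s using Finset.induction_on with
    | empty => intro x; simp
    | insert a s ha ih =>
      intro x
      rw [Finset.sum_insert ha, ← add_assoc, ih, key]
  rw [← h2 Finset.univ x]
  congr 2
  ext j
  simp [Finset.sum_apply, Pi.single_apply]

/-- The closed unit cube as a compact space of coordinates. -/
abbrev Cube (d : ℕ) : Type := ↥(Icc (0 : Fin d → ℝ) 1)

/-- The inclusion of the closed unit cube. -/
def cubeIncl (d : ℕ) : C(Cube d, X d) := ⟨fun k => WithLp.toLp 2 k.1, by fun_prop⟩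

theorem Periodic1.exists_cube {E : Type} {f : X d → E} (hf : Periodic1 f) (x : X d) :
    ∃ k : Cube d, f (cubeIncl d k) = f x := by
  refine ⟨⟨fun i => Int.fract (x i), fun i => Int.fract_nonneg _,
    fun i => (Int.fract_lt_one _).le⟩, ?_⟩
  rw [← hf.add_int (fun i => ⌊x i⌋)]
  congr 1
  ext i
  simp [cubeIncl, Int.fract_add_floor]

theorem Periodic1.exists_norm_le {E : Type} [NormedAddCommGroup E] {f : X d → E}
    (hf : Periodic1 f) (hc : Continuous f) : ∃ C, ∀ x, ‖f x‖ ≤ C := by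
  obtain ⟨C, hC⟩ := (isCompact_univ (X := Cube d)).exists_bound_of_continuousOn
    (f := fun k => f (cubeIncl d k)) (by fun_prop)
  refine ⟨C, fun x => ?_⟩
  obtain ⟨k, hk⟩ := hf.exists_cube x
  rw [← hk]
  exact hC k (mem_univ k)

section Integral

variable {E : Type} [NormedAddCommGroup E] [NormedSpace ℝ E]

/-- The faces of the cube are null sets, so the half-open fundamental domain can be traded for the
closed cube, whose compactness is needed for sup norms. -/
theorem setIntegral_cube_eq_pi (f : X d → E) :
    ∫ x in cube d, f x = ∫ x in Icc (0 : Fin d → ℝ) 1, f (WithLp.toLp 2 x) := by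
  have hp := PiLp.volume_preserving_toLp (Fin d)
  have hpre : cube d = WithLp.ofLp ⁻¹' (Set.pi univ fun _ => Ico (0 : ℝ) 1) := by
    ext x; simp [cube]
  have h1 : ∫ x in cube d, f x =
      ∫ x in (Set.pi univ fun _ => Ico (0 : ℝ) 1), f (WithLp.toLp 2 x) := by
    rw [← hp.setIntegral_preimage_emb (MeasurableEquiv.toLp 2 (Fin d → ℝ)).measurableEmbedding]
    rw [hpre]
    rfl
  rw [h1]
  refine setIntegral_congr_set ?_
  have := MeasureTheory.Measure.univ_pi_Ico_ae_eq_Icc (μ := fun _ : Fin d => (volume : Measure ℝ))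
    (f := 0) (g := 1)
  exact this

/-- Lebesgue measure on the closed unit cube. -/
def cubeMeasure (d : ℕ) : Measure (Cube d) := Measure.comap Subtype.val volume

theorem setIntegral_cube_eq (f : X d → E) :
    ∫ x in cube d, f x = ∫ k, f (cubeIncl d k) ∂(cubeMeasure d) := by
  rw [setIntegral_cube_eq_pi, ← integral_subtype_comap measurableSet_Icc]
  rfl

theorem cubeMeasure_univ : cubeMeasure d univ = 1 := by
  rw [cubeMeasure, comap_subtype_coe_apply measurableSet_Icc, image_univ, Subtype.range_coe,
    Real.volume_Icc_pi]
  simp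

instance : IsProbabilityMeasure (cubeMeasure d) := ⟨cubeMeasure_univ⟩

theorem setIntegral_cube_const [CompleteSpace E] (c : E) : ∫ _x in cube d, c = c := by
  rw [setIntegral_cube_eq]; simp

theorem setIntegral_cube_eq_Ioc (f : X d → E) :
    ∫ x in cube d, f x =
      ∫ x in {x : Fin d → ℝ | ∀ i, x i ∈ Ioc (0 : ℝ) (0 + 1)}, f (WithLp.toLp 2 x) := by
  rw [setIntegral_cube_eq_pi]
  have h : {x : Fin d → ℝ | ∀ i, x i ∈ Ioc (0 : ℝ) (0 + 1)} =
      Set.pi univ fun i => Ioc ((0 : Fin d → ℝ) i) ((1 : Fin d → ℝ) i) := by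
    ext x; simp
  rw [h]
  exact (setIntegral_congr_set Measure.univ_pi_Ioc_ae_eq_Icc).symm

omit [NormedSpace ℝ E] in
theorem integrable_cube {f : X d → E} (hf : Continuous f) :
    Integrable (fun k => f (cubeIncl d k)) (cubeMeasure d) := by
  have : Continuous fun k => f (cubeIncl d k) := by fun_prop
  exact this.integrable_of_hasCompactSupport (HasCompactSupport.of_compactSpace _)

end Integral

-- Descent to the compact torus and translation invariance of the integral

local instance : MeasureSpace UnitAddCircle := ⟨AddCircle.haarAddCircle⟩

/-- The projection of `ℝ^d` onto the torus. -/
def toTorus (x : X d) : UnitAddTorus (Fin d) := fun i => (x i : UnitAddCircle)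

/-- The function on the torus induced by a periodic function. -/
def descend {E : Type} (f : X d → E) (t : UnitAddTorus (Fin d)) : E :=
  f (WithLp.toLp 2 fun i => (AddCircle.equivIoc 1 0 (t i)).1)

theorem Periodic1.descend_toTorus {E : Type} {f : X d → E} (hf : Periodic1 f) (x : X d) :
    descend f (toTorus x) = f x := by
  have h : ∀ i, ∃ n : ℤ, x i = (AddCircle.equivIoc (1 : ℝ) 0 (x i : UnitAddCircle)).1 + n := by
    intro i
    have h1 := (AddCircle.equivIoc (1 : ℝ) 0).symm_apply_apply (x i : UnitAddCircle)
    have h2 : (((AddCircle.equivIoc (1 : ℝ) 0 (x i : UnitAddCircle)).1 : ℝ) : UnitAddCircle) =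
      (x i : UnitAddCircle) := h1
    obtain ⟨n, hn⟩ := AddSubgroup.mem_zmultiples_iff.1 ((QuotientAddGroup.eq).1 h2)
    exact ⟨n, by simp at hn; linarith⟩
  choose n hn using h
  have : x = WithLp.toLp 2 (fun i => (AddCircle.equivIoc (1 : ℝ) 0 (toTorus x i)).1) +
      WithLp.toLp 2 (fun i => (n i : ℝ)) := by
    ext i; exact hn i
  conv_rhs => rw [this, hf.add_int]
  rfl

/-- The representative chosen in `descend` jumps, but the projection of ℝ^d onto the torus is open,
hence a quotient map, and composing with it gives back f. -/
theorem Periodic1.continuous_descend {E : Type} [TopologicalSpace E] {f : X d → E}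
    (hf : Periodic1 f) (hc : Continuous f) : Continuous (descend f) := by
  have hq : IsOpenQuotientMap (Pi.map fun (_ : Fin d) (x : ℝ) => (x : UnitAddCircle)) :=
    IsOpenQuotientMap.piMap fun _ => QuotientAddGroup.isOpenQuotientMap_mk
  rw [hq.isQuotientMap.continuous_iff]
  have : descend f ∘ (Pi.map fun (_ : Fin d) (x : ℝ) => (x : UnitAddCircle)) =
      fun x : Fin d → ℝ => f (WithLp.toLp 2 x) := by
    funext x
    exact hf.descend_toTorus (WithLp.toLp 2 x)
  rw [this]
  fun_prop

section Integral

variable {E : Type} [NormedAddCommGroup E] [NormedSpace ℝ E]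

theorem Periodic1.integral_descend {f : X d → E} (hf : Periodic1 f) :
    ∫ t, descend f t = ∫ x in cube d, f x := by
  rw [UnitAddTorus.integral_preimage (descend f) 0, setIntegral_cube_eq_Ioc]
  refine setIntegral_congr_fun (MeasurableSet.univ_pi' fun i => measurableSet_Ioc) fun x _ => ?_
  exact hf.descend_toTorus (WithLp.toLp 2 x)

theorem Periodic1.comp_add {F : Type} {f : X d → F} (hf : Periodic1 f) (h : X d) :
    Periodic1 fun x => f (x + h) := fun i x => by
  simp only [add_right_comm x (e i) h, hf i (x + h)]

/-- The torus integral may be computed over the unit cube based at any point; basing it at h and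
shifting the cube back to the origin produces the translate. -/
theorem Periodic1.integral_comp_add {f : X d → E} (hf : Periodic1 f) (h : X d) :
    ∫ x in cube d, f (x + h) = ∫ x in cube d, f x := by
  rw [← hf.integral_descend, UnitAddTorus.integral_preimage (descend f) h,
    setIntegral_cube_eq_Ioc]
  have hm : MeasurePreserving (fun x : Fin d → ℝ => x + h.ofLp) volume volume :=
    measurePreserving_add_right volume _
  rw [← hm.setIntegral_preimage_emb (measurableEmbedding_addRight _)
    (fun y => descend f fun i => (y i : UnitAddCircle))]
  have hs : (fun x : Fin d → ℝ => x + h.ofLp) ⁻¹' {x | ∀ i, x i ∈ Ioc (h i) (h i + 1)} =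
      {x | ∀ i, x i ∈ Ioc (0 : ℝ) (0 + 1)} := by
    ext x
    simp only [mem_preimage, mem_ofPred_eq, Pi.add_apply, mem_Ioc]
    refine forall_congr' fun i => ?_
    constructor <;> rintro ⟨h1, h2⟩ <;> constructor <;> linarith
  rw [hs]
  refine setIntegral_congr_fun (MeasurableSet.univ_pi' fun i => measurableSet_Ioc) fun x _ => ?_
  exact (hf.descend_toTorus (WithLp.toLp 2 (x + h.ofLp))).symm

theorem HasLineDerivAt.hasDerivAt_line {f : X d → E} {x w : X d} {t : ℝ} {f' : E}
    (h : HasLineDerivAt ℝ f f' (x + t • w) w) : HasDerivAt (fun s : ℝ => f (x + s • w)) f' t := by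
  rw [HasLineDerivAt] at h
  have h2 : HasDerivAt (fun r : ℝ => f (x + t • w + r • w)) f' (t - t) := by simpa using h
  refine (h2.comp_sub_const t t).congr_of_eventuallyEq (Eventually.of_forall fun r => ?_)
  simp only [add_assoc, ← add_smul]
  congr 3
  ring

/-- The integral over the torus of a directional derivative vanishes. -/
theorem Periodic1.integral_lineDeriv [CompleteSpace E] {f f' : X d → E} (hf : Periodic1 f)
    (hf' : Periodic1 f') (hc : Continuous f) (hc' : Continuous f') (w : X d)
    (hd : ∀ x, HasLineDerivAt ℝ f (f' x) x w) : ∫ x in cube d, f' x = 0 := by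
  obtain ⟨C, hC⟩ := hf'.exists_norm_le hc'
  have hder : ∀ (x : X d) (s : ℝ), HasDerivAt (fun s : ℝ => f (x + s • w)) (f' (x + s • w)) s := by
    intro x s
    exact HasLineDerivAt.hasDerivAt_line (hd _)
  have key := hasDerivAt_integral_of_dominated_loc_of_deriv_le (μ := cubeMeasure d)
    (F := fun (s : ℝ) k => f (cubeIncl d k + s • w))
    (F' := fun (s : ℝ) k => f' (cubeIncl d k + s • w)) (x₀ := 0) (s := univ) (bound := fun _ => C)
    univ_mem
    (Eventually.of_forall fun s => (by fun_prop : Continuous _).aestronglyMeasurable)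
    (integrable_cube (f := fun x => f (x + (0 : ℝ) • w)) (by fun_prop))
    ((by fun_prop : Continuous _).aestronglyMeasurable)
    (Eventually.of_forall fun k s _ => hC _) (integrable_const C)
    (Eventually.of_forall fun k s _ => hder _ s)
  -- Translation invariance makes the integral of f(x + s w) independent of s, while its derivative
  -- at s = 0 is the integral of f'.
  have hconst : (fun s : ℝ => ∫ k, f (cubeIncl d k + s • w) ∂(cubeMeasure d)) =
      fun _ => ∫ x in cube d, f x := by
    funext s
    rw [← hf.integral_comp_add (s • w), setIntegral_cube_eq]
  have h0 := key.2
  rw [hconst] at h0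
  have := h0.unique (hasDerivAt_const _ _)
  simpa [setIntegral_cube_eq] using this

end Integral

/-! ### Calculus of smooth functions on the torus -/

namespace TF

theorem periodic (f : TF d) : Periodic1 (f : X d → ℝ) := f.2.2

theorem contDiff (f : TF d) : ContDiff ℝ ∞ (f : X d → ℝ) := f.2.1

theorem continuous (f : TF d) : Continuous (f : X d → ℝ) := f.contDiff.continuous

theorem ext {f g : TF d} (h : ∀ x, f x = g x) : f = g := Subtype.ext (funext h)

@[simp] theorem add_apply (f g : TF d) (x : X d) : (f + g) x = f x + g x := rfl
@[simp] theorem sub_apply (f g : TF d) (x : X d) : (f - g) x = f x - g x := rfl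
@[simp] theorem neg_apply (f : TF d) (x : X d) : (-f) x = -f x := rfl
@[simp] theorem mul_apply (f g : TF d) (x : X d) : (f * g) x = f x * g x := rfl
@[simp] theorem smul_apply (c : ℝ) (f : TF d) (x : X d) : (c • f) x = c * f x := rfl
@[simp] theorem zero_apply (x : X d) : (0 : TF d) x = 0 := rfl
@[simp] theorem algebraMap_apply (c : ℝ) (x : X d) : (algebraMap ℝ (TF d) c) x = c := rfl

@[simp] theorem sum_apply {ι : Type} (s : Finset ι) (f : ι → TF d) (x : X d) :
    (∑ i ∈ s, f i : TF d) x = ∑ i ∈ s, f i x := by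
  rw [AddSubmonoidClass.coe_finsetSum, Finset.sum_apply]

end TF

theorem pd_apply (i : Fin d) (f : TF d) (x : X d) :
    pd i f x = fderiv ℝ (f : X d → ℝ) x (e i) := rfl

theorem hasLineDerivAt_pd (i : Fin d) (f : TF d) (x : X d) :
    HasLineDerivAt ℝ (f : X d → ℝ) (pd i f x) x (e i) :=
  (f.differentiable x).hasFDerivAt.hasLineDerivAt _

theorem pd_eq_of_hasLineDerivAt {i : Fin d} {f : TF d} {x : X d} {c : ℝ}
    (h : HasLineDerivAt ℝ (f : X d → ℝ) c x (e i)) : pd i f x = c :=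
  (hasLineDerivAt_pd i f x).unique h

theorem pd_mul (i : Fin d) (f g : TF d) : pd i (f * g) = pd i f * g + f * pd i g := by
  refine TF.ext fun x => pd_eq_of_hasLineDerivAt ?_
  simpa [HasLineDerivAt] using! (hasLineDerivAt_pd i f x).mul (hasLineDerivAt_pd i g x)

@[simp] theorem pd_algebraMap (i : Fin d) (c : ℝ) : pd i (algebraMap ℝ (TF d) c) = 0 := by
  refine TF.ext fun x => pd_eq_of_hasLineDerivAt ?_
  exact hasDerivAt_const _ _

theorem pd_comm (i j : Fin d) (f : TF d) : pd i (pd j f) = pd j (pd i f) := by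
  have key : ∀ (i j : Fin d) (x : X d),
      pd i (pd j f) x = fderiv ℝ (fderiv ℝ (f : X d → ℝ)) x (e i) (e j) := by
    intro i j x
    have h1 : DifferentiableAt ℝ (fderiv ℝ (f : X d → ℝ)) x :=
      ((f.contDiff.fderiv_right (m := ∞) (by simp)).differentiable (by simp)) x
    have h2 : HasFDerivAt (fun y => fderiv ℝ (f : X d → ℝ) y (e j)) _ x :=
      h1.hasFDerivAt.clm_apply (hasFDerivAt_const (e j) x)
    have h3 : pd i (pd j f) x = fderiv ℝ (fun y => fderiv ℝ (f : X d → ℝ) y (e j)) x (e i) := rfl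
    rw [h3, h2.fderiv]
    simp
  refine TF.ext fun x => ?_
  rw [key, key]
  exact (f.contDiff.contDiffAt.isSymmSndFDerivAt (by simp; exact WithTop.coe_le_coe.2 (le_top : (2 : ℕ∞) ≤ ⊤))) _ _

/-! ### Integrals of smooth functions -/

theorem intT_eq (f : X d → ℝ) : intT f = ∫ k, f (cubeIncl d k) ∂(cubeMeasure d) :=
  setIntegral_cube_eq f

/-- Integration over the torus as a linear map. -/
def intL (d : ℕ) : TF d →ₗ[ℝ] ℝ where
  toFun f := intT (f : X d → ℝ)
  map_add' f g := by
    simp only [intT_eq]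
    exact integral_add (integrable_cube f.continuous) (integrable_cube g.continuous)
  map_smul' c f := by
    simp only [intT_eq]
    exact integral_const_mul _ _

theorem intL_apply (f : TF d) : intL d f = intT (f : X d → ℝ) := rfl

theorem intL_algebraMap (c : ℝ) : intL d (algebraMap ℝ (TF d) c) = c := by
  have := setIntegral_cube_const (d := d) c
  exact this

theorem intL_pd (i : Fin d) (f : TF d) : intL d (pd i f) = 0 :=
  f.periodic.integral_lineDeriv (pd i f).periodic f.continuous (pd i f).continuous (e i)
    (hasLineDerivAt_pd i f)

theorem intL_pd_mul (i : Fin d) (f g : TF d) : intL d (pd i f * g) = -intL d (f * pd i g) := by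
  have := intL_pd i (f * g)
  rw [pd_mul, map_add] at this
  linarith

theorem intL_divT (v : Fin d → TF d) : intL d (divT v) = 0 := by
  simp [divT, intL_pd]

theorem intL_divGrad (ρ : Density d) (Φ : TF d) : intL d (divGrad ρ Φ) = 0 := intL_divT _

theorem intL_divT_mul (v : Fin d → TF d) (g : TF d) :
    intL d (divT v * g) = -intL d (∑ i, v i * pd i g) := by
  simp [divT, Finset.sum_mul, intL_pd_mul]

local instance : Measure.IsAddHaarMeasure (volume : Measure UnitAddCircle) :=
  inferInstanceAs (Measure.IsAddHaarMeasure AddCircle.haarAddCircle)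

/-- On the torus, Haar measure charges every nonempty open set, so points on the boundary of the
cube or outside it need no separate argument. -/
theorem Periodic1.eq_zero_of_integral_eq_zero {f : X d → ℝ} (hf : Periodic1 f)
    (hc : Continuous f) (h0 : ∀ x, 0 ≤ f x) (h : ∫ x in cube d, f x = 0) (x : X d) : f x = 0 := by
  by_contra hx
  rw [← hf.integral_descend] at h
  refine absurd h (ne_of_gt ?_)
  refine integral_pos_of_integrable_nonneg_nonzero (x := toTorus x) (hf.continuous_descend hc)
    ((hf.continuous_descend hc).integrable_of_hasCompactSupport
      (HasCompactSupport.of_compactSpace _)) (fun t => h0 _) ?_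
  rwa [hf.descend_toTorus]

theorem eq_zero_of_intL_eq_zero {f : TF d} (h0 : ∀ x, 0 ≤ f x) (h : intL d f = 0) : f = 0 :=
  TF.ext (f.periodic.eq_zero_of_integral_eq_zero f.continuous h0 h)

/-- A function of weighted-divergence zero gradient is constant. -/
theorem pd_eq_zero_of_divGrad_eq_zero {ρ : Density d} {Φ : TF d} (h : divGrad ρ Φ = 0)
    (i : Fin d) : pd i Φ = 0 := by
  -- Testing against Φ itself yields ∫ ρ |∇Φ|² = 0 with ρ positive.
  have h1 := intL_divT_mul (fun i => ρ.toTF * pd i Φ) Φ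
  have h2 : divT (fun i => ρ.toTF * pd i Φ) = 0 := h
  rw [h2, zero_mul, map_zero, zero_eq_neg] at h1
  have h3 := eq_zero_of_intL_eq_zero (f := ∑ i, ρ.toTF * pd i Φ * pd i Φ) (fun x => by
    simp only [TF.sum_apply, TF.mul_apply]
    exact Finset.sum_nonneg fun i _ => by
      rw [mul_assoc]; exact mul_nonneg (ρ.pos x).le (mul_self_nonneg _)) h1
  refine TF.ext fun x => ?_
  have h4 : ∑ i, ρ.toTF x * pd i Φ x * pd i Φ x = 0 := by
    have := congrArg (fun f : TF d => f x) h3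
    simpa only [TF.sum_apply, TF.mul_apply, TF.zero_apply] using this
  rw [Finset.sum_eq_zero_iff_of_nonneg fun i _ => by
    rw [mul_assoc]; exact mul_nonneg (ρ.pos x).le (mul_self_nonneg _)] at h4
  have := h4 i (Finset.mem_univ _)
  have hp := (ρ.pos x).ne'
  simpa [hp] using this

theorem divGrad_add (ρ : Density d) (Φ Ψ : TF d) :
    divGrad ρ (Φ + Ψ) = divGrad ρ Φ + divGrad ρ Ψ := by
  simp [divGrad, divT, mul_add, Finset.sum_add_distrib]

theorem divGrad_sub (ρ : Density d) (Φ Ψ : TF d) :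
    divGrad ρ (Φ - Ψ) = divGrad ρ Φ - divGrad ρ Ψ := by
  simp [divGrad, divT, mul_sub, Finset.sum_sub_distrib]

theorem intL_divGrad_mul (ρ : Density d) (Φ g : TF d) :
    intL d (divGrad ρ Φ * g) = -intL d (∑ i, ρ.toTF * pd i Φ * pd i g) :=
  intL_divT_mul _ _

/-! ### Smooth families -/

section SmoothFam

variable {V W : Type} [NormedAddCommGroup V] [NormedSpace ℝ V] [NormedAddCommGroup W]
  [NormedSpace ℝ W] {S : Set V} {f g : V → TF d}

namespace SmoothFam

theorem congr (hf : SmoothFam S f) (h : ∀ v ∈ S, g v = f v) : SmoothFam S g :=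
  ContDiffOn.congr hf fun p hp => by rw [h p.1 hp.1]

theorem const (f : TF d) : SmoothFam S fun _ => f :=
  (f.contDiff.comp contDiff_snd).contDiffOn

theorem algebraMap {c : V → ℝ} (hc : ContDiffOn ℝ ∞ c S) :
    SmoothFam S fun v => algebraMap ℝ (TF d) (c v) :=
  hc.comp contDiffOn_fst fun _ hp => hp.1

theorem add (hf : SmoothFam S f) (hg : SmoothFam S g) : SmoothFam S fun v => f v + g v :=
  ContDiffOn.add hf hg

theorem neg (hf : SmoothFam S f) : SmoothFam S fun v => -f v := ContDiffOn.neg hf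

theorem sub (hf : SmoothFam S f) (hg : SmoothFam S g) : SmoothFam S fun v => f v - g v :=
  ContDiffOn.sub hf hg

theorem mul (hf : SmoothFam S f) (hg : SmoothFam S g) : SmoothFam S fun v => f v * g v :=
  ContDiffOn.mul hf hg

theorem smul {c : V → ℝ} (hc : ContDiffOn ℝ ∞ c S) (hf : SmoothFam S f) :
    SmoothFam S fun v => c v • f v :=
  ContDiffOn.mul (hc.comp contDiffOn_fst fun _ hp => hp.1) hf

theorem sum {ι : Type} (s : Finset ι) {F : ι → V → TF d} (hF : ∀ i ∈ s, SmoothFam S (F i)) :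
    SmoothFam S fun v => ∑ i ∈ s, F i v := by
  have := ContDiffOn.sum hF
  refine ContDiffOn.congr this fun p _ => ?_
  simp only [TF.sum_apply]

theorem comp (hf : SmoothFam S f) {T : Set W} {c : W → V} (hc : ContDiffOn ℝ ∞ c T)
    (hT : ∀ w ∈ T, c w ∈ S) : SmoothFam T fun w => f (c w) :=
  ContDiffOn.comp (g := fun p : V × X d => f p.1 p.2) (f := fun q : W × X d => (c q.1, q.2)) hf
    ((hc.comp contDiffOn_fst fun _ hp => hp.1).prodMk contDiffOn_snd)
    fun _ hq => ⟨hT _ hq.1, mem_univ _⟩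

theorem eval (hf : SmoothFam S f) (x : X d) : ContDiffOn ℝ ∞ (fun v => f v x) S :=
  ContDiffOn.comp (g := fun p : V × X d => f p.1 p.2) (f := fun v => (v, x)) hf
    (contDiffOn_id.prodMk contDiffOn_const) fun _ hv => ⟨hv, mem_univ _⟩

theorem pd (hS : UniqueDiffOn ℝ S) (hf : SmoothFam S f) (i : Fin d) :
    SmoothFam S fun v => pd i (f v) := by
  have h1 : ContDiffOn ℝ ∞ (fun p => fderivWithin ℝ (fun p : V × X d => f p.1 p.2)
      (S ×ˢ univ) p ((0 : V), (e i : X d))) (S ×ˢ univ) :=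
    (ContDiffOn.fderivWithin hf (hS.prod uniqueDiffOn_univ) (by simp)).clm_apply contDiffOn_const
  refine ContDiffOn.congr h1 fun p hp => pd_eq_of_hasLineDerivAt ?_
  have h2 := (ContDiffOn.differentiableOn hf (by simp) p hp).hasFDerivWithinAt
  have h3 : HasFDerivWithinAt (fun y : X d => (p.1, y)) (ContinuousLinearMap.inr ℝ V (X d))
      univ p.2 := by
    simpa using! (hasFDerivWithinAt_const p.1 p.2 univ).prodMk (hasFDerivWithinAt_id p.2 univ)
  have h4 := HasFDerivWithinAt.comp (g := fun p : V × X d => (f p.1 : X d → ℝ) p.2)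
    (t := S ×ˢ univ) p.2 h2 h3 fun y _ => mk_mem_prod hp.1 (mem_univ y)
  rw [hasFDerivWithinAt_univ] at h4
  exact h4.hasLineDerivAt (e i)

theorem divT (hS : UniqueDiffOn ℝ S) {F : Fin d → V → TF d} (hF : ∀ i, SmoothFam S (F i)) :
    SmoothFam S fun v => divT fun i => F i v :=
  SmoothFam.sum _ fun i _ => (hF i).pd hS i

theorem divGrad (hS : UniqueDiffOn ℝ S) {ρ : V → Density d}
    (hρ : SmoothFam S fun v => (ρ v).toTF) (hf : SmoothFam S f) :
    SmoothFam S fun v => divGrad (ρ v) (f v) :=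
  SmoothFam.divT hS fun i => hρ.mul (hf.pd hS i)

end SmoothFam

/-! ### Smooth dependence of integrals on parameters -/

/-- The restriction of a smooth function to the unit cube. -/
def TF.toCube (f : TF d) : C(Cube d, ℝ) :=
  ⟨fun k => f (cubeIncl d k), f.continuous.comp (cubeIncl d).continuous⟩

theorem SmoothFam.toCube (hf : SmoothFam S f) (hS : Convex ℝ S) (hS' : UniqueDiffOn ℝ S) :
    ContDiffOn ℝ ∞ (fun v => (f v).toCube) S :=
  contDiffOn_curry hS hS' uniqueDiffOn_univ (cubeIncl d) (fun _ => mem_univ _) hf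
    fun _ _ _ => rfl

/-- Integration over the cube as a continuous linear map. -/
def cubeIntegral (d : ℕ) : C(Cube d, ℝ) →L[ℝ] ℝ :=
  LinearMap.mkContinuous
    { toFun := fun h => ∫ k, h k ∂(cubeMeasure d)
      map_add' := fun g h => integral_add
        (g.continuous.integrable_of_hasCompactSupport (HasCompactSupport.of_compactSpace _))
        (h.continuous.integrable_of_hasCompactSupport (HasCompactSupport.of_compactSpace _))
      map_smul' := fun c h => integral_const_mul _ _ } 1 fun h => by
    simpa [mul_comm] using! norm_integral_le_of_norm_le_const (μ := cubeMeasure d)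
      (Eventually.of_forall fun k => h.norm_coe_le_norm k)

theorem cubeIntegral_toCube (f : TF d) : cubeIntegral d f.toCube = intL d f := (intT_eq _).symm

theorem SmoothFam.intL (hf : SmoothFam S f) (hS : Convex ℝ S) (hS' : UniqueDiffOn ℝ S) :
    ContDiffOn ℝ ∞ (fun v => intL d (f v)) S := by
  simp only [← cubeIntegral_toCube]
  exact (cubeIntegral d).contDiff.comp_contDiffOn (hf.toCube hS hS')

/-- Differentiation under the integral sign. -/
theorem SmoothFam.hasDerivAt_intL {f : ℝ → TF d} (hf : SmoothFam univ f) {f' : TF d} {s : ℝ}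
    (hf' : ∀ x, HasDerivAt (fun r => f r x) (f' x) s) :
    HasDerivAt (fun r => TransportHessian.intL d (f r)) (TransportHessian.intL d f') s := by
  have h1 := (((hf.toCube convex_univ uniqueDiffOn_univ).differentiableOn (by simp)) s
    (mem_univ s)).hasFDerivWithinAt
  rw [hasFDerivWithinAt_univ] at h1
  have h2 := h1.hasDerivAt
  -- Evaluation at a point is continuous for the sup norm, so the sup-norm derivative must agree
  -- with the given pointwise one.
  have h3 : fderivWithin ℝ (fun v => (f v).toCube) univ s 1 = f'.toCube := by
    ext k
    have h4 := ((ContinuousMap.evalCLM ℝ k).hasFDerivAt.comp_hasDerivAt s h2)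
    exact h4.unique (hf' (cubeIncl d k))
  rw [h3] at h2
  have h5 := (cubeIntegral d).hasFDerivAt.comp_hasDerivAt s h2
  simpa only [cubeIntegral_toCube, Function.comp_def] using! h5

end SmoothFam

/-! ### Characters and absolutely convergent Fourier series -/

/-- The character `x ↦ exp (2 π i n · x)`. -/
def ee (n : Fin d → ℤ) (x : X d) : ℂ := UnitAddTorus.mFourier n (toTorus x)

theorem ee_eq_exp (n : Fin d → ℤ) (x : X d) :
    ee n x = Complex.exp (∑ i, 2 * Real.pi * Complex.I * n i * x i) := by
  rw [Complex.exp_sum]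
  simp only [ee, UnitAddTorus.mFourier, ContinuousMap.coe_mk, toTorus]
  refine Finset.prod_congr rfl fun i _ => ?_
  rw [fourier_coe_apply]
  simp

theorem ee_zero_left (x : X d) : ee 0 x = 1 := by simp [ee_eq_exp]

theorem ee_add_left (m n : Fin d → ℤ) (x : X d) : ee (m + n) x = ee m x * ee n x :=
  UnitAddTorus.mFourier_add

theorem ee_add_right (n : Fin d → ℤ) (x y : X d) : ee n (x + y) = ee n x * ee n y := by
  simp only [ee_eq_exp, ← Complex.exp_add, ← Finset.sum_add_distrib]
  congr 1
  refine Finset.sum_congr rfl fun i _ => ?_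
  push_cast [PiLp.add_apply]
  ring

theorem norm_ee (n : Fin d → ℤ) (x : X d) : ‖ee n x‖ = 1 := by
  simp [ee, UnitAddTorus.mFourier, Circle.norm_coe]

theorem continuous_ee (n : Fin d → ℤ) : Continuous (ee n) := by
  rw [show ee n = _ from funext (ee_eq_exp n)]
  fun_prop

theorem periodic1_ee (n : Fin d → ℤ) : Periodic1 (ee n) := by
  intro i x
  have : toTorus (x + e i) = toTorus x := by
    funext j
    rcases eq_or_ne j i with rfl | h
    · simp [toTorus]
    · simp [toTorus, h]
  simp [ee, this]

theorem hasLineDerivAt_ee (n : Fin d → ℤ) (i : Fin d) (x : X d) :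
    HasLineDerivAt ℝ (ee n) (2 * Real.pi * Complex.I * n i * ee n x) x (e i) := by
  have h1 : ∀ t : ℝ, ee n (x + t • e i) =
      ee n x * Complex.exp (2 * Real.pi * Complex.I * n i * t) := by
    intro t
    rw [ee_add_right, ee_eq_exp n (t • e i)]
    congr 2
    rw [Finset.sum_eq_single i]
    · simp
    · intro j _ hj; simp [hj]
    · simp
  have h2 : HasDerivAt (fun t : ℝ => Complex.exp (2 * Real.pi * Complex.I * n i * t))
      (Complex.exp (2 * Real.pi * Complex.I * n i * (0 : ℝ)) *
        (2 * Real.pi * Complex.I * n i * 1)) 0 :=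
    ((Complex.ofRealCLM.hasDerivAt (x := (0 : ℝ))).const_mul _).cexp
  rw [HasLineDerivAt, funext h1]
  convert! h2.const_mul (ee n x) using 1
  simp; ring

/-- If some n i is nonzero, the character is a nonzero multiple of its own i-th derivative, and
derivatives integrate to zero. -/
theorem integral_ee (n : Fin d → ℤ) : ∫ x in cube d, ee n x = if n = 0 then 1 else 0 := by
  split_ifs with h
  · subst h
    simp only [ee_zero_left]
    exact setIntegral_cube_const 1
  · obtain ⟨i, hi⟩ : ∃ i, n i ≠ 0 := by
      by_contra! hc; exact h (funext hc)
    have h1 := (periodic1_ee n).integral_lineDeriv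
      (f' := fun x => 2 * Real.pi * Complex.I * n i * ee n x)
      (fun j x => by simp only [periodic1_ee n j x]) (continuous_ee n)
      (continuous_const.mul (continuous_ee n)) (e i) (hasLineDerivAt_ee n i)
    rw [integral_const_mul] at h1
    simpa [hi, Real.pi_ne_zero] using h1

/-- The space `ℓ¹(ℤ^d)` of coefficients of absolutely convergent Fourier series. -/
abbrev Wiener (d : ℕ) : Type := lp (fun _ : Fin d → ℤ => ℂ) 1

namespace Wiener

theorem summable_norm (y : Wiener d) : Summable fun n => ‖y n‖ := by
  simpa using (lp.memℓp y).summable (by simp)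

theorem summable (y : Wiener d) : Summable fun n => y n := y.summable_norm.of_norm

theorem norm_eq (y : Wiener d) : ‖y‖ = ∑' n, ‖y n‖ := by
  simpa using lp.norm_eq_tsum_rpow (by simp) y

theorem memℓp {y : (Fin d → ℤ) → ℂ} (h : Summable fun n => ‖y n‖) :
    Memℓp (E := fun _ : Fin d → ℤ => ℂ) y 1 := memℓp_gen (by simpa using h)

/-- The element of `ℓ¹` with given absolutely summable coefficients. -/
def mk (y : (Fin d → ℤ) → ℂ) (h : Summable fun n => ‖y n‖) : Wiener d := ⟨y, memℓp h⟩

@[simp] theorem mk_apply (y : (Fin d → ℤ) → ℂ) (h : Summable fun n => ‖y n‖) (n : Fin d → ℤ) :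
    mk y h n = y n := rfl

theorem ext {y z : Wiener d} (h : ∀ n, y n = z n) : y = z := lp.ext (funext h)

@[simp] theorem add_apply (y z : Wiener d) (n : Fin d → ℤ) : (y + z) n = y n + z n := rfl
@[simp] theorem csmul_apply (c : ℂ) (y : Wiener d) (n : Fin d → ℤ) : (c • y) n = c * y n := rfl
@[simp] theorem rsmul_apply (c : ℝ) (y : Wiener d) (n : Fin d → ℤ) : (c • y) n = c • y n := rfl

theorem summable_diag (r : (Fin d → ℤ) → ℂ) {C : ℝ} (h : ∀ n, ‖r n‖ ≤ C) (y : Wiener d) :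
    Summable fun n => ‖r n * y n‖ :=
  (y.summable_norm.mul_left C).of_nonneg_of_le (fun _ => norm_nonneg _) fun n => by
    rw [norm_mul]; gcongr; exact h n

/-- The Fourier multiplier with a bounded symbol. -/
def diag (r : (Fin d → ℤ) → ℂ) (C : ℝ) (h : ∀ n, ‖r n‖ ≤ C) : Wiener d →L[ℂ] Wiener d :=
  LinearMap.mkContinuous
    { toFun := fun y => mk (fun n => r n * y n) (summable_diag r h y)
      map_add' := fun y z => ext fun n => by simp [mul_add]
      map_smul' := fun c y => ext fun n => by simp; ring } C fun y => by
    rw [norm_eq, norm_eq, ← tsum_mul_left]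
    refine (summable_diag r h y).tsum_le_tsum (fun n => ?_) (y.summable_norm.mul_left C)
    change ‖r n * y n‖ ≤ _
    rw [norm_mul]; gcongr; exact h n

@[simp] theorem diag_apply (r : (Fin d → ℤ) → ℂ) (C : ℝ) (h : ∀ n, ‖r n‖ ≤ C) (y : Wiener d)
    (n : Fin d → ℤ) : diag r C h y n = r n * y n := rfl

theorem norm_diag_le (r : (Fin d → ℤ) → ℂ) (C : ℝ) (h : ∀ n, ‖r n‖ ≤ C) : ‖diag r C h‖ ≤ C :=
  LinearMap.mkContinuous_norm_le _ ((norm_nonneg _).trans (h 0)) _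

/-- The value at `x` of the Fourier series with given coefficients. -/
def ev (x : X d) : Wiener d →L[ℂ] ℂ :=
  (lp.tsumCLM ℂ (Fin d → ℤ) ℂ).comp (diag (fun n => ee n x) 1 fun n => (norm_ee n x).le)

theorem ev_apply (x : X d) (y : Wiener d) : ev x y = ∑' n, ee n x * y n := rfl

theorem summable_ev (x : X d) (y : Wiener d) : Summable fun n => ee n x * y n :=
  (summable_diag _ (fun n => (norm_ee n x).le) y).of_norm

theorem periodic1_ev (y : Wiener d) : Periodic1 fun x => ev x y := fun i x => by
  simp only [ev_apply, periodic1_ee _ i x]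

theorem continuous_ev (y : Wiener d) : Continuous fun x => ev x y := by
  simp only [ev_apply]
  exact continuous_tsum (fun n => (continuous_ee n).mul continuous_const) y.summable_norm
    fun n x => by rw [norm_mul, norm_ee, one_mul]

theorem hasLineDerivAt_ev {y z : Wiener d} (i : Fin d)
    (h : ∀ n, z n = 2 * Real.pi * Complex.I * n i * y n) (x : X d) :
    HasLineDerivAt ℝ (fun x => ev x y) (ev x z) x (e i) := by
  have hder : ∀ (n : Fin d → ℤ) (t : ℝ), HasDerivAt (fun t : ℝ => ee n (x + t • e i) * y n)
      (ee n (x + t • e i) * z n) t := by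
    intro n t
    have h3 := HasLineDerivAt.hasDerivAt_line (hasLineDerivAt_ee n i (x + t • e i))
    convert! h3.mul_const (y n) using 1
    rw [h]; ring
  have := hasDerivAt_tsum (u := fun n => ‖z n‖) z.summable_norm hder
    (fun n t => by rw [norm_mul, norm_ee, one_mul]) (y₀ := 0)
    (summable_ev (x + (0 : ℝ) • e i) y) 0
  simpa [HasLineDerivAt, ev_apply] using! this

/-- Translation of coefficients. -/
def shift (m : Fin d → ℤ) (y : Wiener d) : Wiener d :=
  mk (fun n => y (n - m)) ((Equiv.subRight m).summable_iff.2 y.summable_norm)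

@[simp] theorem shift_apply (m n : Fin d → ℤ) (y : Wiener d) : shift m y n = y (n - m) := rfl

theorem norm_shift (m : Fin d → ℤ) (y : Wiener d) : ‖shift m y‖ = ‖y‖ := by
  rw [norm_eq, norm_eq]
  exact (Equiv.subRight m).tsum_eq fun n => ‖y n‖

theorem ev_shift (x : X d) (m : Fin d → ℤ) (y : Wiener d) :
    ev x (shift m y) = ee m x * ev x y := by
  rw [ev_apply, ev_apply, ← tsum_mul_left, ← (Equiv.addRight m).tsum_eq]
  refine tsum_congr fun n => ?_
  simp [ee_add_left]; ring

theorem summable_conv (y z : Wiener d) : Summable fun m => ‖z m • shift m y‖ := by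
  simp only [norm_smul, norm_shift]
  exact z.summable_norm.mul_right _

/-- Convolution of coefficients. -/
def conv (d : ℕ) : Wiener d →L[ℝ] Wiener d →L[ℝ] Wiener d :=
  LinearMap.mkContinuous₂
    (LinearMap.mk₂ ℝ (fun y z : Wiener d => ∑' m, z m • shift m y)
      (fun y y' z => by
        rw [← (summable_conv y z).of_norm.tsum_add (summable_conv y' z).of_norm]
        refine tsum_congr fun m => ext fun n => by simp [mul_add])
      (fun c y z => by
        rw [← (summable_conv y z).of_norm.tsum_const_smul]
        refine tsum_congr fun m => ext fun n => by simp; ring)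
      (fun y z z' => by
        rw [← (summable_conv y z).of_norm.tsum_add (summable_conv y z').of_norm]
        refine tsum_congr fun m => ext fun n => by simp [add_mul])
      (fun c y z => by
        rw [← (summable_conv y z).of_norm.tsum_const_smul]
        refine tsum_congr fun m => ext fun n => by simp; ring)) 1 fun y z => by
    refine (norm_tsum_le_tsum_norm (summable_conv y z)).trans ?_
    simp only [norm_smul, norm_shift]
    rw [tsum_mul_right, norm_eq z, one_mul, mul_comm]

/-- Convolution superposes shifts, and a shift by m multiplies the series by the m-th character. -/
theorem ev_conv (x : X d) (y z : Wiener d) : ev x (conv d y z) = ev x y * ev x z := by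
  have : conv d y z = ∑' m, z m • shift m y := rfl
  rw [this, (ev x).map_tsum (summable_conv y z).of_norm, ev_apply x z, ← tsum_mul_left]
  refine tsum_congr fun m => ?_
  rw [map_smul, ev_shift, smul_eq_mul]; ring

/-- Absolute summability permits termwise integration, and orthogonality of the characters leaves
one term. This makes the passage from coefficients to functions injective. -/
theorem integral_ev (m : Fin d → ℤ) (y : Wiener d) :
    ∫ x in cube d, ee (-m) x * ev x y = y m := by
  rw [setIntegral_cube_eq]
  have h1 : ∀ n, Integrable (fun k => ee (-m) (cubeIncl d k) * (ee n (cubeIncl d k) * y n))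
      (cubeMeasure d) := fun n =>
    integrable_cube (f := fun x => ee (-m) x * (ee n x * y n))
      ((continuous_ee _).mul ((continuous_ee _).mul continuous_const))
  have h2 := integral_tsum_of_summable_integral_norm h1 (by
    simpa [norm_mul, norm_ee] using y.summable_norm)
  simp only [ev_apply, ← tsum_mul_left]
  rw [← h2, tsum_eq_single m]
  · rw [← setIntegral_cube_eq (fun x => ee (-m) x * (ee m x * y m))]
    simp only [← mul_assoc, ← ee_add_left, neg_add_cancel, ee_zero_left, one_mul]
    exact setIntegral_cube_const _
  · intro n hn
    rw [← setIntegral_cube_eq (fun x => ee (-m) x * (ee n x * y n))]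
    simp only [← mul_assoc, ← ee_add_left]
    rw [integral_mul_const, integral_ee, if_neg, zero_mul]
    intro h
    exact hn (neg_add_eq_zero.1 h).symm

theorem eq_zero_of_ev {y : Wiener d} (h : ∀ x, ev x y = 0) : y = 0 :=
  ext fun m => by rw [← integral_ev m y]; simp [h]

end Wiener

/-! ### Fourier coefficients of smooth functions -/

theorem summable_int_inv : Summable fun n : ℤ => (1 + (n : ℝ) ^ 2)⁻¹ := by
  have h := (Real.summable_one_div_int_pow (p := 2)).2 (by norm_num)
  refine Summable.of_norm_bounded_eventually h ?_
  filter_upwards [(finite_singleton (0 : ℤ)).compl_mem_cofinite] with n hn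
  have hn' : (n : ℝ) ≠ 0 := by simpa using hn
  rw [Real.norm_of_nonneg (by positivity), one_div]
  gcongr
  linarith

theorem summable_prod_inv (d : ℕ) :
    Summable fun n : Fin d → ℤ => ∏ i, (1 + (n i : ℝ) ^ 2)⁻¹ := by
  induction d with
  | zero => exact summable_of_hasFiniteSupport (toFinite _)
  | succ d ih =>
    rw [← (Fin.consEquiv fun _ : Fin (d + 1) => ℤ).summable_iff]
    have := summable_int_inv.mul_of_nonneg ih (fun _ => by positivity)
      (fun _ => Finset.prod_nonneg fun _ _ => by positivity)
    refine this.congr fun p => ?_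
    simp [Fin.prod_univ_succ, mul_comm]

/-- The symbol of `1 - Δ / (4 π²)`. -/
def weight (n : Fin d → ℤ) : ℝ := 1 + ∑ i, (n i : ℝ) ^ 2

theorem one_le_weight (n : Fin d → ℤ) : 1 ≤ weight n := by
  have : 0 ≤ ∑ i, (n i : ℝ) ^ 2 := Finset.sum_nonneg fun _ _ => sq_nonneg _
  simp only [weight]; linarith

theorem weight_pos (n : Fin d → ℤ) : 0 < weight n := zero_lt_one.trans_le (one_le_weight n)

/-- Every factor 1 + n_i² is bounded by the weight, so its d-th power dominates the product over
coordinates. Hence d applications of `helmholtz` buy absolute convergence of the Fourier series. -/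
theorem summable_weight : Summable fun n : Fin d → ℤ => (weight n ^ d)⁻¹ := by
  refine (summable_prod_inv d).of_nonneg_of_le
    (fun n => inv_nonneg.2 (pow_nonneg (weight_pos n).le _)) fun n => ?_
  rw [Finset.prod_inv_distrib]
  refine inv_anti₀ (Finset.prod_pos fun _ _ => by positivity) ?_
  · calc ∏ i, (1 + (n i : ℝ) ^ 2) ≤ ∏ _i : Fin d, weight n := by
          refine Finset.prod_le_prod (fun _ _ => by positivity) fun i _ => ?_
          simp only [weight]
          gcongr
          exact Finset.single_le_sum (f := fun i => (n i : ℝ) ^ 2) (fun _ _ => sq_nonneg _)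
            (Finset.mem_univ i)
      _ = weight n ^ d := by simp

/-- The `n`-th Fourier coefficient. -/
def coeffCube (n : Fin d → ℤ) (h : C(Cube d, ℝ)) : ℂ :=
  ∫ k, ee (-n) (cubeIncl d k) * h k ∂(cubeMeasure d)

theorem integrable_coeff (n : Fin d → ℤ) (h : C(Cube d, ℝ)) :
    Integrable (fun k => ee (-n) (cubeIncl d k) * h k) (cubeMeasure d) := by
  have h1 : Continuous fun k => ee (-n) (cubeIncl d k) :=
    (continuous_ee (-n)).comp (cubeIncl d).continuous
  exact (h1.mul (Complex.continuous_ofReal.comp h.continuous)).integrable_of_hasCompactSupport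
    (HasCompactSupport.of_compactSpace _)

theorem norm_coeffCube_le (n : Fin d → ℤ) (h : C(Cube d, ℝ)) : ‖coeffCube n h‖ ≤ ‖h‖ := by
  have := norm_integral_le_of_norm_le_const (μ := cubeMeasure d)
    (f := fun k => ee (-n) (cubeIncl d k) * h k) (C := ‖h‖)
    (Eventually.of_forall fun k => by
      rw [norm_mul, norm_ee, one_mul, Complex.norm_real]; exact h.norm_coe_le_norm k)
  simpa using! this

theorem summable_weight_coeff (h : C(Cube d, ℝ)) :
    Summable fun n : Fin d → ℤ => ‖((weight n ^ d)⁻¹ : ℝ) * coeffCube n h‖ := by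
  refine (summable_weight.mul_right ‖h‖).of_nonneg_of_le (fun _ => norm_nonneg _) fun n => ?_
  rw [norm_mul, Complex.norm_real, Real.norm_of_nonneg
    (inv_nonneg.2 (pow_nonneg (weight_pos n).le _))]
  gcongr
  · exact inv_nonneg.2 (pow_nonneg (weight_pos n).le _)
  · exact norm_coeffCube_le n h

/-- The coefficients of `(1 - Δ / (4 π²))⁻ᵈ h`. -/
def smoothCoeff (d : ℕ) : C(Cube d, ℝ) →L[ℝ] Wiener d :=
  LinearMap.mkContinuous
    { toFun := fun h => Wiener.mk _ (summable_weight_coeff h)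
      map_add' := fun g h => Wiener.ext fun n => by
        simp only [Wiener.mk_apply, Wiener.add_apply, coeffCube, ContinuousMap.add_apply,
          Complex.ofReal_add, mul_add]
        rw [integral_add (integrable_coeff n g) (integrable_coeff n h), mul_add]
      map_smul' := fun c h => Wiener.ext fun n => by
        simp only [Wiener.mk_apply, Wiener.rsmul_apply, coeffCube, ContinuousMap.smul_apply,
          smul_eq_mul, Complex.ofReal_mul, RingHom.id_apply, Complex.real_smul]
        rw [mul_left_comm (c : ℂ), ← integral_const_mul (c : ℂ)]
        congr 2
        funext k; ring } (∑' n : Fin d → ℤ, (weight n ^ d)⁻¹) fun h => by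
    rw [Wiener.norm_eq, ← tsum_mul_right]
    refine (summable_weight_coeff h).tsum_le_tsum (fun n => ?_) (summable_weight.mul_right ‖h‖)
    change ‖((weight n ^ d)⁻¹ : ℝ) * coeffCube n h‖ ≤ _
    rw [norm_mul, Complex.norm_real, Real.norm_of_nonneg
      (inv_nonneg.2 (pow_nonneg (weight_pos n).le _))]
    gcongr
    · exact inv_nonneg.2 (pow_nonneg (weight_pos n).le _)
    · exact norm_coeffCube_le n h

theorem smoothCoeff_apply (h : C(Cube d, ℝ)) (n : Fin d → ℤ) :
    smoothCoeff d h n = ((weight n ^ d)⁻¹ : ℝ) * coeffCube n h := rfl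

theorem coeffCube_toCube (n : Fin d → ℤ) (f : TF d) :
    coeffCube n f.toCube = ∫ x in cube d, ee (-n) x * f x :=
  (setIntegral_cube_eq fun x => ee (-n) x * (f x : ℂ)).symm

theorem continuous_ofReal_comp (f : TF d) : Continuous fun x => (f x : ℂ) :=
  Complex.continuous_ofReal.comp f.continuous

/-- The derivative of the product of f with the character of -n integrates to zero; the product rule
then moves the derivative onto the character. -/
theorem coeffCube_pd (n : Fin d → ℤ) (i : Fin d) (f : TF d) :
    coeffCube n (pd i f).toCube = 2 * Real.pi * Complex.I * n i * coeffCube n f.toCube := by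
  have hper : ∀ g : TF d, Periodic1 fun x => ee (-n) x * (g x : ℂ) := fun g j x => by
    simp only [periodic1_ee (-n) j x, g.periodic j x]
  have hcont : ∀ g : TF d, Continuous fun x => ee (-n) x * (g x : ℂ) := fun g =>
    (continuous_ee _).mul (continuous_ofReal_comp g)
  have h1 := (hper f).integral_lineDeriv
    (f' := fun x => -(2 * Real.pi * Complex.I * n i) * (ee (-n) x * (f x : ℂ)) +
      ee (-n) x * (pd i f x : ℂ))
    (fun j x => by
      have h1 := hper f j x
      have h2 := hper (pd i f) j x
      simp only at h1 h2 ⊢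
      rw [h1, h2]) (hcont f)
    ((continuous_const.mul (hcont f)).add (hcont _)) (e i) (fun x => by
      have h1 := hasLineDerivAt_ee (-n) i x
      have h2 := hasLineDerivAt_pd i f x
      rw [HasLineDerivAt] at h1 h2 ⊢
      convert! h1.mul h2.ofReal_comp using 1
      simp; ring)
  rw [setIntegral_cube_eq, integral_add, integral_const_mul] at h1
  · change _ * coeffCube n f.toCube + coeffCube n (pd i f).toCube = 0 at h1
    linear_combination h1
  · exact (integrable_cube (hcont f)).const_mul _
  · exact integrable_cube (hcont (pd i f))

/-- The operator `1 - Δ / (4 π²)`. -/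
def helmholtz (f : TF d) : TF d := f - (1 / (4 * Real.pi ^ 2)) • ∑ i, pd i (pd i f)

theorem coeffCube_helmholtz (n : Fin d → ℤ) (f : TF d) :
    coeffCube n (helmholtz f).toCube = weight n * coeffCube n f.toCube := by
  have hcont : ∀ g : TF d, Continuous fun x => ee (-n) x * (g x : ℂ) := fun g =>
    (continuous_ee _).mul (continuous_ofReal_comp g)
  have hint : ∀ g : TF d, Integrable (fun k => ee (-n) (cubeIncl d k) * (g (cubeIncl d k) : ℂ))
      (cubeMeasure d) := fun g => integrable_cube (hcont g)
  have h1 : coeffCube n (helmholtz f).toCube = coeffCube n f.toCube -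
      (1 / (4 * Real.pi ^ 2) : ℝ) * ∑ i, coeffCube n (pd i (pd i f)).toCube := by
    simp only [coeffCube, TF.toCube, ContinuousMap.coe_mk]
    rw [← integral_finsetSum _ fun i _ => hint _, ← integral_const_mul, ← integral_sub (hint f)]
    · congr 1
      funext k
      simp only [helmholtz, TF.sub_apply, TF.smul_apply, TF.sum_apply, Complex.ofReal_sub,
        Complex.ofReal_mul, Complex.ofReal_sum, ← Finset.mul_sum]
      ring
    · exact (integrable_finsetSum _ fun i _ => hint _).const_mul _
  rw [h1]
  simp only [coeffCube_pd, weight]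
  have hpi : (Real.pi : ℂ) ≠ 0 := by simp [Real.pi_ne_zero]
  have h2 : ∀ i : Fin d, 2 * (Real.pi : ℂ) * Complex.I * n i *
      (2 * Real.pi * Complex.I * n i * coeffCube n f.toCube) =
      -(4 * Real.pi ^ 2) * ((n i : ℂ) ^ 2 * coeffCube n f.toCube) := fun i => by
    linear_combination (4 * (Real.pi : ℂ) ^ 2 * (n i : ℂ) ^ 2 * coeffCube n f.toCube) *
      Complex.I_sq
  simp only [h2, ← Finset.mul_sum, ← Finset.sum_mul]
  push_cast
  field_simp
  ring

theorem coeffCube_helmholtz_iterate (n : Fin d → ℤ) (f : TF d) (N : ℕ) :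
    coeffCube n (helmholtz^[N] f).toCube = weight n ^ N * coeffCube n f.toCube := by
  induction N with
  | zero => simp
  | succ N ih => rw [Function.iterate_succ_apply', coeffCube_helmholtz, ih, pow_succ']; ring

/-- The Fourier coefficients of a smooth function, as an element of `ℓ¹`. -/
def TF.hat (f : TF d) : Wiener d := smoothCoeff d (helmholtz^[d] f).toCube

/-- The weights cancel. The detour through `smoothCoeff` writes the coefficients as a continuous
linear image of a continuous function, so that smooth families have smooth coefficients in the ℓ¹
norm. -/
theorem TF.hat_apply (f : TF d) (n : Fin d → ℤ) : f.hat n = coeffCube n f.toCube := by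
  rw [TF.hat, smoothCoeff_apply, coeffCube_helmholtz_iterate]
  have : ((weight n : ℝ) : ℂ) ^ d ≠ 0 := pow_ne_zero _ (by exact_mod_cast (weight_pos n).ne')
  push_cast
  field_simp

/-- A smooth function is the sum of its Fourier series. -/
theorem TF.ev_hat (f : TF d) (x : X d) : Wiener.ev x f.hat = f x := by
  have hper : Periodic1 fun x => (f x : ℂ) := fun i x => by simp only [f.periodic i x]
  let g : C(UnitAddTorus (Fin d), ℂ) :=
    ⟨descend fun x => (f x : ℂ), hper.continuous_descend (continuous_ofReal_comp f)⟩
  have hg : ∀ n, UnitAddTorus.mFourierCoeff g n = f.hat n := by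
    intro n
    have hp : Periodic1 fun x => ee (-n) x * (f x : ℂ) := fun i x => by
      simp only [periodic1_ee (-n) i x, f.periodic i x]
    rw [TF.hat_apply, coeffCube_toCube, ← hp.integral_descend, UnitAddTorus.mFourierCoeff]
    congr 1
    funext t
    simp only [descend, ee, smul_eq_mul, g, ContinuousMap.coe_mk]
    congr 2
    funext i
    exact ((AddCircle.equivIoc (1 : ℝ) 0).symm_apply_apply (t i)).symm
  -- A continuous function with summable Fourier coefficients is the sum of its series at every
  -- point, not only in mean square.
  have hs : Summable (UnitAddTorus.mFourierCoeff g) := by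
    rw [funext hg]; exact f.hat.summable
  have h1 := UnitAddTorus.hasSum_mFourier_series_apply_of_summable hs (toTorus x)
  have h2 : g (toTorus x) = f x := hper.descend_toTorus x
  rw [h2] at h1
  rw [Wiener.ev_apply, ← h1.tsum_eq]
  refine tsum_congr fun n => ?_
  rw [hg, smul_eq_mul, mul_comm]
  rfl

section SmoothFam

variable {V : Type} [NormedAddCommGroup V] [NormedSpace ℝ V] {S : Set V} {f : V → TF d}

theorem SmoothFam.helmholtz (hf : SmoothFam S f) (hS : UniqueDiffOn ℝ S) :
    SmoothFam S fun v => helmholtz (f v) :=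
  hf.sub (SmoothFam.smul contDiffOn_const
    (SmoothFam.sum _ fun i _ => (hf.pd hS i).pd hS i))

theorem SmoothFam.hat (hf : SmoothFam S f) (hS : Convex ℝ S) (hS' : UniqueDiffOn ℝ S) :
    ContDiffOn ℝ ∞ (fun v => (f v).hat) S := by
  have h : ∀ N : ℕ, SmoothFam S fun v => TransportHessian.helmholtz^[N] (f v) := by
    intro N
    induction N with
    | zero => exact hf
    | succ N ih =>
      simp only [Function.iterate_succ_apply']
      exact ih.helmholtz hS'
  exact (smoothCoeff d).contDiff.comp_contDiffOn ((h d).toCube hS hS')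

end SmoothFam

namespace Wiener

/-! ### Compact Fourier multipliers -/

/-- Truncations of the symbol to finitely many modes have finite rank, and they converge in operator
norm because the symbol tends to zero. -/
theorem isCompactOperator_diag (r : (Fin d → ℤ) → ℂ) (C : ℝ) (h : ∀ n, ‖r n‖ ≤ C)
    (h0 : Tendsto r cofinite (𝓝 0)) : IsCompactOperator (diag r C h) := by
  classical
  have hC : 0 ≤ C := (norm_nonneg _).trans (h 0)
  have hF : ∀ (F : Finset (Fin d → ℤ)) n, ‖if n ∈ F then r n else 0‖ ≤ C := fun F n => by
    split_ifs
    · exact h n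
    · simpa using hC
  refine isCompactOperator_of_tendsto
    (F := fun F : Finset (Fin d → ℤ) => diag (fun n => if n ∈ F then r n else 0) C (hF F))
    (l := atTop) ?_ (Eventually.of_forall fun F => ?_)
  · rw [tendsto_iff_norm_sub_tendsto_zero, Metric.tendsto_atTop]
    intro ε hε
    have h1 : {n | ¬ ‖r n‖ < ε / 2}.Finite := by
      have := (tendsto_zero_iff_norm_tendsto_zero.1 h0).eventually (gt_mem_nhds (half_pos hε))
      exact this
    refine ⟨h1.toFinset, fun F hF' => ?_⟩
    have hb : ∀ n, ‖(if n ∈ F then r n else 0) - r n‖ ≤ ε / 2 := fun n => by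
      split_ifs with hn
      · simpa using (half_pos hε).le
      · by_contra hc
        refine hn (hF' ?_)
        rw [Finite.mem_toFinset]
        simp only [zero_sub, norm_neg, not_le] at hc
        exact not_lt.2 hc.le
    have h2 : diag (fun n => if n ∈ F then r n else 0) C (hF F) - diag r C h =
        diag (fun n => (if n ∈ F then r n else 0) - r n) (ε / 2) hb :=
      ContinuousLinearMap.ext fun y => ext fun n => (sub_mul _ _ _).symm
    rw [dist_zero_right, norm_norm, h2]
    exact (norm_diag_le _ _ hb).trans_lt (half_lt_self hε)
  · have h3 : diag (fun n => if n ∈ F then r n else 0) C (hF F) =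
        ∑ n ∈ F, r n • ((lp.singleContinuousLinearMap ℂ (fun _ : Fin d → ℤ => ℂ) 1 n).comp
          (lp.evalCLM ℂ (fun _ : Fin d → ℤ => ℂ) 1 n)) := by
      refine ContinuousLinearMap.ext fun y => ext fun m => ?_
      have h4 : ∀ n, lp.evalCLM ℂ (fun _ : Fin d → ℤ => ℂ) 1 n y = y n := fun _ => rfl
      rw [sum_apply, lp.coeFn_sum, Finset.sum_apply]
      simp [lp.single_apply, Pi.single_apply, h4]
    rw [h3]
    refine Submodule.sum_mem (compactOperator (RingHom.id ℂ) (Wiener d) (Wiener d)) fun n _ => ?_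
    refine Submodule.smul_mem _ _ ?_
    exact (isCompactOperator_of_locallyCompactSpace_rng
      (lp.singleContinuousLinearMap ℂ (fun _ : Fin d → ℤ => ℂ) 1 n)).comp_clm _

end Wiener

/-! ### The symbols -/

/-- The eigenvalues of `-Δ`, with the value at the zero mode replaced by `1`. -/
def lam (n : Fin d → ℤ) : ℝ := if n = 0 then 1 else ∑ i, (2 * Real.pi * n i) ^ 2

theorem sq_le_lam (n : Fin d → ℤ) (i : Fin d) : (2 * Real.pi * n i) ^ 2 ≤ lam n := by
  rw [lam]
  split_ifs with h
  · simp [h]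
  · exact Finset.single_le_sum (f := fun i => (2 * Real.pi * n i) ^ 2) (fun _ _ => sq_nonneg _)
      (Finset.mem_univ i)

theorem one_le_lam (n : Fin d → ℤ) : 1 ≤ lam n := by
  by_cases h : n = 0
  · simp [lam, h]
  · obtain ⟨i, hi⟩ : ∃ i, n i ≠ 0 := by
      by_contra! hc; exact h (funext hc)
    refine le_trans ?_ (sq_le_lam n i)
    have h1 : (1 : ℝ) ≤ (n i : ℝ) ^ 2 := by
      have : 1 ≤ (n i) ^ 2 := by have := sq_pos_of_ne_zero hi; omega
      exact_mod_cast this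
    have h2 : (1 : ℝ) ≤ (2 * Real.pi) ^ 2 := by nlinarith [Real.pi_gt_three]
    rw [mul_pow]
    nlinarith

theorem lam_pos (n : Fin d → ℤ) : 0 < lam n := zero_lt_one.trans_le (one_le_lam n)

/-- The symbol of the solution operator `y ↦ u`. -/
def sym0 (n : Fin d → ℤ) : ℂ := -(lam n : ℂ)⁻¹

/-- The symbol of `y ↦ ∂_i u`. -/
def sym1 (i : Fin d) (n : Fin d → ℤ) : ℂ := 2 * Real.pi * Complex.I * n i * sym0 n

/-- The symbol of `y ↦ ∂_i ∂_i u`. -/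
def sym2 (i : Fin d) (n : Fin d → ℤ) : ℂ := 2 * Real.pi * Complex.I * n i * sym1 i n

theorem norm_sym0_le (n : Fin d → ℤ) : ‖sym0 n‖ ≤ 1 := by
  rw [sym0, norm_neg, norm_inv, Complex.norm_real, Real.norm_of_nonneg (lam_pos n).le]
  exact inv_le_one_of_one_le₀ (one_le_lam n)

theorem norm_sym1 (i : Fin d) (n : Fin d → ℤ) :
    ‖sym1 i n‖ = |2 * Real.pi * n i| * (lam n)⁻¹ := by
  rw [sym1, sym0, norm_mul, norm_neg, norm_inv, Complex.norm_real,
    Real.norm_of_nonneg (lam_pos n).le]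
  congr 1
  simp [abs_mul]

theorem norm_sym1_sq_le (i : Fin d) (n : Fin d → ℤ) : ‖sym1 i n‖ ^ 2 ≤ (lam n)⁻¹ := by
  rw [norm_sym1, mul_pow, sq_abs]
  have h := lam_pos n
  calc (2 * Real.pi * n i) ^ 2 * (lam n)⁻¹ ^ 2 ≤ lam n * (lam n)⁻¹ ^ 2 := by
        gcongr; exact sq_le_lam n i
    _ = (lam n)⁻¹ := by field_simp

theorem norm_sym1_le (i : Fin d) (n : Fin d → ℤ) : ‖sym1 i n‖ ≤ 1 := by
  have h1 := norm_sym1_sq_le i n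
  have h2 : (lam n)⁻¹ ≤ 1 := inv_le_one_of_one_le₀ (one_le_lam n)
  exact (sq_le_one_iff₀ (norm_nonneg _)).1 (h1.trans h2)

theorem sym2_eq (i : Fin d) (n : Fin d → ℤ) :
    sym2 i n = (((2 * Real.pi * n i) ^ 2 * (lam n)⁻¹ : ℝ) : ℂ) := by
  rw [sym2, sym1, sym0]
  push_cast
  linear_combination (-(2 * (Real.pi : ℂ) * n i) ^ 2 * (lam n : ℂ)⁻¹) * Complex.I_sq

theorem norm_sym2_le (i : Fin d) (n : Fin d → ℤ) : ‖sym2 i n‖ ≤ 1 := by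
  have h := lam_pos n
  rw [sym2_eq, Complex.norm_real, Real.norm_of_nonneg (by positivity), ← div_eq_mul_inv,
    div_le_one h]
  exact sq_le_lam n i

/-- This is the symbol of Δ composed with `potOp`: the identity except on the zero mode, which Δ
annihilates. -/
theorem sum_sym2 (n : Fin d → ℤ) : ∑ i, sym2 i n = if n = 0 then 0 else 1 := by
  simp only [sym2_eq, ← Complex.ofReal_sum, ← Finset.sum_mul]
  split_ifs with h
  · simp [h]
  · have h1 := lam_pos n
    have h2 : ∑ i, (2 * Real.pi * (n i : ℝ)) ^ 2 = lam n := by rw [lam, if_neg h]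
    rw [h2, mul_inv_cancel₀ h1.ne']
    simp

/-- The squared symbol is at most 1/λ, and λ exceeds any given bound outside a finite box of
frequencies. -/
theorem tendsto_sym1 (i : Fin d) : Tendsto (sym1 (d := d) i) cofinite (𝓝 0) := by
  rw [tendsto_zero_iff_norm_tendsto_zero, Metric.tendsto_nhds]
  intro ε hε
  obtain ⟨R, hR⟩ := exists_nat_gt (ε ^ 2)⁻¹
  have hfin : (Icc (fun _ : Fin d => -(R : ℤ)) fun _ => (R : ℤ)).Finite := finite_Icc _ _
  filter_upwards [hfin.compl_mem_cofinite] with n hn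
  rw [dist_zero_right, norm_norm]
  obtain ⟨j, hj⟩ : ∃ j, (R : ℤ) < |n j| := by
    by_contra! hc
    exact hn ⟨fun j => (abs_le.1 (hc j)).1, fun j => (abs_le.1 (hc j)).2⟩
  have hj' : (R : ℝ) + 1 ≤ |(n j : ℝ)| := by exact_mod_cast hj
  have h1 : (R : ℝ) < lam n := by
    refine lt_of_lt_of_le ?_ (sq_le_lam n j)
    have hR0 : (0 : ℝ) ≤ R := Nat.cast_nonneg R
    have h2 : ((R : ℝ) + 1) ^ 2 ≤ (n j : ℝ) ^ 2 := by
      rw [← sq_abs (n j : ℝ)]; gcongr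
    have h3 : (1 : ℝ) ≤ (2 * Real.pi) ^ 2 := by nlinarith [Real.pi_gt_three]
    rw [mul_pow]
    nlinarith
  have h4 : ‖sym1 i n‖ ^ 2 < ε ^ 2 := by
    refine (norm_sym1_sq_le i n).trans_lt ?_
    exact inv_lt_of_inv_lt₀ (by positivity) (hR.trans h1)
  exact lt_of_pow_lt_pow_left₀ 2 hε.le h4

/-! ### The elliptic operator on coefficients -/

/-- The inverse `1 / ρ` of a density. -/
def Density.inv (ρ : Density d) : TF d :=
  ⟨fun x => (ρ.toTF x)⁻¹, ρ.toTF.contDiff.inv fun x => (ρ.pos x).ne', fun i x => by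
    simp only [ρ.toTF.periodic i x]⟩

@[simp] theorem Density.inv_apply (ρ : Density d) (x : X d) : ρ.inv x = (ρ.toTF x)⁻¹ := rfl

/-- The drift `∂_i ρ / ρ`. -/
def drift (ρ : Density d) (i : Fin d) : TF d := pd i ρ.toTF * ρ.inv

/-- The multiplier `y ↦ ∂_i u`. -/
def gradOp (i : Fin d) : Wiener d →L[ℂ] Wiener d := Wiener.diag (sym1 i) 1 (norm_sym1_le i)

/-- The multiplier `y ↦ u`. -/
def potOp (d : ℕ) : Wiener d →L[ℂ] Wiener d := Wiener.diag sym0 1 norm_sym0_le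

/-- The multiplier `y ↦ ∂_i ∂_i u`. -/
def grad2Op (i : Fin d) : Wiener d →L[ℂ] Wiener d := Wiener.diag (sym2 i) 1 (norm_sym2_le i)

/-- The first-order part `y ↦ ∇ log ρ · ∇ u` of the elliptic operator. -/
def driftOp (ρ : Density d) : Wiener d →L[ℝ] Wiener d :=
  ∑ i, (Wiener.conv d (drift ρ i).hat).comp ((gradOp i).restrictScalars ℝ)

theorem ev_driftOp (ρ : Density d) (y : Wiener d) (x : X d) :
    Wiener.ev x (driftOp ρ y) = ∑ i, (drift ρ i x : ℂ) * Wiener.ev x (gradOp i y) := by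
  simp [driftOp, Wiener.ev_conv, TF.ev_hat]

/-- One derivative of the inverse Laplacian is a multiplier of order -1, hence compact;
multiplication by the drift is a bounded convolution. -/
theorem isCompactOperator_driftOp (ρ : Density d) : IsCompactOperator (driftOp ρ) := by
  rw [driftOp]
  refine Submodule.sum_mem (compactOperator (RingHom.id ℝ) (Wiener d) (Wiener d)) fun i _ => ?_
  have h := Wiener.isCompactOperator_diag (sym1 i) 1 (norm_sym1_le i) (tendsto_sym1 i)
  exact IsCompactOperator.continuous_comp h (Wiener.conv d (drift ρ i).hat).continuous

theorem sum_ev_grad2Op (y : Wiener d) (x : X d) :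
    ∑ i, Wiener.ev x (grad2Op i y) = Wiener.ev x y - y 0 := by
  have h1 : ∑ i, grad2Op i y = y - lp.single 1 0 (y 0) := by
    refine Wiener.ext fun n => ?_
    rw [lp.coeFn_sum, Finset.sum_apply]
    simp only [grad2Op, Wiener.diag_apply, ← Finset.sum_mul, sum_sym2, lp.coeFn_sub, Pi.sub_apply]
    by_cases h : n = 0
    · subst h; simp
    · simp [h, lp.single_apply]
  rw [← map_sum, h1, map_sub, Wiener.ev_apply x (lp.single 1 0 (y 0)), tsum_eq_single 0]
  · simp [ee_zero_left]
  · intro n hn; simp [lp.single_apply, hn]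

/-! ### Uniqueness for the weighted Poisson equation -/

theorem integral_cube_sum {ι : Type} (s : Finset ι) {f : ι → X d → ℝ}
    (hf : ∀ i ∈ s, Continuous (f i)) :
    ∫ x in cube d, ∑ i ∈ s, f i x = ∑ i ∈ s, ∫ x in cube d, f i x := by
  simp only [setIntegral_cube_eq]
  exact integral_finsetSum _ fun i hi => integrable_cube (hf i hi)

/-- A function with continuous first and second directional derivatives. -/
structure HasGrad (r : X d → ℝ) (r1 r2 : Fin d → X d → ℝ) : Prop where
  per : Periodic1 r
  per1 : ∀ i, Periodic1 (r1 i)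
  per2 : ∀ i, Periodic1 (r2 i)
  cont : Continuous r
  cont1 : ∀ i, Continuous (r1 i)
  cont2 : ∀ i, Continuous (r2 i)
  line1 : ∀ i x, HasLineDerivAt ℝ r (r1 i x) x (e i)
  line2 : ∀ i x, HasLineDerivAt ℝ (r1 i) (r2 i x) x (e i)

namespace HasGrad

variable {r : X d → ℝ} {r1 r2 : Fin d → X d → ℝ}

/-- The divergence `∇ · (ρ ∇ r)`. -/
theorem line_flux (h : HasGrad r r1 r2) (ρ : Density d) (i : Fin d) (x : X d) :
    HasLineDerivAt ℝ (fun x => ρ.toTF x * r1 i x)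
      (pd i ρ.toTF x * r1 i x + ρ.toTF x * r2 i x) x (e i) := by
  have h1 := hasLineDerivAt_pd i ρ.toTF x
  have h2 := h.line2 i x
  rw [HasLineDerivAt] at h1 h2 ⊢
  simpa using! h1.mul h2

theorem integral_flux (h : HasGrad r r1 r2) (ρ : Density d) :
    ∫ x in cube d, ∑ i, (pd i ρ.toTF x * r1 i x + ρ.toTF x * r2 i x) = 0 := by
  have hc1 := h.cont1
  have hc2 := h.cont2
  have hcρ := ρ.toTF.continuous
  have hcd : ∀ i, Continuous (pd i ρ.toTF : X d → ℝ) := fun i => (pd i ρ.toTF).continuous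
  have hcc : ∀ i, Continuous fun x => pd i ρ.toTF x * r1 i x + ρ.toTF x * r2 i x := fun i =>
    ((hcd i).mul (hc1 i)).add (hcρ.mul (hc2 i))
  rw [integral_cube_sum _ fun i _ => hcc i]
  refine Finset.sum_eq_zero fun i _ => ?_
  refine Periodic1.integral_lineDeriv (f := fun x => ρ.toTF x * r1 i x) (fun j x => ?_)
    (fun j x => ?_) (hcρ.mul (hc1 i)) (hcc i) (e i)
    (h.line_flux ρ i)
  · simp only [ρ.toTF.periodic j x, h.per1 i j x]
  · simp only [ρ.toTF.periodic j x, (pd i ρ.toTF).periodic j x, h.per1 i j x, h.per2 i j x]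

theorem flux_eq (ρ : Density d) (r1 r2 : Fin d → X d → ℝ) (x : X d) :
    ∑ i, (pd i ρ.toTF x * r1 i x + ρ.toTF x * r2 i x) =
      ρ.toTF x * (∑ i, r2 i x + ∑ i, drift ρ i x * r1 i x) := by
  have := (ρ.pos x).ne'
  rw [← Finset.sum_add_distrib, Finset.mul_sum]
  refine Finset.sum_congr rfl fun i _ => ?_
  simp only [drift, TF.mul_apply, Density.inv_apply]
  field_simp
  ring

/-- Multiplied by ρ, the left side becomes a divergence and integrates to zero; on the right f has
mean zero and ρ has mass one, which leaves -c. -/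
theorem const_eq_zero (h : HasGrad r r1 r2) (ρ : Density d) {f : TF d} (hf : intL d f = 0)
    {c : ℝ} (heq : ∀ x, ∑ i, r2 i x + ∑ i, drift ρ i x * r1 i x = (f * ρ.inv) x - c) : c = 0 := by
  have h1 := h.integral_flux ρ
  simp only [flux_eq, heq] at h1
  have h2 : ∀ x, ρ.toTF x * ((f * ρ.inv) x - c) = (f - c • ρ.toTF) x := fun x => by
    have := (ρ.pos x).ne'
    simp only [TF.mul_apply, Density.inv_apply, TF.sub_apply, TF.smul_apply]
    field_simp
  simp only [h2] at h1
  have h3 : intL d (f - c • ρ.toTF) = 0 := h1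
  rw [map_sub, map_smul, hf, intL_apply, ρ.mass] at h3
  simpa using h3

/-- Energy identity: integrating the divergence of r ρ∇r and using the equation gives ∫ ρ |∇r|² = 0.
-/
theorem grad_eq_zero (h : HasGrad r r1 r2) (ρ : Density d)
    (heq : ∀ x, ∑ i, r2 i x + ∑ i, drift ρ i x * r1 i x = 0) (i : Fin d) (x : X d) :
    r1 i x = 0 := by
  have hc1 := h.cont1
  have hc2 := h.cont2
  have hc := h.cont
  have hcρ := ρ.toTF.continuous
  have hcd : ∀ i, Continuous (pd i ρ.toTF : X d → ℝ) := fun i => (pd i ρ.toTF).continuous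
  have h1 : ∫ x in cube d, ∑ i, (r1 i x * (ρ.toTF x * r1 i x) +
      r x * (pd i ρ.toTF x * r1 i x + ρ.toTF x * r2 i x)) = 0 := by
    have hcc : ∀ i, Continuous fun x => r1 i x * (ρ.toTF x * r1 i x) +
        r x * (pd i ρ.toTF x * r1 i x + ρ.toTF x * r2 i x) := fun i =>
      ((hc1 i).mul (hcρ.mul (hc1 i))).add
        (hc.mul (((hcd i).mul (hc1 i)).add (hcρ.mul (hc2 i))))
    rw [integral_cube_sum _ fun i _ => hcc i]
    refine Finset.sum_eq_zero fun i _ => ?_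
    refine Periodic1.integral_lineDeriv (f := fun x => r x * (ρ.toTF x * r1 i x)) (fun j x => ?_)
      (fun j x => ?_) (hc.mul (hcρ.mul (hc1 i))) (hcc i) (e i) fun x => ?_
    · simp only [ρ.toTF.periodic j x, h.per1 i j x, h.per j x]
    · simp only [ρ.toTF.periodic j x, (pd i ρ.toTF).periodic j x, h.per1 i j x, h.per2 i j x,
        h.per j x]
    · have h1 := h.line1 i x
      have h2 := h.line_flux ρ i x
      rw [HasLineDerivAt] at h1 h2 ⊢
      simpa using! h1.mul h2
  have h2 : ∀ x, ∑ i, (r1 i x * (ρ.toTF x * r1 i x) +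
      r x * (pd i ρ.toTF x * r1 i x + ρ.toTF x * r2 i x)) = ∑ i, ρ.toTF x * r1 i x ^ 2 := by
    intro x
    rw [Finset.sum_add_distrib, ← Finset.mul_sum, flux_eq, heq, mul_zero, mul_zero, add_zero]
    exact Finset.sum_congr rfl fun i _ => by ring
  simp only [h2] at h1
  have hnn : ∀ x, ∀ i ∈ Finset.univ, 0 ≤ ρ.toTF x * r1 i x ^ 2 := fun x i _ =>
    mul_nonneg (ρ.pos x).le (sq_nonneg _)
  have h3 := Periodic1.eq_zero_of_integral_eq_zero (f := fun x => ∑ i, ρ.toTF x * r1 i x ^ 2)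
    (fun j x => by simp only [ρ.toTF.periodic j x, h.per1 _ j x])
    (continuous_finsetSum _ fun i _ => hcρ.mul ((hc1 i).pow 2))
    (fun x => Finset.sum_nonneg (hnn x)) h1 x
  have h4 := (Finset.sum_eq_zero_iff_of_nonneg (hnn x)).1 h3 i (Finset.mem_univ i)
  simpa [(ρ.pos x).ne'] using h4

end HasGrad

/-- The real function obtained from coefficients `y` by solving `-λ u = y`, with its derivatives. -/
theorem hasGrad_ev (P : ℂ →L[ℝ] ℝ) (y : Wiener d) :
    HasGrad (fun x => P (Wiener.ev x (potOp d y))) (fun i x => P (Wiener.ev x (gradOp i y)))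
      fun i x => P (Wiener.ev x (grad2Op i y)) := by
  have hper : ∀ z : Wiener d, Periodic1 fun x => P (Wiener.ev x z) := fun z i x =>
    congrArg P (Wiener.periodic1_ev z i x)
  have hcont : ∀ z : Wiener d, Continuous fun x => P (Wiener.ev x z) := fun z =>
    P.continuous.comp (Wiener.continuous_ev z)
  refine ⟨hper _, fun _ => hper _, fun _ => hper _, hcont _, fun _ => hcont _, fun _ => hcont _,
    fun i x => ?_, fun i x => ?_⟩
  · have h := Wiener.hasLineDerivAt_ev (y := potOp d y) (z := gradOp i y) i (fun n => by
      simp only [gradOp, potOp, Wiener.diag_apply, sym1]; ring) x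
    rw [HasLineDerivAt] at h ⊢
    exact P.hasFDerivAt.comp_hasDerivAt _ h
  · have h := Wiener.hasLineDerivAt_ev (y := gradOp i y) (z := grad2Op i y) i (fun n => by
      simp only [gradOp, grad2Op, Wiener.diag_apply, sym2]; ring) x
    rw [HasLineDerivAt] at h ⊢
    exact P.hasFDerivAt.comp_hasDerivAt _ h

/-- With y as unknown, the operator Δ + ∇log ρ·∇ is 1 + `driftOp` up to the zero mode of y. The
functional P will be the real or the imaginary part, so that real energy estimates apply to complex
coefficients. -/
theorem elliptic_ev (P : ℂ →L[ℝ] ℝ) (ρ : Density d) (y : Wiener d) (x : X d) :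
    ∑ i, P (Wiener.ev x (grad2Op i y)) + ∑ i, drift ρ i x * P (Wiener.ev x (gradOp i y)) =
      P (Wiener.ev x (y + driftOp ρ y)) - P (y 0) := by
  rw [← map_sum P, sum_ev_grad2Op, map_add, ev_driftOp, map_sub, map_add P, map_sum P]
  have : ∀ i, P ((drift ρ i x : ℂ) * Wiener.ev x (gradOp i y)) =
      drift ρ i x * P (Wiener.ev x (gradOp i y)) := fun i => by
    rw [← Complex.real_smul, map_smul, smul_eq_mul]
  simp only [this]
  ring

/-- The zero mode vanishes by integration, and the gradient by the energy identity. Then the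
Laplacian vanishes too, and it equals y once the zero mode is gone. -/
theorem eq_zero_of_add_driftOp_eq_zero {ρ : Density d} {y : Wiener d} (h : y + driftOp ρ y = 0) :
    y = 0 := by
  have key : ∀ P : ℂ →L[ℝ] ℝ, P (y 0) = 0 ∧ ∀ i x, P (Wiener.ev x (gradOp i y)) = 0 := by
    intro P
    have heq : ∀ x, ∑ i, P (Wiener.ev x (grad2Op i y)) +
        ∑ i, drift ρ i x * P (Wiener.ev x (gradOp i y)) = ((0 : TF d) * ρ.inv) x - P (y 0) :=
      fun x => by rw [elliptic_ev, h]; simp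
    have h0 := (hasGrad_ev P y).const_eq_zero ρ (map_zero _) heq
    refine ⟨h0, (hasGrad_ev P y).grad_eq_zero ρ fun x => ?_⟩
    rw [heq, h0]; simp
  have h0 : y 0 = 0 := Complex.ext (key Complex.reCLM).1 (key Complex.imCLM).1
  have h1 : ∀ i, gradOp i y = 0 := fun i => Wiener.eq_zero_of_ev fun x =>
    Complex.ext ((key Complex.reCLM).2 i x) ((key Complex.imCLM).2 i x)
  have h2 : ∀ i, grad2Op i y = 0 := fun i => Wiener.ext fun n => by
    have : gradOp i y n = 0 := by rw [h1]; rfl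
    simp only [gradOp, Wiener.diag_apply] at this
    simp only [grad2Op, Wiener.diag_apply, sym2, mul_assoc, this, mul_zero]
    rfl
  refine Wiener.eq_zero_of_ev fun x => ?_
  have := sum_ev_grad2Op y x
  simpa [h2, h0] using this.symm

/-! ### Solving the weighted Poisson equation by the Fredholm alternative -/

/-- For the compact operator -`driftOp ρ`, the number 1 is either an eigenvalue or in the resolvent
set; injectivity excludes the former. -/
theorem isUnit_one_add_driftOp (ρ : Density d) : IsUnit (1 + driftOp ρ) := by
  have hc : IsCompactOperator (-driftOp ρ) := (isCompactOperator_driftOp ρ).neg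
  rcases IsCompactOperator.hasEigenvalue_or_mem_resolventSet (μ := (1 : ℝ)) hc one_ne_zero
    with h | h
  · obtain ⟨y, hy⟩ := h.exists_hasEigenvector
    refine absurd (eq_zero_of_add_driftOp_eq_zero (ρ := ρ) ?_) hy.2
    have h1 := hy.apply_eq_smul
    rw [one_smul] at h1
    have h2 : -driftOp ρ y = y := h1
    rw [neg_eq_iff_eq_neg.1 h2, add_neg_cancel]
  · rw [spectrum.mem_resolventSet_iff] at h
    simpa using h

/-- The coefficients of the (normalized) Laplacian of the solution of `∇ · (ρ ∇ u) = f`. -/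
def solCoeff (ρ : Density d) (f : TF d) : Wiener d :=
  Ring.inverse (1 + driftOp ρ) (f * ρ.inv).hat

theorem solCoeff_spec (ρ : Density d) (f : TF d) :
    solCoeff ρ f + driftOp ρ (solCoeff ρ f) = (f * ρ.inv).hat := by
  have h := Ring.mul_inverse_cancel _ (isUnit_one_add_driftOp ρ)
  have := congrArg (fun A : Wiener d →L[ℝ] Wiener d => A (f * ρ.inv).hat) h
  simpa [solCoeff] using! this

theorem eq_solCoeff {ρ : Density d} {f : TF d} {y : Wiener d}
    (h : ∀ x, Wiener.ev x (y + driftOp ρ y) = (f * ρ.inv) x) : y = solCoeff ρ f := by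
  refine sub_eq_zero.1 (eq_zero_of_add_driftOp_eq_zero (ρ := ρ) ?_)
  refine Wiener.eq_zero_of_ev fun x => ?_
  have h1 : y - solCoeff ρ f + driftOp ρ (y - solCoeff ρ f) =
      (y + driftOp ρ y) - (solCoeff ρ f + driftOp ρ (solCoeff ρ f)) := by
    rw [map_sub]; abel
  rw [h1, solCoeff_spec, map_sub, h, TF.ev_hat, sub_self]

/-- The solution of `∇ · (ρ ∇ u) = f`, as a function. -/
def solFun (ρ : Density d) (f : TF d) (x : X d) : ℝ := (Wiener.ev x (potOp d (solCoeff ρ f))).re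

/-- The coefficients solve the equation only up to the constant given by their zero mode; the
mean-zero condition on f makes the real part of that mode vanish. -/
theorem solFun_spec {ρ : Density d} {f : TF d} (hf : intL d f = 0) {u : TF d}
    (hu : ∀ x, u x = solFun ρ f x) : divGrad ρ u = f := by
  have hg := hasGrad_ev Complex.reCLM (solCoeff ρ f)
  have heq : ∀ x, ∑ i, Complex.reCLM (Wiener.ev x (grad2Op i (solCoeff ρ f))) +
      ∑ i, drift ρ i x * Complex.reCLM (Wiener.ev x (gradOp i (solCoeff ρ f))) =
      (f * ρ.inv) x - Complex.reCLM (solCoeff ρ f 0) := fun x => by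
    rw [elliptic_ev, solCoeff_spec, TF.ev_hat]; simp
  have h0 := hg.const_eq_zero ρ hf heq
  have hu' : (u : X d → ℝ) = fun x => Complex.reCLM (Wiener.ev x (potOp d (solCoeff ρ f))) :=
    funext hu
  have h1 : ∀ i x, pd i u x = Complex.reCLM (Wiener.ev x (gradOp i (solCoeff ρ f))) :=
    fun i x => pd_eq_of_hasLineDerivAt (by rw [hu']; exact hg.line1 i x)
  refine TF.ext fun x => ?_
  have h2 : ∀ i, pd i (ρ.toTF * pd i u) x =
      pd i ρ.toTF x * Complex.reCLM (Wiener.ev x (gradOp i (solCoeff ρ f))) +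
        ρ.toTF x * Complex.reCLM (Wiener.ev x (grad2Op i (solCoeff ρ f))) := fun i => by
    refine pd_eq_of_hasLineDerivAt ?_
    have h3 : ((ρ.toTF * pd i u : TF d) : X d → ℝ) =
        fun x => ρ.toTF x * Complex.reCLM (Wiener.ev x (gradOp i (solCoeff ρ f))) :=
      funext fun x => by rw [TF.mul_apply, h1]
    rw [h3]
    exact hg.line_flux ρ i x
  rw [divGrad, divT, TF.sum_apply]
  simp only [h2]
  rw [HasGrad.flux_eq ρ (fun i x => Complex.reCLM (Wiener.ev x (gradOp i (solCoeff ρ f))))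
    (fun i x => Complex.reCLM (Wiener.ev x (grad2Op i (solCoeff ρ f)))), heq, h0, sub_zero,
    TF.mul_apply, Density.inv_apply]
  have := (ρ.pos x).ne'
  field_simp

/-! ### Translations and smooth dependence on parameters -/

/-- Translation of a smooth function on the torus. -/
def TF.translate (h : X d) (f : TF d) : TF d :=
  ⟨fun x => f (x + h), f.contDiff.comp (contDiff_id.add contDiff_const), f.periodic.comp_add h⟩

@[simp] theorem TF.translate_apply (h : X d) (f : TF d) (x : X d) : f.translate h x = f (x + h) :=
  rfl

theorem intL_translate (h : X d) (f : TF d) : intL d (f.translate h) = intL d f :=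
  f.periodic.integral_comp_add h

theorem pd_translate (i : Fin d) (h : X d) (f : TF d) :
    pd i (f.translate h) = (pd i f).translate h := by
  refine TF.ext fun x => pd_eq_of_hasLineDerivAt ?_
  have h1 := hasLineDerivAt_pd i f (x + h)
  rw [HasLineDerivAt] at h1 ⊢
  refine h1.congr_of_eventuallyEq (Eventually.of_forall fun t => ?_)
  simp only [TF.translate_apply, add_right_comm]

/-- Translation of a density. -/
def Density.translate (h : X d) (ρ : Density d) : Density d :=
  ⟨ρ.toTF.translate h, fun x => ρ.pos (x + h), (intL_translate h ρ.toTF).trans ρ.mass⟩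

theorem drift_translate (h : X d) (ρ : Density d) (i : Fin d) (x : X d) :
    drift (ρ.translate h) i x = drift ρ i (x + h) := by
  simp only [drift, TF.mul_apply, Density.inv_apply, Density.translate, pd_translate,
    TF.translate_apply]

/-- Fourier multipliers commute with translation, so by uniqueness the translated data have the
translated solution. Evaluation at h thus becomes evaluation at the fixed point 0, with h turned
into a parameter of the data. -/
theorem solFun_translate (ρ : Density d) (f : TF d) (h : X d) :
    solFun (ρ.translate h) (f.translate h) 0 = solFun ρ f h := by
  let τ : Wiener d →L[ℂ] Wiener d := Wiener.diag (fun n => ee n h) 1 fun n => (norm_ee n h).le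
  have hev : ∀ x z, Wiener.ev x (τ z) = Wiener.ev (x + h) z := fun x z => by
    simp only [Wiener.ev_apply]
    refine tsum_congr fun n => ?_
    rw [ee_add_right, Wiener.diag_apply, mul_assoc]
  have hcomm : ∀ i z, gradOp i (τ z) = τ (gradOp i z) := fun i z => Wiener.ext fun n => by
    simp only [gradOp, τ, Wiener.diag_apply]; ring
  have hcomm0 : ∀ z, potOp d (τ z) = τ (potOp d z) := fun z => Wiener.ext fun n => by
    simp only [potOp, τ, Wiener.diag_apply]; ring
  have hsol : τ (solCoeff ρ f) = solCoeff (ρ.translate h) (f.translate h) := by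
    refine eq_solCoeff fun x => ?_
    rw [map_add, ev_driftOp, hev]
    simp only [hcomm, hev, drift_translate]
    rw [← ev_driftOp, ← map_add, solCoeff_spec, TF.ev_hat]
    rfl
  rw [solFun, ← hsol, hcomm0, hev, zero_add, solFun]

section Param

variable {V : Type} [NormedAddCommGroup V] [NormedSpace ℝ V] {S : Set V} {ρ : V → Density d}
  {f : V → TF d}

theorem SmoothFam.inv (hρ : SmoothFam S fun v => (ρ v).toTF) : SmoothFam S fun v => (ρ v).inv :=
  ContDiffOn.inv hρ fun p _ => ((ρ p.1).pos p.2).ne'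

theorem SmoothFam.translate (hf : SmoothFam S f) :
    SmoothFam (S ×ˢ (univ : Set (X d))) fun p : V × X d => (f p.1).translate p.2 :=
  ContDiffOn.comp (g := fun p : V × X d => f p.1 p.2)
    (f := fun q : (V × X d) × X d => (q.1.1, q.2 + q.1.2)) hf
    (by fun_prop) fun _ hq => ⟨hq.1.1, mem_univ _⟩

/-- The operator is affine in the coefficients of the drift, which vary smoothly in ℓ¹, and
inversion in the Banach algebra of bounded operators is smooth at units. -/
theorem contDiffOn_solCoeff (hS : Convex ℝ S) (hS' : UniqueDiffOn ℝ S)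
    (hρ : SmoothFam S fun v => (ρ v).toTF) (hf : SmoothFam S f) :
    ContDiffOn ℝ ∞ (fun v => solCoeff (ρ v) (f v)) S := by
  have h1 : ContDiffOn ℝ ∞ (fun v => 1 + driftOp (ρ v)) S := by
    refine contDiffOn_const.add (ContDiffOn.sum fun i _ => ?_)
    refine ContDiffOn.clm_comp ?_ contDiffOn_const
    exact (Wiener.conv d).contDiff.comp_contDiffOn (((hρ.pd hS' i).mul hρ.inv).hat hS hS')
  have h2 : ContDiffOn ℝ ∞ (fun v => Ring.inverse (1 + driftOp (ρ v))) S := by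
    intro v hv
    obtain ⟨u, hu⟩ := isUnit_one_add_driftOp (ρ v)
    have h3 := contDiffAt_ringInverse ℝ (n := ∞) u
    rw [hu] at h3
    exact ContDiffAt.comp_contDiffWithinAt (g := Ring.inverse) v h3 (h1 v hv)
  exact h2.clm_apply ((hf.mul hρ.inv).hat hS hS')

/-- Smooth dependence of the coefficients is applied to the enlarged family that includes
translations; smoothness in x needs no separate regularity theory. -/
theorem contDiffOn_solFun (hS : Convex ℝ S) (hS' : UniqueDiffOn ℝ S)
    (hρ : SmoothFam S fun v => (ρ v).toTF) (hf : SmoothFam S f) :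
    ContDiffOn ℝ ∞ (fun p : V × X d => solFun (ρ p.1) (f p.1) p.2) (S ×ˢ univ) := by
  have h := contDiffOn_solCoeff (ρ := fun p : V × X d => (ρ p.1).translate p.2)
    (f := fun p : V × X d => (f p.1).translate p.2) (hS.prod convex_univ)
    (hS'.prod uniqueDiffOn_univ) hρ.translate hf.translate
  have hL : ContDiff ℝ ∞ fun y : Wiener d => (Wiener.ev 0 (potOp d y)).re :=
    (Complex.reCLM.comp (((Wiener.ev 0).comp (potOp d)).restrictScalars ℝ)).contDiff
  refine (hL.comp_contDiffOn h).congr fun p _ => ?_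
  exact (solFun_translate _ _ _).symm

/-- Solvability of the weighted Poisson equation, with smooth dependence on parameters. -/
theorem exists_divGrad_eq (hS : Convex ℝ S) (hS' : UniqueDiffOn ℝ S)
    (hρ : SmoothFam S fun v => (ρ v).toTF) (hf : SmoothFam S f)
    (h0 : ∀ v ∈ S, intL d (f v) = 0) :
    ∃ u : V → TF d, SmoothFam S u ∧ ∀ v ∈ S, divGrad (ρ v) (u v) = f v := by
  classical
  have h := contDiffOn_solFun hS hS' hρ hf
  have hmem : ∀ v ∈ S, solFun (ρ v) (f v) ∈ torusSmooth d := fun v hv => by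
    refine ⟨?_, fun i x => by simp only [solFun, Wiener.periodic1_ev _ i x]⟩
    have := ContDiffOn.comp (f := fun x : X d => (v, x)) (s := univ) h
      (contDiffOn_const.prodMk contDiffOn_id) fun x _ => ⟨hv, mem_univ _⟩
    exact contDiffOn_univ.1 this
  let u : V → TF d := fun v => if hv : v ∈ S then ⟨_, hmem v hv⟩ else 0
  have hu : ∀ v ∈ S, ∀ x, u v x = solFun (ρ v) (f v) x := fun v hv x => by simp [u, hv]
  exact ⟨u, h.congr fun p hp => hu p.1 hp.1 p.2, fun v hv => solFun_spec (h0 v hv) (hu v hv)⟩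

end Param

/-! ### Velocities of smooth families -/

/-- `f'` is the velocity of the family `f` at time `s`. -/
def HasVel (f : ℝ → TF d) (f' : TF d) (s : ℝ) : Prop :=
  ∀ x, HasDerivAt (fun r => f r x) (f' x) s

namespace HasVel

variable {f g : ℝ → TF d} {f' g' : TF d} {s : ℝ}

theorem unique (hf : HasVel f f' s) (hf' : HasVel f g' s) : f' = g' :=
  TF.ext fun x => (hf x).unique (hf' x)

theorem const (f : TF d) (s : ℝ) : HasVel (fun _ => f) 0 s := fun _ => hasDerivAt_const _ _

theorem mul (hf : HasVel f f' s) (hg : HasVel g g' s) :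
    HasVel (fun r => f r * g r) (f' * g s + f s * g') s := fun x => (hf x).mul (hg x)

theorem sum {ι : Type} (u : Finset ι) {F : ι → ℝ → TF d} {F' : ι → TF d}
    (h : ∀ i ∈ u, HasVel (F i) (F' i) s) : HasVel (fun r => ∑ i ∈ u, F i r) (∑ i ∈ u, F' i) s :=
  fun x => by
    simp only [TF.sum_apply]
    exact HasDerivAt.fun_sum fun i hi => h i hi x

end HasVel

section Vel

variable {f : ℝ → TF d}

theorem SmoothFam.contDiff_univ {V : Type} [NormedAddCommGroup V] [NormedSpace ℝ V]
    {f : V → TF d} (hf : SmoothFam univ f) : ContDiff ℝ ∞ fun p : V × X d => f p.1 p.2 := by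
  rw [SmoothFam, univ_prod_univ] at hf
  exact contDiffOn_univ.1 hf

/-- The velocity commutes with spatial derivatives by symmetry of the second derivative of the joint
map. -/
theorem exists_hasVel (hf : SmoothFam univ f) (s : ℝ) :
    ∃ f' : TF d, HasVel f f' s ∧ ∀ i, HasVel (fun r => pd i (f r)) (pd i f') s := by
  set g : ℝ × X d → ℝ := fun p => f p.1 p.2 with hg
  have hgc : ContDiff ℝ ∞ g := hf.contDiff_univ
  have hgd : ∀ p, HasFDerivAt g (fderiv ℝ g p) p := fun p =>
    (hgc.differentiable (by simp) p).hasFDerivAt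
  have hgc' : ContDiff ℝ ∞ (fderiv ℝ g) := hgc.fderiv_right (by simp)
  have hgd' : ∀ p, HasFDerivAt (fderiv ℝ g) (fderiv ℝ (fderiv ℝ g) p) p := fun p =>
    (hgc'.differentiable (by simp) p).hasFDerivAt
  have hs : ∀ x r, HasDerivAt (fun r : ℝ => (r, x)) ((1 : ℝ), (0 : X d)) r := fun x r =>
    (hasDerivAt_id r).prodMk (hasDerivAt_const r x)
  have hx : ∀ (r : ℝ) (i : Fin d) (x : X d),
      HasDerivAt (fun t : ℝ => (r, x + t • e i)) ((0 : ℝ), (e i : X d)) 0 := fun r i x => by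
    have h1 : HasDerivAt (fun t : ℝ => x + t • (e i : X d)) (e i) 0 := by
      simpa using ((hasDerivAt_id (0 : ℝ)).smul_const (e i : X d)).const_add x
    exact (hasDerivAt_const _ _).prodMk h1
  have hvel : ∀ r x, HasDerivAt (fun r => f r x) (fderiv ℝ g (r, x) (1, 0)) r := fun r x =>
    HasFDerivAt.comp_hasDerivAt (f := fun r : ℝ => (r, x)) (l := g) r (hgd (r, x)) (hs x r)
  have hpd : ∀ r i x, pd i (f r) x = fderiv ℝ g (r, x) (0, e i) := fun r i x => by
    refine pd_eq_of_hasLineDerivAt ?_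
    have h1 : HasFDerivAt g (fderiv ℝ g (r, x)) (r, x + (0 : ℝ) • e i) := by simpa using hgd (r, x)
    exact h1.comp_hasDerivAt (0 : ℝ) (hx r i x)
  let f' : TF d := ⟨fun x => fderiv ℝ g (s, x) (1, 0),
    (hgc'.comp (contDiff_const.prodMk contDiff_id)).clm_apply contDiff_const, fun i x => by
      have h1 := hvel s (x + e i)
      simp only [(f _).periodic i x] at h1
      exact h1.unique (hvel s x)⟩
  refine ⟨f', hvel s, fun i x => ?_⟩
  have h1 : HasDerivAt (fun r => pd i (f r) x)
      (fderiv ℝ (fderiv ℝ g) (s, x) (1, 0) (0, e i)) s := by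
    simp only [hpd]
    have h2 := (hgd' (s, x)).comp_hasDerivAt s (hs x s)
    simpa using! h2.clm_apply (hasDerivAt_const s ((0 : ℝ), (e i : X d)))
  have h3 : pd i f' x = fderiv ℝ (fderiv ℝ g) (s, x) (0, e i) (1, 0) := by
    refine pd_eq_of_hasLineDerivAt ?_
    have h4 : HasFDerivAt (fderiv ℝ g) (fderiv ℝ (fderiv ℝ g) (s, x)) (s, x + (0 : ℝ) • e i) := by
      simpa using hgd' (s, x)
    have h2 := h4.comp_hasDerivAt (0 : ℝ) (hx s i x)
    simpa [HasLineDerivAt] using! h2.clm_apply (hasDerivAt_const (0 : ℝ) ((1 : ℝ), (0 : X d)))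
  rw [h3]
  have hsym := hgc.contDiffAt (x := (s, x)) |>.isSymmSndFDerivAt
    (by simp; exact WithTop.coe_le_coe.2 (le_top : (2 : ℕ∞) ≤ ⊤))
  rw [hsym.eq]
  exact h1

theorem hasVel_pd {f' : TF d} {s : ℝ} (h : HasVel f f' s) (hf : SmoothFam univ f) (i : Fin d) :
    HasVel (fun r => pd i (f r)) (pd i f') s := by
  obtain ⟨g', h1, h2⟩ := exists_hasVel hf s
  rw [h.unique h1]
  exact h2 i

end Vel

/-! ### Perturbations of a density -/

open Classical in
/-- The density `ρ + φ`, if this is one. -/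
def Density.perturb (ρ : Density d) (φ : TF d) : Density d :=
  if h : (∀ x, 0 < (ρ.toTF + φ) x) ∧ intL d (ρ.toTF + φ) = 1 then ⟨ρ.toTF + φ, h.1, h.2⟩ else ρ

theorem Density.perturb_toTF {ρ : Density d} {φ : TF d} (h : ∀ x, |φ x| < ρ.toTF x)
    (h0 : intL d φ = 0) : (ρ.perturb φ).toTF = ρ.toTF + φ := by
  have h1 : (∀ x, 0 < (ρ.toTF + φ) x) ∧ intL d (ρ.toTF + φ) = 1 := by
    refine ⟨fun x => ?_, ?_⟩
    · have := neg_abs_le (φ x)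
      have := h x
      simp only [TF.add_apply]; linarith
    · rw [map_add, h0, add_zero]; exact ρ.mass
  rw [Density.perturb, dif_pos h1]

theorem Density.ext {ρ ρ' : Density d} (h : ρ.toTF = ρ'.toTF) : ρ = ρ' := by
  cases ρ; cases ρ'; simp only at h; subst h; rfl

theorem Density.exists_small (ρ : Density d) (φ : TF d) :
    ∃ ε : ℝ, 0 < ε ∧ ∀ x, |ε * φ x| < ρ.toTF x / 2 := by
  obtain ⟨C, hC⟩ := (φ * ρ.inv).periodic.exists_norm_le (φ * ρ.inv).continuous
  have hC0 : 0 ≤ C := (norm_nonneg _).trans (hC 0)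
  refine ⟨1 / (2 * (C + 1)), by positivity, fun x => ?_⟩
  have hp := ρ.pos x
  have h1 : |φ x| ≤ C * ρ.toTF x := by
    have h2 := hC x
    rw [TF.mul_apply, Density.inv_apply, Real.norm_eq_abs, abs_mul, abs_inv, abs_of_pos hp,
      ← div_eq_mul_inv, div_le_iff₀ hp] at h2
    exact h2
  rw [abs_mul, abs_of_pos (by positivity : 0 < 1 / (2 * (C + 1))), one_div_mul_eq_div,
    div_lt_iff₀ (by positivity)]
  nlinarith

/-- The parameter enters through sin because curves are defined on all of ℝ: |sin s| ≤ 1 lets a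
small perturbation stay positive for every s, and the velocity at s = 0 is still φ. -/
theorem isCurve_of_eq_add {γ : ℝ → Density d} {ρ φ : TF d}
    (h : ∀ s, (γ s).toTF = ρ + Real.sin s • φ) : IsCurve γ fun s => Real.cos s • φ where
  smooth := by
    simp only [h]
    exact (SmoothFam.const ρ).add (SmoothFam.smul Real.contDiff_sin.contDiffOn (SmoothFam.const φ))
  velocity s x := by
    simp only [h]
    exact ((Real.hasDerivAt_sin s).mul_const (φ x)).const_add (ρ x)

/-! ### Symmetry of the variations -/

/-- Phrased through iterated one-variable derivatives, the form in which the variations are given.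
-/
theorem mixed_deriv_eq {g : ℝ × ℝ → ℝ} (hg : ContDiff ℝ ∞ g) {p q : ℝ → ℝ} {P Q : ℝ}
    (hp : ∀ b, HasDerivAt (fun a => g (a, b)) (p b) 0) (hp' : HasDerivAt p P 0)
    (hq : ∀ a, HasDerivAt (fun b => g (a, b)) (q a) 0) (hq' : HasDerivAt q Q 0) : P = Q := by
  have hgd : ∀ p, HasFDerivAt g (fderiv ℝ g p) p := fun p =>
    (hg.differentiable (by simp) p).hasFDerivAt
  have hgc' : ContDiff ℝ ∞ (fderiv ℝ g) := hg.fderiv_right (by simp)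
  have hgd' : ∀ p, HasFDerivAt (fderiv ℝ g) (fderiv ℝ (fderiv ℝ g) p) p := fun p =>
    (hgc'.differentiable (by simp) p).hasFDerivAt
  have h1 : ∀ b a, HasDerivAt (fun a : ℝ => (a, b)) ((1 : ℝ), (0 : ℝ)) a := fun b a =>
    (hasDerivAt_id a).prodMk (hasDerivAt_const a b)
  have h2 : ∀ a b, HasDerivAt (fun b : ℝ => (a, b)) ((0 : ℝ), (1 : ℝ)) b := fun a b =>
    (hasDerivAt_const b a).prodMk (hasDerivAt_id b)
  have hpe : p = fun b => fderiv ℝ g (0, b) (1, 0) := funext fun b =>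
    (hp b).unique ((hgd (0, b)).comp_hasDerivAt 0 (h1 b 0))
  have hqe : q = fun a => fderiv ℝ g (a, 0) (0, 1) := funext fun a =>
    (hq a).unique ((hgd (a, 0)).comp_hasDerivAt 0 (h2 a 0))
  have hP : P = fderiv ℝ (fderiv ℝ g) (0, 0) (0, 1) (1, 0) := by
    rw [hpe] at hp'
    refine hp'.unique ?_
    simpa using! ((hgd' (0, 0)).comp_hasDerivAt 0 (h2 0 0)).clm_apply
      (hasDerivAt_const (0 : ℝ) ((1 : ℝ), (0 : ℝ)))
  have hQ : Q = fderiv ℝ (fderiv ℝ g) (0, 0) (1, 0) (0, 1) := by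
    rw [hqe] at hq'
    refine hq'.unique ?_
    have h3 : HasFDerivAt (fderiv ℝ g) (fderiv ℝ (fderiv ℝ g) (0, 0))
      ((fun a : ℝ => (a, (0 : ℝ))) 0) := hgd' (0, 0)
    simpa using! (HasFDerivAt.comp_hasDerivAt (f := fun a : ℝ => (a, (0 : ℝ))) 0 h3 (h1 0 0)).clm_apply
      (hasDerivAt_const (0 : ℝ) ((0 : ℝ), (1 : ℝ)))
  have hsym := hg.contDiffAt (x := (0, 0)) |>.isSymmSndFDerivAt
    (by simp; exact WithTop.coe_le_coe.2 (le_top : (2 : ℕ∞) ≤ ⊤))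
  rw [hP, hQ, hsym.eq]

theorem abs_sin_mul_le (a y : ℝ) : |Real.sin a * y| ≤ |y| := by
  rw [abs_mul]
  exact mul_le_of_le_one_left (abs_nonneg _) (Real.abs_sin_le_one a)

section Symmetry

variable {H : Density d → ℝ}

/-- Mixed derivatives of H at the origin of the family ρ + sin(a) φ + sin(b) ψ, taken in the two
orders. Bounding each perturbation by ρ/2 keeps the sum positive. -/
theorem variation_symm_of_small
    (hH : ∀ ρ : ℝ × ℝ → Density d, SmoothFam univ (fun v => (ρ v).toTF) →
      ContDiff ℝ ∞ fun v => H (ρ v))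
    (l : Density d → TF d →ₗ[ℝ] ℝ) (m : Density d → TF d →ₗ[ℝ] TF d →ₗ[ℝ] ℝ)
    (h1 : ∀ γ γ', IsCurve γ γ' → ∀ s, HasDerivAt (fun r => H (γ r)) (l (γ s) (γ' s)) s)
    (h2 : ∀ γ γ', IsCurve γ γ' → ∀ ψ : TF d, intL d ψ = 0 → ∀ s,
      HasDerivAt (fun r => l (γ r) ψ) (m (γ s) ψ (γ' s)) s)
    (ρ : Density d) {φ ψ : TF d} (hφ : intL d φ = 0) (hψ : intL d ψ = 0)
    (hφ' : ∀ x, |φ x| < ρ.toTF x / 2) (hψ' : ∀ x, |ψ x| < ρ.toTF x / 2) :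
    m ρ φ ψ = m ρ ψ φ := by
  let R : ℝ × ℝ → Density d := fun p => ρ.perturb (Real.sin p.1 • φ + Real.sin p.2 • ψ)
  have hR : ∀ p, (R p).toTF = ρ.toTF + (Real.sin p.1 • φ + Real.sin p.2 • ψ) := fun p => by
    refine Density.perturb_toTF (fun x => ?_) (by simp [hφ, hψ])
    have h1 := abs_sin_mul_le p.1 (φ x)
    have h2 := abs_sin_mul_le p.2 (ψ x)
    have h3 := abs_add_le (Real.sin p.1 * φ x) (Real.sin p.2 * ψ x)
    have h4 := hφ' x
    have h5 := hψ' x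
    simp only [TF.add_apply, TF.smul_apply]
    linarith
  have hR0 : R (0, 0) = ρ := Density.ext (by rw [hR]; simp)
  have hRs : SmoothFam univ fun p => (R p).toTF := by
    simp only [hR]
    exact (SmoothFam.const _).add ((SmoothFam.smul (by fun_prop) (SmoothFam.const φ)).add
      (SmoothFam.smul (by fun_prop) (SmoothFam.const ψ)))
  have hc1 : ∀ b, IsCurve (fun a => R (a, b)) fun s => Real.cos s • φ := fun b =>
    isCurve_of_eq_add (ρ := ρ.toTF + Real.sin b • ψ) fun s => by rw [hR]; simp only; abel
  have hc2 : ∀ a, IsCurve (fun b => R (a, b)) fun s => Real.cos s • ψ := fun a =>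
    isCurve_of_eq_add (ρ := ρ.toTF + Real.sin a • φ) fun s => by rw [hR]; simp only; abel
  have hp := fun b => h1 _ _ (hc1 b) 0
  have hq := fun a => h1 _ _ (hc2 a) 0
  have hp' := h2 _ _ (hc2 0) φ hφ 0
  have hq' := h2 _ _ (hc1 0) ψ hψ 0
  simp only [Real.cos_zero, one_smul] at hp hq hp' hq'
  have := mixed_deriv_eq (hH R hRs) hp hp' hq hq'
  rwa [hR0] at this

/-- Symmetry of second variations. -/
theorem variation_symm
    (hH : ∀ ρ : ℝ × ℝ → Density d, SmoothFam univ (fun v => (ρ v).toTF) →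
      ContDiff ℝ ∞ fun v => H (ρ v))
    (l : Density d → TF d →ₗ[ℝ] ℝ) (m : Density d → TF d →ₗ[ℝ] TF d →ₗ[ℝ] ℝ)
    (h1 : ∀ γ γ', IsCurve γ γ' → ∀ s, HasDerivAt (fun r => H (γ r)) (l (γ s) (γ' s)) s)
    (h2 : ∀ γ γ', IsCurve γ γ' → ∀ ψ : TF d, intL d ψ = 0 → ∀ s,
      HasDerivAt (fun r => l (γ r) ψ) (m (γ s) ψ (γ' s)) s)
    (ρ : Density d) {φ ψ : TF d} (hφ : intL d φ = 0) (hψ : intL d ψ = 0) :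
    m ρ φ ψ = m ρ ψ φ := by
  -- Both sides are bilinear, so φ and ψ may be rescaled to be small.
  obtain ⟨ε, hε, hε'⟩ := ρ.exists_small φ
  obtain ⟨δ, hδ, hδ'⟩ := ρ.exists_small ψ
  have h := variation_symm_of_small hH l m h1 h2 ρ (φ := ε • φ) (ψ := δ • ψ) (by simp [hφ])
    (by simp [hψ]) hε' hδ'
  simp only [map_smul, LinearMap.smul_apply, smul_eq_mul] at h
  have h3 : (ε * δ) * m ρ φ ψ = (ε * δ) * m ρ ψ φ := by linear_combination h
  exact mul_left_cancel₀ (mul_pos hε hδ).ne' h3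

variable {E : Density d → ℝ} {δE : Density d → TF d} {δ2E : Density d → Kernel2 d}
  {δ3E : Density d → Kernel3 d}

/-- Multiplication by `g` followed by integration. -/
def intMul (g : TF d) : TF d →ₗ[ℝ] ℝ := (intL d).comp (LinearMap.mulRight ℝ g)

theorem secondVariation_symm (hE : SmoothFunctional E) (hE1 : IsFirstVariation E δE)
    (hE2 : IsSecondVariation δE δ2E) (ρ : Density d) {φ ψ : TF d} (hφ : intL d φ = 0)
    (hψ : intL d ψ = 0) : intL d (δ2E ρ φ * ψ) = intL d (δ2E ρ ψ * φ) := by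
  refine (variation_symm (H := E) (fun R hR => ?_)
    (fun ρ => (intL d).comp (LinearMap.mulLeft ℝ (δE ρ)))
    (fun ρ => ((LinearMap.mul ℝ (TF d)).compl₁₂ (δ2E ρ) LinearMap.id).flip.compr₂ (intL d))
    (fun γ γ' hγ s => hE1.deriv γ γ' hγ s)
    (fun γ γ' hγ ψ hψ s => hE2.deriv γ γ' hγ ψ hψ s) ρ hψ hφ)
  exact contDiffOn_univ.1 (hE (ℝ × ℝ) univ convex_univ (by simp) R hR)

/-- Differentiate the symmetry of the second variation along a curve whose initial velocity is a
multiple of χ. -/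
theorem thirdVariation_symm_left (hE : SmoothFunctional E) (hE1 : IsFirstVariation E δE)
    (hE2 : IsSecondVariation δE δ2E) (hE3 : IsThirdVariation δ2E δ3E) (ρ : Density d)
    {φ ψ χ : TF d} (hφ : intL d φ = 0) (hψ : intL d ψ = 0) (hχ : intL d χ = 0) :
    intL d (δ3E ρ ψ χ * φ) = intL d (δ3E ρ φ χ * ψ) := by
  obtain ⟨ε, hε, hε'⟩ := ρ.exists_small χ
  have hp : ∀ x, 0 < ρ.toTF x := ρ.pos
  let R : ℝ → Density d := fun s => ρ.perturb (Real.sin s • ε • χ)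
  have hR : ∀ s, (R s).toTF = ρ.toTF + Real.sin s • ε • χ := fun s => by
    refine Density.perturb_toTF (fun x => ?_) (by simp [hχ])
    have h1 := abs_sin_mul_le s (ε * χ x)
    have h2 := hε' x
    have h3 := hp x
    simp only [TF.smul_apply]
    linarith
  have hR0 : R 0 = ρ := Density.ext (by rw [hR]; simp)
  have hc := isCurve_of_eq_add hR
  have h1 := hE3.deriv _ _ hc φ ψ hφ hψ 0
  have h2 := hE3.deriv _ _ hc ψ φ hψ hφ 0
  have h3 : (fun r => intT fun x => δ2E (R r) ψ x * φ x) =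
      fun r => intT fun x => δ2E (R r) φ x * ψ x := funext fun r =>
    secondVariation_symm hE hE1 hE2 (R r) hψ hφ
  rw [h3] at h1
  have h4 := h1.unique h2
  simp only [hR0, Real.cos_zero, one_smul, map_smul] at h4
  have h5 : ε * intL d (δ3E ρ ψ χ * φ) = ε * intL d (δ3E ρ φ χ * ψ) := by
    have h6 : intL d ((ε • δ3E ρ ψ χ) * φ) = intL d ((ε • δ3E ρ φ χ) * ψ) := h4
    simpa using h6
  exact mul_left_cancel₀ hε.ne' h5

/-- For fixed φ, the kernels δ²E and δ³E tested against φ are the first and second variations of the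
functional ρ ↦ ∫ δE(ρ) φ, so the general symmetry applies. -/
theorem thirdVariation_symm_right (hE1 : IsFirstVariation E δE)
    (hE2 : IsSecondVariation δE δ2E) (hE3 : IsThirdVariation δ2E δ3E) (ρ : Density d)
    {φ ψ χ : TF d} (hφ : intL d φ = 0) (hψ : intL d ψ = 0) (hχ : intL d χ = 0) :
    intL d (δ3E ρ ψ χ * φ) = intL d (δ3E ρ χ ψ * φ) := by
  refine variation_symm (H := fun ρ => intL d (δE ρ * φ)) (fun R hR => ?_)
    (fun ρ => (intMul φ).comp (δ2E ρ)) (fun ρ => (δ3E ρ).compr₂ (intMul φ))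
    (fun γ γ' hγ s => hE2.deriv γ γ' hγ φ hφ s)
    (fun γ γ' hγ ψ hψ s => hE3.deriv γ γ' hγ φ ψ hφ hψ s) ρ hψ hχ
  have h := hE1.smooth (ℝ × ℝ) univ convex_univ (by simp) R hR
  exact contDiffOn_univ.1 ((h.mul (SmoothFam.const φ)).intL convex_univ uniqueDiffOn_univ)

end Symmetry

/-! ### The Hessian as an integral of smooth functions -/

section Hess

variable {δE : Density d → TF d} {δ2E : Density d → Kernel2 d} {δ3E : Density d → Kernel3 d}
  {δF : Density d → TF d}

theorem sum_dy (K : Kernel2 d) (ρ : Density d) (Φ : TF d) :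
    ∑ j, K.dy j (ρ.toTF * pd j Φ) = -K (divGrad ρ Φ) := by
  simp [Kernel2.dy, divGrad, divT, map_sum]

/-- `∑_{ij} ∂_i ∂_j f ∂_i Φ ∂_j Ψ`. -/
def hessForm (f Φ Ψ : TF d) : TF d := ∑ i, ∑ j, pd i (pd j f) * pd i Φ * pd j Ψ

theorem hessForm_comm (f Φ Ψ : TF d) : hessForm f Φ Ψ = hessForm f Ψ Φ := by
  rw [hessForm, Finset.sum_comm]
  refine Finset.sum_congr rfl fun i _ => Finset.sum_congr rfl fun j _ => ?_
  rw [pd_comm]; ring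

/-- `∑_{ij} ∂_i ∂_j (ρ ∂_i Φ ∂_j Φ)`. -/
def stress (ρ : TF d) (Φ : TF d) : TF d := ∑ i, ∑ j, pd i (pd j (ρ * pd i Φ * pd j Φ))

theorem intL_stress (ρ Φ : TF d) : intL d (stress ρ Φ) = 0 := by simp [stress, intL_pd]

/-- Two integrations by parts leave f undifferentiated, tested against a function of mean zero,
which is all that the variations of E control. -/
theorem intL_hessForm_mul (f Φ ρ : TF d) :
    intL d (hessForm f Φ Φ * ρ) = intL d (f * stress ρ Φ) := by
  simp only [hessForm, stress, Finset.sum_mul, Finset.mul_sum, map_sum]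
  rw [Finset.sum_comm]
  refine Finset.sum_congr rfl fun i _ => Finset.sum_congr rfl fun j _ => ?_
  have h1 : pd j (pd i f) * pd j Φ * pd i Φ * ρ = pd j (pd i f) * (ρ * pd i Φ * pd j Φ) := by ring
  rw [h1, intL_pd_mul, intL_pd_mul, neg_neg, pd_comm]

/-- Integration by parts in x and y turns the double gradient of δ²E into δ²E acting on the fluxes
∇·(ρ∇Φ), which have mean zero. -/
theorem hessStar_eq (ρ : Density d) (Φ Ψ : TF d) :
    hessStar δE δ2E ρ Φ Ψ = intL d (δ2E ρ (divGrad ρ Ψ) * divGrad ρ Φ) +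
      intL d (hessForm (δE ρ) Φ Ψ * ρ.toTF) := by
  have h1 : (intT fun x => ∑ i, ∑ j,
      ((δ2E ρ).dy j).dx i (ρ.toTF * pd j Ψ) x * pd i Φ x * ρ.toTF x) =
      intL d (∑ i, ∑ j, ((δ2E ρ).dy j).dx i (ρ.toTF * pd j Ψ) * pd i Φ * ρ.toTF) := by
    rw [intL_apply]; congr 1; funext x; simp only [TF.sum_apply, TF.mul_apply]
  have h2 : (intT fun x => ∑ i, ∑ j, pd i (pd j (δE ρ)) x * pd i Φ x * pd j Ψ x * ρ.toTF x) =
      intL d (hessForm (δE ρ) Φ Ψ * ρ.toTF) := by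
    rw [intL_apply]; congr 1; funext x
    simp only [hessForm, TF.sum_apply, TF.mul_apply, Finset.sum_mul]
  rw [hessStar, h1, h2]
  congr 1
  have h3 : ∀ i, ∑ j, ((δ2E ρ).dy j).dx i (ρ.toTF * pd j Ψ) * pd i Φ * ρ.toTF =
      -(ρ.toTF * pd i Φ * pd i (δ2E ρ (divGrad ρ Ψ))) := fun i => by
    rw [← Finset.sum_mul, ← Finset.sum_mul]
    have : ∑ j, ((δ2E ρ).dy j).dx i (ρ.toTF * pd j Ψ) = pd i (-(δ2E ρ) (divGrad ρ Ψ)) := by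
      rw [← sum_dy, map_sum]; rfl
    rw [this, map_neg]; ring
  simp only [h3]
  rw [mul_comm, intL_divGrad_mul, Finset.sum_neg_distrib, map_neg]

theorem hessStar_congr {ρ : Density d} {Φ Φ' : TF d} (h : ∀ i, pd i Φ = pd i Φ') :
    hessStar δE δ2E ρ Φ Φ = hessStar δE δ2E ρ Φ' Φ' := by
  simp only [hessStar, h]

/-- Two potentials of the same tangent vector have equal gradients, and the form sees only
gradients, so the arbitrary choice in `potential` is harmless. -/
theorem gH_eq {ρ : Density d} {Φ : TF d} {σ : X d → ℝ} (h : ∀ x, σ x + divGrad ρ Φ x = 0) :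
    gH δE δ2E ρ σ σ = hessStar δE δ2E ρ Φ Φ := by
  have h0 : ∀ x, σ x = -divGrad ρ Φ x := fun x => by linarith [h x]
  have hex : ∃ Φ : TF d, ∀ x, σ x = -divGrad ρ Φ x := ⟨Φ, h0⟩
  have h1 : ∀ x, σ x = -divGrad ρ (potential ρ σ) x := by
    rw [potential, dif_pos hex]; exact hex.choose_spec
  refine hessStar_congr fun i => ?_
  have h2 : divGrad ρ (potential ρ σ - Φ) = 0 := by
    rw [divGrad_sub, sub_eq_zero]
    exact TF.ext fun x => by linarith [h0 x, h1 x]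
  have h3 := pd_eq_zero_of_divGrad_eq_zero h2 i
  rwa [map_sub, sub_eq_zero] at h3

/-- The right-hand side of the Poisson equation. -/
def poissonRHS (δE : Density d → TF d) (δ2E : Density d → Kernel2 d) (ρ : Density d)
    (Φ : TF d) : TF d :=
  divT fun i => ρ.toTF * (pd i (∑ j, (δ2E ρ).dy j (ρ.toTF * pd j Φ)) +
    ∑ j, pd i (pd j (δE ρ)) * pd j Φ)

theorem intL_poissonRHS_mul (ρ : Density d) (Φ χ : TF d) :
    intL d (poissonRHS δE δ2E ρ Φ * χ) =
      intL d (∑ i, ρ.toTF * pd i (δ2E ρ (divGrad ρ Φ)) * pd i χ) -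
        intL d (hessForm (δE ρ) χ Φ * ρ.toTF) := by
  rw [poissonRHS, intL_divT_mul, sum_dy, ← map_sub, ← map_neg]
  congr 1
  rw [← Finset.sum_neg_distrib, hessForm, Finset.sum_mul, ← Finset.sum_sub_distrib]
  refine Finset.sum_congr rfl fun i _ => ?_
  rw [map_neg, Finset.sum_mul]
  have : ∑ j, pd i (pd j (δE ρ)) * pd i χ * pd j Φ * ρ.toTF =
      (∑ j, pd i (pd j (δE ρ)) * pd j Φ) * (pd i χ * ρ.toTF) := by
    rw [Finset.sum_mul]
    exact Finset.sum_congr rfl fun j _ => by ring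
  rw [this]; ring

/-- The terms of the Hamilton–Jacobi equation other than the time derivative. -/
def hjTerms (δE : Density d → TF d) (δ2E : Density d → Kernel2 d) (δ3E : Density d → Kernel3 d)
    (δF : Density d → TF d) (ρ : Density d) (Φ Ψ : TF d) : TF d :=
  (1 / 2 : ℝ) • δ3E ρ (divGrad ρ Φ) (divGrad ρ Φ) - ∑ i, pd i (δ2E ρ (divGrad ρ Φ)) * pd i Φ
    + (1 / 2 : ℝ) • δ2E ρ (stress ρ.toTF Φ) + (1 / 2 : ℝ) • hessForm (δE ρ) Φ Φ
    - ∑ i, pd i Φ * pd i Ψ - δF ρ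

theorem hjTerms_apply (ρ : Density d) (Φ Ψ : TF d) (x : X d) :
    hjTerms δE δ2E δ3E δF ρ Φ Ψ x = (1 / 2) * (∑ i, ∑ j, ((δ3E ρ).dy i).dz j
          (ρ.toTF * pd i Φ) (ρ.toTF * pd j Φ) x)
      + (∑ i, ∑ j, ((δ2E ρ).dy j).dx i (ρ.toTF * pd j Φ) x * pd i Φ x)
      + (1 / 2) * (∑ i, ∑ j, ((δ2E ρ).dy i).dy j (ρ.toTF * pd i Φ * pd j Φ) x)
      + (1 / 2) * (∑ i, ∑ j, pd i (pd j (δE ρ)) x * pd i Φ x * pd j Φ x)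
      - ∑ i, pd i Φ x * pd i Ψ x - δF ρ x := by
  have h1 : δ3E ρ (divGrad ρ Φ) (divGrad ρ Φ) =
      ∑ i, ∑ j, ((δ3E ρ).dy i).dz j (ρ.toTF * pd i Φ) (ρ.toTF * pd j Φ) := by
    simp [Kernel3.dy, Kernel3.dz, divGrad, divT, map_sum, LinearMap.sum_apply]
    exact Finset.sum_comm
  have h2 : ∀ i, ∑ j, ((δ2E ρ).dy j).dx i (ρ.toTF * pd j Φ) * pd i Φ =
      -(pd i (δ2E ρ (divGrad ρ Φ)) * pd i Φ) := fun i => by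
    rw [← Finset.sum_mul]
    have : ∑ j, ((δ2E ρ).dy j).dx i (ρ.toTF * pd j Φ) = pd i (-(δ2E ρ) (divGrad ρ Φ)) := by
      rw [← sum_dy, map_sum]; rfl
    rw [this, map_neg]; ring
  have h3 : δ2E ρ (stress ρ.toTF Φ) =
      ∑ i, ∑ j, ((δ2E ρ).dy i).dy j (ρ.toTF * pd i Φ * pd j Φ) := by
    simp [Kernel2.dy, stress, map_sum]
  have h4 : (∑ i, ∑ j, ((δ2E ρ).dy j).dx i (ρ.toTF * pd j Φ) x * pd i Φ x) =
      (-∑ i, pd i (δ2E ρ (divGrad ρ Φ)) * pd i Φ : TF d) x := by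
    rw [← Finset.sum_neg_distrib]
    simp only [← h2, TF.sum_apply, TF.mul_apply]
  rw [h4, hjTerms, h1, h3]
  simp only [hessForm, TF.sum_apply, TF.mul_apply, TF.add_apply, TF.sub_apply, TF.smul_apply,
    TF.neg_apply]
  ring

end Hess

/-! ### First variation of the Lagrangian at a fixed time -/

section FirstVariation

variable {E F : Density d → ℝ} {δE : Density d → TF d} {δ2E : Density d → Kernel2 d}
  {δ3E : Density d → Kernel3 d} {δF : Density d → TF d}

/-- The derivative of the quadratic form of the second variation along a variation. -/
theorem hasDerivAt_secondVariation (hE : SmoothFunctional E) (hE1 : IsFirstVariation E δE)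
    (hE2 : IsSecondVariation δE δ2E) (hE3 : IsThirdVariation δ2E δ3E) {γ : ℝ → Density d}
    {η σ κ : TF d} (hγ : ∀ s, (γ s).toTF = (γ 0).toTF + Real.sin s • η) (hη : intL d η = 0)
    (hσ : intL d σ = 0) (hκ : intL d κ = 0) :
    HasDerivAt (fun s => intL d (δ2E (γ s) (σ - Real.sin s • κ) * (σ - Real.sin s • κ)))
      (intL d (δ3E (γ 0) σ σ * η) - 2 * intL d (δ2E (γ 0) σ * κ)) 0 := by
  have hB : ∀ φ ψ : TF d, intL d φ = 0 → intL d ψ = 0 →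
      HasDerivAt (fun s => intL d (δ2E (γ s) ψ * φ)) (intL d (δ3E (γ 0) ψ η * φ)) 0 := by
    intro φ ψ hφ hψ
    have := hE3.deriv _ _ (isCurve_of_eq_add hγ) φ ψ hφ hψ 0
    simpa only [Real.cos_zero, one_smul] using! this
  -- The third variation differentiates δ²E only between fixed test functions, so the moving
  -- arguments are expanded first; the sin² term contributes nothing at s = 0.
  have hexp : ∀ s, intL d (δ2E (γ s) (σ - Real.sin s • κ) * (σ - Real.sin s • κ)) =
      intL d (δ2E (γ s) σ * σ) - 2 * Real.sin s * intL d (δ2E (γ s) σ * κ) +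
        Real.sin s ^ 2 * intL d (δ2E (γ s) κ * κ) := by
    intro s
    have h1 := secondVariation_symm hE hE1 hE2 (γ s) hκ hσ
    simp only [map_sub, map_smul, sub_mul, mul_sub, smul_mul_assoc, mul_smul_comm, smul_eq_mul, h1]
    ring
  simp only [hexp]
  have hs : HasDerivAt Real.sin 1 0 := by simpa using Real.hasDerivAt_sin 0
  have h3 := ((hB σ σ hσ hσ).sub ((hs.const_mul 2).mul (hB κ σ hκ hσ))).add
    ((hs.pow 2).mul (hB κ κ hκ hκ))
  -- The symmetries of δ³E carry η from a kernel argument to the outer test slot.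
  have h4 : intL d (δ3E (γ 0) σ η * σ) = intL d (δ3E (γ 0) σ σ * η) := by
    rw [thirdVariation_symm_right hE1 hE2 hE3 (γ 0) hσ hσ hη,
      thirdVariation_symm_left hE hE1 hE2 hE3 (γ 0) hσ hη hσ]
  convert! h3 using 1
  rw [h4]
  simp

/-- The velocity of the first variation is the second variation, up to a constant. -/
theorem intL_vel_firstVariation_mul (hE1 : IsFirstVariation E δE)
    (hE2 : IsSecondVariation δE δ2E) {γ : ℝ → Density d} {η p' φ : TF d}
    (hγ : ∀ s, (γ s).toTF = (γ 0).toTF + Real.sin s • η)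
    (hp' : HasVel (fun s => δE (γ s)) p' 0) (hφ : intL d φ = 0) :
    intL d (p' * φ) = intL d (δ2E (γ 0) η * φ) := by
  have hc := isCurve_of_eq_add hγ
  have hsm := hE1.smooth ℝ univ convex_univ (by simp) γ hc.smooth
  have h1 := hE2.deriv _ _ hc φ hφ 0
  have h2 := (hsm.mul (SmoothFam.const φ)).hasDerivAt_intL (f' := p' * φ) (s := 0) (fun x => by
    have := hp'.mul (HasVel.const φ 0) x
    simpa using! this)
  simp only [Real.cos_zero, one_smul] at h1
  exact h2.unique h1

theorem hasVel_hessForm {p Φ : ℝ → TF d} {p' χ : TF d} {s : ℝ} (hp : SmoothFam univ p)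
    (hΦ : SmoothFam univ Φ) (hp' : HasVel p p' s) (hχ : HasVel Φ χ s) :
    HasVel (fun r => hessForm (p r) (Φ r) (Φ r))
      (hessForm p' (Φ s) (Φ s) + 2 * hessForm (p s) χ (Φ s)) s := by
  have h1 := HasVel.sum Finset.univ fun i _ => HasVel.sum Finset.univ fun j _ =>
    (((hasVel_pd (hasVel_pd hp' hp j) (hp.pd uniqueDiffOn_univ j) i).mul
      (hasVel_pd hχ hΦ i)).mul (hasVel_pd hχ hΦ j))
  have h2 : 2 * hessForm (p s) χ (Φ s) = hessForm (p s) χ (Φ s) + hessForm (p s) (Φ s) χ := by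
    rw [hessForm_comm (p s) (Φ s), two_mul]
  rw [h2]
  convert! h1 using 1
  simp only [hessForm, ← Finset.sum_add_distrib]
  refine Finset.sum_congr rfl fun i _ => Finset.sum_congr rfl fun j _ => ?_
  ring

/-- The first variation of the Lagrangian at a fixed time. -/
theorem hasDerivAt_lagrangian (hE : SmoothFunctional E) (hE1 : IsFirstVariation E δE)
    (hE2 : IsSecondVariation δE δ2E) (hE3 : IsThirdVariation δ2E δ3E)
    (hF1 : IsFirstVariation F δF) {γ : ℝ → Density d} {Φ : ℝ → TF d} {η κ Ψ : TF d}
    (hγ : ∀ s, (γ s).toTF = (γ 0).toTF + Real.sin s • η) (hη : intL d η = 0)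
    (hκ : intL d κ = 0) (hΦ : SmoothFam univ Φ)
    (hcont : ∀ s, divGrad (γ s) (Φ s) = divGrad (γ 0) (Φ 0) - Real.sin s • κ)
    (hΨ : divGrad (γ 0) Ψ = poissonRHS δE δ2E (γ 0) (Φ 0)) :
    HasDerivAt (fun s => (1 / 2) * hessStar δE δ2E (γ s) (Φ s) (Φ s) - F (γ s))
      (intL d (hjTerms δE δ2E δ3E δF (γ 0) (Φ 0) Ψ * η) + intL d (Ψ * κ)) 0 := by
  have hc := isCurve_of_eq_add hγ
  have hsm := hE1.smooth ℝ univ convex_univ (by simp) γ hc.smooth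
  have hγv : HasVel (fun s => (γ s).toTF) η 0 := fun x => by
    have := hc.velocity 0 x
    simpa using! this
  obtain ⟨p', hp', -⟩ := exists_hasVel hsm 0
  obtain ⟨χ, hχ, -⟩ := exists_hasVel hΦ 0
  set ρ := γ 0 with hρ
  set σ := divGrad ρ (Φ 0) with hσ
  have hσ0 : intL d σ = 0 := intL_divGrad _ _
  -- the three parts of the Lagrangian
  have hA := hasDerivAt_secondVariation hE hE1 hE2 hE3 hγ hη hσ0 hκ
  have hQv := (hasVel_hessForm hsm hΦ hp' hχ).mul hγv
  have hQs : SmoothFam univ fun s => hessForm (δE (γ s)) (Φ s) (Φ s) * (γ s).toTF :=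
    (SmoothFam.sum _ fun i _ => SmoothFam.sum _ fun j _ =>
      (((hsm.pd uniqueDiffOn_univ j).pd uniqueDiffOn_univ i).mul
        (hΦ.pd uniqueDiffOn_univ i)).mul (hΦ.pd uniqueDiffOn_univ j)).mul hc.smooth
  have hQ := hQs.hasDerivAt_intL hQv
  have hFd := hF1.deriv _ _ hc 0
  simp only [Real.cos_zero, one_smul] at hFd
  have htot := ((hA.add hQ).const_mul (1 / 2)).sub hFd
  have hfun : (fun s => (1 / 2) * hessStar δE δ2E (γ s) (Φ s) (Φ s) - F (γ s)) = fun s =>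
      (1 / 2) * (intL d (δ2E (γ s) (σ - Real.sin s • κ) * (σ - Real.sin s • κ)) +
        intL d (hessForm (δE (γ s)) (Φ s) (Φ s) * (γ s).toTF)) - F (γ s) := funext fun s => by
    rw [hessStar_eq, hcont]
  rw [hfun]
  convert! htot using 1
  rw [← hρ]
  have hFi : (intT fun x => δF ρ x * η x) = intL d (δF ρ * η) := rfl
  rw [hFi]
  -- the linearized continuity equation
  have hlin : divT (fun i => η * pd i (Φ 0)) + divGrad ρ χ = -κ := by
    have h1 : HasVel (fun s => divGrad (γ s) (Φ s))
        (∑ i, pd i (η * pd i (Φ 0) + ρ.toTF * pd i χ)) 0 :=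
      HasVel.sum Finset.univ fun i _ => hasVel_pd (hγv.mul (hasVel_pd hχ hΦ i))
        (hc.smooth.mul (hΦ.pd uniqueDiffOn_univ i)) i
    have hs : HasDerivAt Real.sin 1 0 := by simpa using Real.hasDerivAt_sin 0
    have h2 : HasVel (fun s => divGrad (γ s) (Φ s)) (-κ) 0 := fun x => by
      simp only [hcont]
      simpa using! (hs.mul_const (κ x)).const_sub (σ x)
    rw [← h1.unique h2]
    simp only [map_add, Finset.sum_add_distrib]
    rfl
  -- integration by parts in the term with `χ`
  have hK : intL d (hessForm (δE ρ) χ (Φ 0) * ρ.toTF) =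
      intL d (δ2E ρ σ * κ) + intL d (Ψ * κ) - intL d ((∑ i, pd i (δ2E ρ σ) * pd i (Φ 0)) * η)
        - intL d ((∑ i, pd i (Φ 0) * pd i Ψ) * η) := by
    have h1 := intL_poissonRHS_mul (δE := δE) (δ2E := δ2E) ρ (Φ 0) χ
    rw [← hΨ, intL_divGrad_mul, ← hσ] at h1
    have h2 := intL_divGrad_mul ρ χ (δ2E ρ σ + Ψ)
    have h3 : divGrad ρ χ = -κ - divT fun i => η * pd i (Φ 0) := by
      rw [← hlin]; abel
    have h4 := intL_divT_mul (fun i => η * pd i (Φ 0)) (δ2E ρ σ + Ψ)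
    rw [h3, sub_mul, map_sub, h4] at h2
    have h5 : ∑ i, ρ.toTF * pd i χ * pd i (δ2E ρ σ + Ψ) =
        (∑ i, ρ.toTF * pd i (δ2E ρ σ) * pd i χ) + ∑ i, ρ.toTF * pd i Ψ * pd i χ := by
      rw [← Finset.sum_add_distrib]
      exact Finset.sum_congr rfl fun i _ => by rw [map_add]; ring
    have h6 : ∑ i, η * pd i (Φ 0) * pd i (δ2E ρ σ + Ψ) =
        (∑ i, pd i (δ2E ρ σ) * pd i (Φ 0)) * η + (∑ i, pd i (Φ 0) * pd i Ψ) * η := by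
      rw [Finset.sum_mul, Finset.sum_mul, ← Finset.sum_add_distrib]
      exact Finset.sum_congr rfl fun i _ => by rw [map_add]; ring
    have h7 : -κ * (δ2E ρ σ + Ψ) = -(δ2E ρ σ * κ) - Ψ * κ := by ring
    rw [h5, h6, h7, map_sub, map_neg, map_add, map_add] at h2
    linarith
  -- The velocity p' of δE equals δ²E η only up to a constant, which is invisible here because
  -- `stress` has mean zero.
  have hP : intL d (hessForm p' (Φ 0) (Φ 0) * ρ.toTF) = intL d (δ2E ρ (stress ρ.toTF (Φ 0)) * η) := by
    rw [intL_hessForm_mul, intL_vel_firstVariation_mul hE1 hE2 hγ hp' (intL_stress _ _),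
      secondVariation_symm hE hE1 hE2 _ hη (intL_stress _ _)]
  have h2c : intL d ((hessForm p' (Φ 0) (Φ 0) + 2 * hessForm (δE ρ) χ (Φ 0)) * ρ.toTF +
      hessForm (δE ρ) (Φ 0) (Φ 0) * η) =
      intL d (hessForm p' (Φ 0) (Φ 0) * ρ.toTF) +
        2 * intL d (hessForm (δE ρ) χ (Φ 0) * ρ.toTF) +
        intL d (hessForm (δE ρ) (Φ 0) (Φ 0) * η) := by
    rw [add_mul, map_add, map_add, mul_assoc, two_mul, map_add]; ring
  -- The terms ∫ (δ²E σ) κ now cancel: coefficient -1 from the quadratic form of δ²E, +1 from the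
  -- term in χ.
  rw [h2c, hP, hK]
  simp only [hjTerms, add_mul, sub_mul, map_add, map_sub, smul_mul_assoc, map_smul, smul_eq_mul,
    ← hσ]
  ring

end FirstVariation

/-! ### Calculus on the time interval -/

/-- J is controlled only on the closed strip; its within-derivative is continuous there, hence
bounded on [s - 1, s + 1] × [0, 1], which gives the dominating constant. -/
theorem hasDerivAt_integral_zero_one {J : ℝ × ℝ → ℝ} {D : ℝ → ℝ} {s : ℝ}
    (hJ : ContDiffOn ℝ ∞ J (univ ×ˢ Icc 0 1))
    (hD : ∀ t ∈ Icc (0 : ℝ) 1, HasDerivAt (fun s => J (s, t)) (D t) s) :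
    HasDerivAt (fun s => ∫ t in (0 : ℝ)..1, J (s, t)) (∫ t in (0 : ℝ)..1, D t) s := by
  set F' : ℝ → ℝ → ℝ := fun s t => fderivWithin ℝ J (univ ×ˢ Icc 0 1) (s, t) (1, 0) with hF'
  have hu : UniqueDiffOn ℝ ((univ : Set ℝ) ×ˢ Icc (0 : ℝ) 1) :=
    uniqueDiffOn_univ.prod (uniqueDiffOn_Icc zero_lt_one)
  have hc : ContinuousOn (fun p : ℝ × ℝ => F' p.1 p.2) (univ ×ˢ Icc 0 1) :=
    (hJ.continuousOn_fderivWithin hu (by simp)).clm_apply continuousOn_const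
  have hslice : ∀ {G : ℝ × ℝ → ℝ}, ContinuousOn G (univ ×ˢ Icc 0 1) → ∀ r,
      ContinuousOn (fun t => G (r, t)) (Icc 0 1) := fun hG r =>
    hG.comp (by fun_prop) fun t ht => ⟨mem_univ _, ht⟩
  have hd : ∀ r, ∀ t ∈ Icc (0 : ℝ) 1, HasDerivAt (fun s => J (s, t)) (F' r t) r := fun r t ht => by
    have h1 := hasFDerivWithinAt_fst (hJ.differentiableOn (by simp)) (mem_univ r) ht
    rw [hasFDerivWithinAt_univ] at h1
    simpa [fstDeriv] using! h1.hasDerivAt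
  obtain ⟨C, hC⟩ := ((isCompact_closedBall s 1).prod (isCompact_Icc (a := (0 : ℝ)) (b := 1))).exists_bound_of_continuousOn
    (hc.mono (prod_mono (subset_univ _) le_rfl))
  have hI : uIoc (0 : ℝ) 1 ⊆ Icc 0 1 := by
    rw [uIoc_of_le zero_le_one]; exact Ioc_subset_Icc_self
  have key := (intervalIntegral.hasDerivAt_integral_of_dominated_loc_of_deriv_le
    (F := fun s t => J (s, t)) (F' := F') (bound := fun _ => C) (μ := volume) (a := 0) (b := 1)
    (Metric.closedBall_mem_nhds s one_pos)
    (Eventually.of_forall fun r => ((hslice hJ.continuousOn r).mono hI).aestronglyMeasurable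
      measurableSet_uIoc)
    ((hslice hJ.continuousOn s).intervalIntegrable_of_Icc zero_le_one)
    (((hslice hc s).mono hI).aestronglyMeasurable measurableSet_uIoc)
    (Eventually.of_forall fun t ht r hr => hC (r, t) ⟨hr, hI ht⟩)
    intervalIntegrable_const
    (Eventually.of_forall fun t ht r _ => hd r t (hI ht))).2
  convert! key using 1
  refine intervalIntegral.integral_congr fun t ht => ?_
  rw [uIcc_of_le zero_le_one] at ht
  exact (hD t ht).unique (hd s t ht)

/-- Fundamental lemma of the calculus of variations: h vanishes almost everywhere in the open
interval, and continuity extends this to the closed one. -/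
theorem eqOn_zero_of_integral_mul_eq_zero {h : ℝ → ℝ} (hh : ContinuousOn h (Icc 0 1))
    (hint : ∀ θ : ℝ → ℝ, ContDiff ℝ ∞ θ → tsupport θ ⊆ Ioo 0 1 →
      ∫ t in (0 : ℝ)..1, θ t * h t = 0) : ∀ t ∈ Icc (0 : ℝ) 1, h t = 0 := by
  have h1 := isOpen_Ioo.ae_eq_zero_of_integral_contDiff_smul_eq_zero (U := Ioo (0 : ℝ) 1)
    (f := h) (μ := volume)
    ((hh.mono Ioo_subset_Icc_self).locallyIntegrableOn measurableSet_Ioo) fun θ hθ _ hsupp => by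
      rw [← hint θ hθ hsupp, intervalIntegral.integral_of_le zero_le_one]
      refine (setIntegral_eq_integral_of_forall_compl_eq_zero fun t ht => ?_).symm
      have : θ t = 0 := image_eq_zero_of_notMem_tsupport fun h => ht (Ioo_subset_Ioc_self (hsupp h))
      simp [this]
  refine Measure.eqOn_Icc_of_ae_eq (μ := volume) zero_ne_one ?_ hh continuousOn_const
  rw [← restrict_Ioo_eq_restrict_Icc]
  exact (ae_restrict_iff' measurableSet_Ioo).2 h1

theorem eqOn_of_integral_mul_add_deriv_mul_eq_zero {a c c' : ℝ → ℝ}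
    (ha : ContinuousOn a (Icc 0 1)) (hc' : ContinuousOn c' (Icc 0 1))
    (hc : ∀ t ∈ Icc (0 : ℝ) 1, HasDerivWithinAt c (c' t) (Icc 0 1) t)
    (hint : ∀ θ : ℝ → ℝ, ContDiff ℝ ∞ θ → tsupport θ ⊆ Ioo 0 1 →
      ∫ t in (0 : ℝ)..1, (θ t * a t + deriv θ t * c t) = 0) :
    ∀ t ∈ Icc (0 : ℝ) 1, a t - c' t = 0 := by
  refine eqOn_zero_of_integral_mul_eq_zero (ha.sub hc') fun θ hθ hsupp => ?_
  have h0 : ∀ t, t ∉ Ioo (0 : ℝ) 1 → θ t = 0 := fun t ht =>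
    image_eq_zero_of_notMem_tsupport fun h => ht (hsupp h)
  have hcc : ContinuousOn c (Icc 0 1) := fun t ht => (hc t ht).continuousWithinAt
  have hθd : Continuous (deriv θ) := hθ.continuous_deriv (by simp)
  have hi : ∀ {g k : ℝ → ℝ}, Continuous g → ContinuousOn k (Icc 0 1) →
      IntervalIntegrable (fun t => g t * k t) volume 0 1 := fun hg hk =>
    (hg.continuousOn.mul hk).intervalIntegrable_of_Icc zero_le_one
  have h1 := intervalIntegral.integral_mul_deriv_eq_deriv_mul_of_hasDerivWithinAt
    (a := 0) (b := 1) (u := θ) (v := c) (u' := deriv θ) (v' := c')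
    (fun t _ => (hθ.differentiable (by simp) t).hasDerivAt.hasDerivWithinAt)
    (by rw [uIcc_of_le zero_le_one]; exact hc) (hθd.intervalIntegrable _ _)
    (hc'.intervalIntegrable_of_Icc zero_le_one)
  have h2 := hint θ hθ hsupp
  rw [intervalIntegral.integral_add (hi hθ.continuous ha) (hi hθd hcc)] at h2
  rw [h0 0 (by simp), h0 1 (by simp)] at h1
  simp only [mul_sub]
  rw [intervalIntegral.integral_sub (hi hθ.continuous ha) (hi hθ.continuous hc')]
  linarith

section TimeDerivative

variable {f f' : ℝ → TF d}

/-- Smooth families on `[0, 1]` have smooth time derivatives. -/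
theorem exists_timeDeriv (hf : SmoothFam (Icc (0 : ℝ) 1) f) :
    ∃ f' : ℝ → TF d, SmoothFam (Icc (0 : ℝ) 1) f' ∧
      ∀ t ∈ Icc (0 : ℝ) 1, ∀ x, HasDerivWithinAt (fun r => f r x) (f' t x) (Icc 0 1) t := by
  classical
  have hu := uniqueDiffOn_Icc (zero_lt_one (α := ℝ))
  set g : ℝ × X d → ℝ := fun p => fderivWithin ℝ (fun p : ℝ × X d => f p.1 p.2)
    (Icc 0 1 ×ˢ univ) p (1, 0) with hg
  have hgc : ContDiffOn ℝ ∞ g (Icc 0 1 ×ˢ univ) :=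
    (ContDiffOn.fderivWithin hf (hu.prod uniqueDiffOn_univ) (by simp)).clm_apply contDiffOn_const
  have hd : ∀ t ∈ Icc (0 : ℝ) 1, ∀ x,
      HasDerivWithinAt (fun r => f r x) (g (t, x)) (Icc 0 1) t := fun t ht x => by
    have h1 := hasFDerivWithinAt_fst (ContDiffOn.differentiableOn hf (by simp)) ht (mem_univ x)
    simpa [fstDeriv] using! h1.hasDerivWithinAt
  have hmem : ∀ t ∈ Icc (0 : ℝ) 1, (fun x => g (t, x)) ∈ torusSmooth d := fun t ht => by
    refine ⟨?_, fun i x => ?_⟩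
    · have := ContDiffOn.comp (f := fun x : X d => (t, x)) (s := univ) hgc
        (contDiffOn_const.prodMk contDiffOn_id) fun x _ => ⟨ht, mem_univ _⟩
      exact contDiffOn_univ.1 this
    · have h1 := hd t ht (x + e i)
      simp only [(f _).periodic i x] at h1
      exact (hu t ht).eq_deriv _ h1 (hd t ht x)
  let f' : ℝ → TF d := fun t => if ht : t ∈ Icc (0 : ℝ) 1 then ⟨_, hmem t ht⟩ else 0
  have hf' : ∀ t ∈ Icc (0 : ℝ) 1, ∀ x, f' t x = g (t, x) := fun t ht x => by
    simp only [f', dif_pos ht]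
  exact ⟨f', hgc.congr fun p hp => hf' p.1 hp.1 p.2, fun t ht x => by
    rw [hf' t ht]; exact hd t ht x⟩

theorem hasDerivWithinAt_intL (hf : SmoothFam (Icc (0 : ℝ) 1) f) {t : ℝ}
    (ht : t ∈ Icc (0 : ℝ) 1) {f' : TF d}
    (hf' : ∀ x, HasDerivWithinAt (fun r => f r x) (f' x) (Icc 0 1) t) :
    HasDerivWithinAt (fun r => intL d (f r)) (intL d f') (Icc 0 1) t := by
  have hu := uniqueDiffOn_Icc (zero_lt_one (α := ℝ))
  have h2 := (((hf.toCube (convex_Icc 0 1) hu).differentiableOn (by simp)) t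
    ht).hasFDerivWithinAt.hasDerivWithinAt
  have h3 : fderivWithin ℝ (fun v => (f v).toCube) (Icc 0 1) t 1 = f'.toCube := by
    ext k
    have h4 := (ContinuousMap.evalCLM ℝ k).hasFDerivAt.comp_hasDerivWithinAt t h2
    exact (hu t ht).eq_deriv _ h4 (hf' (cubeIncl d k))
  rw [h3] at h2
  have h5 := (cubeIntegral d).hasFDerivAt.comp_hasDerivWithinAt t h2
  simpa only [cubeIntegral_toCube, Function.comp_def] using! h5

theorem dt_eq {t : ℝ} (ht : t ∈ Icc (0 : ℝ) 1) {x : X d} {y : ℝ}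
    (h : HasDerivWithinAt (fun r => f r x) y (Icc 0 1) t) : dt f t x = y :=
  h.derivWithin (uniqueDiffOn_Icc zero_lt_one t ht)

theorem hasDerivWithinAt_dt (hf : SmoothFam (Icc (0 : ℝ) 1) f) {t : ℝ} (ht : t ∈ Icc (0 : ℝ) 1)
    (x : X d) : HasDerivWithinAt (fun r => f r x) (dt f t x) (Icc 0 1) t :=
  (((hf.eval x).differentiableOn (by simp)) t ht).hasDerivWithinAt

/-- Smooth families of functions on `[0, 1] × 𝕋^d` are bounded below by a positive constant if
they are positive. -/
theorem exists_pos_le (hf : SmoothFam (Icc (0 : ℝ) 1) f)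
    (hpos : ∀ t ∈ Icc (0 : ℝ) 1, ∀ x, 0 < f t x) :
    ∃ c : ℝ, 0 < c ∧ ∀ t ∈ Icc (0 : ℝ) 1, ∀ x, c ≤ f t x := by
  have hK : IsCompact (univ : Set (Icc (0 : ℝ) 1 × Cube d)) := isCompact_univ
  have hc : Continuous fun p : Icc (0 : ℝ) 1 × Cube d => f p.1 (cubeIncl d p.2) :=
    ContinuousOn.comp_continuous (f := fun p : Icc (0 : ℝ) 1 × Cube d =>
      ((p.1 : ℝ), cubeIncl d p.2)) (ContDiffOn.continuousOn hf) (by fun_prop)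
      fun p => ⟨p.1.2, mem_univ _⟩
  obtain ⟨k₀, -⟩ := (f 0).periodic.exists_cube 0
  obtain ⟨p, -, hp⟩ := hK.exists_isMinOn ⟨(⟨0, by simp⟩, k₀), mem_univ _⟩ hc.continuousOn
  refine ⟨_, hpos p.1 p.1.2 (cubeIncl d p.2), fun t ht x => ?_⟩
  obtain ⟨k, hk⟩ := (f t).periodic.exists_cube x
  rw [← hk]
  exact hp (mem_univ (⟨t, ht⟩, k))

end TimeDerivative

/-! ### Variations and the Euler–Lagrange equation -/

theorem divGrad_eq_zero_of_pd {ρ : Density d} {Φ : TF d} (h : ∀ i, pd i Φ = 0) :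
    divGrad ρ Φ = 0 := by simp [divGrad, divT, h]

section

variable {ρ : ℝ → Density d} {Φ : ℝ → TF d}

theorem convex_strip : Convex ℝ ((univ : Set ℝ) ×ˢ Icc (0 : ℝ) 1) :=
  convex_univ.prod (convex_Icc 0 1)

theorem uniqueDiffOn_strip : UniqueDiffOn ℝ ((univ : Set ℝ) ×ˢ Icc (0 : ℝ) 1) :=
  uniqueDiffOn_univ.prod (uniqueDiffOn_Icc zero_lt_one)

theorem interior_strip : (interior ((univ : Set ℝ) ×ˢ Icc (0 : ℝ) 1)).Nonempty := by
  rw [interior_prod_eq, interior_univ, interior_Icc]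
  exact ⟨(0, 1 / 2), mem_univ _, by norm_num, by norm_num⟩

/-- The variation of a path of densities in the direction `θ(t) φ(x)`. -/
theorem exists_variation (hadm : Admissible ρ Φ) {θ : ℝ → ℝ} (hθ : ContDiff ℝ ∞ θ)
    (hθ0 : θ 0 = 0) (hθ1 : θ 1 = 0) {φ : TF d} (hφ : intL d φ = 0)
    (hsmall : ∀ t ∈ Icc (0 : ℝ) 1, ∀ x, |θ t * φ x| < (ρ t).toTF x) :
    ∃ ρs Φs, IsVariation ρ Φ ρs Φs ∧ ∀ t ∈ Icc (0 : ℝ) 1, ∀ s,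
      (ρs s t).toTF = (ρ t).toTF + Real.sin s • θ t • φ ∧
      divGrad (ρs s t) (Φs s t) = divGrad (ρ t) (Φ t) - Real.sin s • deriv θ t • φ := by
  have hρ := hadm.smooth_density
  have hΦ := hadm.smooth_potential
  have hI := uniqueDiffOn_Icc (zero_lt_one (α := ℝ))
  set T : Set (ℝ × ℝ) := univ ×ˢ Icc (0 : ℝ) 1 with hT
  have hlift : ∀ {f : ℝ → TF d}, SmoothFam (Icc (0 : ℝ) 1) f →
      SmoothFam T fun p : ℝ × ℝ => f p.2 := fun hf =>
    hf.comp contDiff_snd.contDiffOn fun p hp => hp.2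
  let R : ℝ × ℝ → Density d := fun p => (ρ p.2).perturb (Real.sin p.1 • θ p.2 • φ)
  have hR : ∀ p ∈ T, (R p).toTF = (ρ p.2).toTF + Real.sin p.1 • θ p.2 • φ := fun p hp => by
    refine Density.perturb_toTF (fun x => ?_) (by simp [hφ])
    exact (abs_sin_mul_le p.1 (θ p.2 * φ x)).trans_lt (hsmall p.2 hp.2 x)
  have hpert : ∀ {c : ℝ → ℝ}, ContDiff ℝ ∞ c →
      SmoothFam T fun p : ℝ × ℝ => Real.sin p.1 • c p.2 • φ := fun {c} hc => by
    have h1 : ContDiffOn ℝ ∞ (fun p : ℝ × ℝ => c p.2) T := (hc.comp contDiff_snd).contDiffOn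
    have h2 : ContDiffOn ℝ ∞ (fun p : ℝ × ℝ => Real.sin p.1) T :=
      (Real.contDiff_sin.comp contDiff_fst).contDiffOn
    exact SmoothFam.smul h2 (SmoothFam.smul h1 (SmoothFam.const φ))
  have hRs : SmoothFam T fun p => (R p).toTF :=
    SmoothFam.congr ((hlift hρ).add (hpert hθ)) hR
  have hR0 : ∀ s t, t ∈ Icc (0 : ℝ) 1 → Real.sin s * θ t = 0 → R (s, t) = ρ t :=
    fun s t ht h => Density.ext (by rw [hR (s, t) ⟨mem_univ _, ht⟩, smul_smul]; simp [h])
  have hθ' : ContDiff ℝ ∞ (deriv θ) := (contDiff_infty_iff_deriv.1 hθ).2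
  -- The flux that Φ fails to supply for the perturbed density. It is made of divergences and a
  -- multiple of φ, so it has mean zero and a corrector u exists.
  let f : ℝ × ℝ → TF d := fun p =>
    divGrad (ρ p.2) (Φ p.2) - Real.sin p.1 • deriv θ p.2 • φ - divGrad (R p) (Φ p.2)
  have hfs : SmoothFam T f :=
    ((hlift (SmoothFam.divGrad hI hρ hΦ)).sub (hpert hθ')).sub
      (SmoothFam.divGrad uniqueDiffOn_strip hRs (hlift hΦ))
  obtain ⟨u, hu, hu'⟩ := exists_divGrad_eq convex_strip uniqueDiffOn_strip hRs hfs fun p _ => by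
    simp [f, intL_divGrad, hφ]
  have hu0 : ∀ t ∈ Icc (0 : ℝ) 1, ∀ i, pd i (u (0, t)) = 0 := fun t ht =>
    pd_eq_zero_of_divGrad_eq_zero (ρ := ρ t) (by
      rw [← hR0 0 t ht (by simp), hu' (0, t) ⟨mem_univ _, ht⟩]
      simp [f, hR0 0 t ht (by simp)])
  -- At s = 0 the missing flux is zero, so u(0, t) is constant in x. Subtracting it leaves gradients
  -- unchanged and makes the varied potential equal Φ exactly at s = 0.
  have hdiv : ∀ t ∈ Icc (0 : ℝ) 1, ∀ s, divGrad (R (s, t)) (Φ t + (u (s, t) - u (0, t))) =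
      divGrad (ρ t) (Φ t) - Real.sin s • deriv θ t • φ := fun t ht s => by
    rw [divGrad_add, divGrad_sub, hu' (s, t) ⟨mem_univ _, ht⟩, divGrad_eq_zero_of_pd (hu0 t ht)]
    simp only [f]; abel
  refine ⟨fun s t => R (s, t), fun s t => Φ t + (u (s, t) - u (0, t)), ?_, fun t ht s =>
    ⟨hR (s, t) ⟨mem_univ _, ht⟩, hdiv t ht s⟩⟩
  refine ⟨hRs, (hlift hΦ).add (hu.sub (hu.comp (c := fun p : ℝ × ℝ => ((0 : ℝ), p.2))
    (by fun_prop) fun p hp => ⟨mem_univ _, hp.2⟩)), fun s t ht x => ?_, fun t ht =>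
    hR0 0 t ht (by simp), fun t _ => by simp, fun s => hR0 s 0 (by simp) (by simp [hθ0]),
    fun s => hR0 s 1 (by simp) (by simp [hθ1])⟩
  have h1 : dt (fun r => (R (s, r)).toTF) t x =
      dt (fun r => (ρ r).toTF) t x + Real.sin s * (deriv θ t * φ x) := by
    refine dt_eq ht ?_
    have h2 := (hasDerivWithinAt_dt hρ ht x).add
      ((((hθ.differentiable (by simp) t).hasDerivAt.hasDerivWithinAt (s := Icc 0 1)).mul_const
        (φ x)).const_mul (Real.sin s))
    refine h2.congr_of_mem (fun r hr => ?_) ht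
    rw [hR (s, r) ⟨mem_univ _, hr⟩]
    rfl
  rw [h1, hdiv t ht s]
  simp only [TF.sub_apply, TF.smul_apply]
  linarith [hadm.continuity t ht x]

end

/-! ### From criticality to the flow equations -/

section Critical

variable {E F : Density d → ℝ} {δE : Density d → TF d} {δ2E : Density d → Kernel2 d}
  {δ3E : Density d → Kernel3 d} {δF : Density d → TF d} {ρ : ℝ → Density d} {Φ : ℝ → TF d}

theorem SmoothFam.hessForm {V : Type} [NormedAddCommGroup V] [NormedSpace ℝ V] {S : Set V}
    (hS : UniqueDiffOn ℝ S) {p Φ Ψ : V → TF d} (hp : SmoothFam S p) (hΦ : SmoothFam S Φ)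
    (hΨ : SmoothFam S Ψ) : SmoothFam S fun v => hessForm (p v) (Φ v) (Ψ v) :=
  SmoothFam.sum _ fun i _ => SmoothFam.sum _ fun j _ =>
    (((hp.pd hS j).pd hS i).mul (hΦ.pd hS i)).mul (hΨ.pd hS j)

/-- The continuity equation makes Φs an admissible potential for the velocity, so the metric may be
evaluated on it. -/
theorem action_eq (ρs : ℝ → Density d) (Φs : ℝ → TF d) (h : ContinuityEq ρs Φs) :
    action δE δ2E F ρs =
      ∫ t in (0 : ℝ)..1, ((1 / 2) * hessStar δE δ2E (ρs t) (Φs t) (Φs t) - F (ρs t)) := by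
  refine intervalIntegral.integral_congr fun t ht => ?_
  rw [uIcc_of_le zero_le_one] at ht
  rw [gH_eq fun x => h t ht x]

/-- The weak form of the Euler–Lagrange equation, for small test functions. -/
theorem integral_eq_zero_of_small (hE : SmoothFunctional E) (hE1 : IsFirstVariation E δE)
    (hE2 : IsSecondVariation δE δ2E) (hE3 : IsThirdVariation δ2E δ3E) (hF : SmoothFunctional F)
    (hF1 : IsFirstVariation F δF) (hcrit : IsCriticalPoint δE δ2E F ρ Φ) {Ψ : ℝ → TF d}
    (hΨ : ∀ t ∈ Icc (0 : ℝ) 1, divGrad (ρ t) (Ψ t) = poissonRHS δE δ2E (ρ t) (Φ t))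
    {θ : ℝ → ℝ} (hθ : ContDiff ℝ ∞ θ) (hθ0 : θ 0 = 0) (hθ1 : θ 1 = 0) {φ : TF d}
    (hφ : intL d φ = 0) (hsmall : ∀ t ∈ Icc (0 : ℝ) 1, ∀ x, |θ t * φ x| < (ρ t).toTF x) :
    ∫ t in (0 : ℝ)..1, (θ t * intL d (hjTerms δE δ2E δ3E δF (ρ t) (Φ t) (Ψ t) * φ) +
      deriv θ t * intL d (Ψ t * φ)) = 0 := by
  obtain ⟨ρs, Φs, hvar, hspec⟩ := exists_variation hcrit.admissible hθ hθ0 hθ1 hφ hsmall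
  have hρ0 := hvar.base_density
  have hΦ0 := hvar.base_potential
  have hslice : ∀ t ∈ Icc (0 : ℝ) 1, SmoothFam univ fun s => Φs s t := fun t ht =>
    hvar.smooth_potential.comp (c := fun s : ℝ => (s, t)) (by fun_prop)
      fun s _ => ⟨mem_univ _, ht⟩
  let J : ℝ × ℝ → ℝ := fun p =>
    (1 / 2) * hessStar δE δ2E (ρs p.1 p.2) (Φs p.1 p.2) (Φs p.1 p.2) - F (ρs p.1 p.2)
  have hJ : ContDiffOn ℝ ∞ J (univ ×ˢ Icc 0 1) := by
    have hr := hvar.smooth_density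
    have hp := hvar.smooth_potential
    have hσ := SmoothFam.divGrad uniqueDiffOn_strip hr hp
    have h1 := hE1.smooth (ℝ × ℝ) _ convex_strip interior_strip _ hr
    have h2 := hE2.smooth (ℝ × ℝ) _ convex_strip interior_strip _ _ hr hσ
    have h3 := (h2.mul hσ).intL convex_strip uniqueDiffOn_strip
    have h4 := ((SmoothFam.hessForm uniqueDiffOn_strip h1 hp hp).mul hr).intL convex_strip
      uniqueDiffOn_strip
    simp only [J, hessStar_eq]
    exact (contDiffOn_const.mul (h3.add h4)).sub
      (hF (ℝ × ℝ) _ convex_strip interior_strip _ hr)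
  have hD : ∀ t ∈ Icc (0 : ℝ) 1, HasDerivAt (fun s => J (s, t))
      (θ t * intL d (hjTerms δE δ2E δ3E δF (ρ t) (Φ t) (Ψ t) * φ) +
        deriv θ t * intL d (Ψ t * φ)) 0 := fun t ht => by
    have h1 := hasDerivAt_lagrangian hE hE1 hE2 hE3 hF1 (γ := fun s => ρs s t)
      (Φ := fun s => Φs s t) (η := θ t • φ) (κ := deriv θ t • φ) (Ψ := Ψ t)
      (fun s => by rw [hρ0 t ht]; exact (hspec t ht s).1) (by simp [hφ]) (by simp [hφ])
      (hslice t ht) (fun s => by rw [hρ0 t ht, hΦ0 t ht]; exact (hspec t ht s).2)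
      (by rw [hρ0 t ht, hΦ0 t ht]; exact hΨ t ht)
    simpa only [hρ0 t ht, hΦ0 t ht, mul_smul_comm, map_smul, smul_eq_mul] using! h1
  have h1 := hasDerivAt_integral_zero_one hJ hD
  have h2 := hcrit.critical ρs Φs hvar
  simp only [action_eq _ _ (hvar.continuity _)] at h2
  exact h1.unique h2

theorem smul_small {f : ℝ → TF d} {c : ℝ} (hc : 0 < c)
    (hf : ∀ t ∈ Icc (0 : ℝ) 1, ∀ x, c ≤ f t x) {θ : ℝ → ℝ} (hθ : Continuous θ) (φ : TF d) :
    ∃ ε : ℝ, 0 < ε ∧ ∀ t ∈ Icc (0 : ℝ) 1, ∀ x, |θ t * (ε • φ) x| < f t x := by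
  obtain ⟨A, hA⟩ := isCompact_Icc.exists_bound_of_continuousOn (hθ.continuousOn (s := Icc 0 1))
  obtain ⟨B, hB⟩ := φ.periodic.exists_norm_le φ.continuous
  have hA0 : 0 ≤ A := (norm_nonneg _).trans (hA 0 (by simp))
  have hB0 : 0 ≤ B := (norm_nonneg _).trans (hB 0)
  have hAB : 0 ≤ A * B := mul_nonneg hA0 hB0
  refine ⟨c / (A * B + 1), by positivity, fun t ht x => lt_of_lt_of_le ?_ (hf t ht x)⟩
  have h1 : |θ t| * |φ x| ≤ A * B := mul_le_mul (hA t ht) (hB x) (abs_nonneg _) hA0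
  rw [TF.smul_apply, mul_left_comm, abs_mul, abs_of_pos (by positivity), abs_mul,
    div_mul_eq_mul_div, div_lt_iff₀ (by positivity)]
  nlinarith

/-- The Euler–Lagrange equation tested against functions of mean zero. -/
theorem intL_hjTerms_sub_mul_eq_zero (hE : SmoothFunctional E) (hE1 : IsFirstVariation E δE)
    (hE2 : IsSecondVariation δE δ2E) (hE3 : IsThirdVariation δ2E δ3E) (hF : SmoothFunctional F)
    (hF1 : IsFirstVariation F δF) (hcrit : IsCriticalPoint δE δ2E F ρ Φ) {Ψ Ψ' : ℝ → TF d}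
    (hΨ : ∀ t ∈ Icc (0 : ℝ) 1, divGrad (ρ t) (Ψ t) = poissonRHS δE δ2E (ρ t) (Φ t))
    (hΨs : SmoothFam (Icc (0 : ℝ) 1) Ψ) (hΨs' : SmoothFam (Icc (0 : ℝ) 1) Ψ')
    (hΨ' : ∀ t ∈ Icc (0 : ℝ) 1, ∀ x, HasDerivWithinAt (fun r => Ψ r x) (Ψ' t x) (Icc 0 1) t)
    (hH : SmoothFam (Icc (0 : ℝ) 1) fun t => hjTerms δE δ2E δ3E δF (ρ t) (Φ t) (Ψ t))
    {φ : TF d} (hφ : intL d φ = 0) : ∀ t ∈ Icc (0 : ℝ) 1,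
      intL d ((hjTerms δE δ2E δ3E δF (ρ t) (Φ t) (Ψ t) - Ψ' t) * φ) = 0 := by
  have hI := uniqueDiffOn_Icc (zero_lt_one (α := ℝ))
  have hcont : ∀ {f : ℝ → TF d}, SmoothFam (Icc (0 : ℝ) 1) f →
      ContinuousOn (fun t => intL d (f t * φ)) (Icc 0 1) := fun hf =>
    ((hf.mul (SmoothFam.const φ)).intL (convex_Icc 0 1) hI).continuousOn
  have key := eqOn_of_integral_mul_add_deriv_mul_eq_zero (hcont hH) (hcont hΨs')
    (c := fun t => intL d (Ψ t * φ)) (fun t ht => hasDerivWithinAt_intL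
      (hΨs.mul (SmoothFam.const φ)) ht fun x => (hΨ' t ht x).mul_const (φ x))
    fun θ hθ hsupp => by
      have h0 : ∀ t, t ∉ Ioo (0 : ℝ) 1 → θ t = 0 := fun t ht =>
        image_eq_zero_of_notMem_tsupport fun h => ht (hsupp h)
      -- The weak equation is linear in φ, so it suffices to have it for ε φ, with ε small enough
      -- for the perturbed densities to stay positive.
      obtain ⟨c, hc, hcρ⟩ := exists_pos_le hcrit.admissible.smooth_density fun t _ => (ρ t).pos
      obtain ⟨ε, hε, hsmall⟩ := smul_small hc hcρ hθ.continuous φ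
      have h := integral_eq_zero_of_small hE hE1 hE2 hE3 hF hF1 hcrit hΨ hθ (h0 0 (by simp))
        (h0 1 (by simp)) (by simp [hφ]) hsmall
      simp only [mul_smul_comm, map_smul, smul_eq_mul, mul_left_comm _ ε, ← mul_add,
        intervalIntegral.integral_const_mul] at h
      exact (mul_eq_zero.1 h).resolve_left hε.ne'
  intro t ht
  rw [sub_mul, map_sub]
  exact key t ht

/-- Test against q minus its mean: the square of this function then integrates to zero. -/
theorem eq_const_of_intL_mul_eq_zero {q : TF d} (h : ∀ φ : TF d, intL d φ = 0 → intL d (q * φ) = 0) :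
    q = algebraMap ℝ (TF d) (intL d q) := by
  set m := algebraMap ℝ (TF d) (intL d q) with hm
  have h0 : intL d (q - m) = 0 := by rw [map_sub, hm, intL_algebraMap, sub_self]
  have h1 : intL d ((q - m) * (q - m)) = 0 := by
    have h2 : (q - m) * (q - m) = q * (q - m) - intL d q • (q - m) := by
      rw [hm, sub_mul, Algebra.smul_def]
    rw [h2, map_sub, map_smul, h0, h _ h0]; simp
  have h2 := eq_zero_of_intL_eq_zero (fun x => mul_self_nonneg ((q - m) x)) h1
  refine sub_eq_zero.1 (TF.ext fun x => ?_)
  have h3 : (q - m) x * (q - m) x = 0 := congrArg (fun f : TF d => f x) h2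
  exact mul_self_eq_zero.1 h3

theorem exists_primitive {m : ℝ → ℝ} (hm : ContDiffOn ℝ ∞ m (Icc 0 1)) :
    ∃ M : ℝ → ℝ, ContDiffOn ℝ ∞ M (Icc 0 1) ∧
      ∀ t ∈ Icc (0 : ℝ) 1, HasDerivWithinAt M (m t) (Icc 0 1) t := by
  have hI := uniqueDiffOn_Icc (zero_lt_one (α := ℝ))
  -- Extending m constantly beyond the interval gives a continuous integrand on ℝ, so the
  -- fundamental theorem of calculus also covers the end points.
  let n : ℝ → ℝ := IccExtend zero_le_one ((Icc (0 : ℝ) 1).domRestrict m)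
  have hn : Continuous n := (continuousOn_iff_continuous_domRestrict.1 hm.continuousOn).Icc_extend'
  have hM : ∀ t ∈ Icc (0 : ℝ) 1,
      HasDerivWithinAt (fun t => ∫ r in (0 : ℝ)..t, n r) (m t) (Icc 0 1) t := fun t ht => by
    have h1 : n t = m t := IccExtend_of_mem _ _ ht
    rw [← h1]
    exact (hn.integral_hasStrictDerivAt 0 t).hasDerivAt.hasDerivWithinAt
  refine ⟨_, (contDiffOn_infty_iff_derivWithin hI).2
    ⟨fun t ht => (hM t ht).differentiableWithinAt, hm.congr fun t ht =>
      (hM t ht).derivWithin (hI t ht)⟩, hM⟩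

theorem smoothFam_poissonRHS (hE1 : IsFirstVariation E δE) (hE2 : IsSecondVariation δE δ2E)
    (hρ : SmoothFam (Icc (0 : ℝ) 1) fun t => (ρ t).toTF) (hΦ : SmoothFam (Icc (0 : ℝ) 1) Φ) :
    SmoothFam (Icc (0 : ℝ) 1) fun t => poissonRHS δE δ2E (ρ t) (Φ t) := by
  have hI := uniqueDiffOn_Icc (zero_lt_one (α := ℝ))
  have hi : (interior (Icc (0 : ℝ) 1)).Nonempty := by simp
  have h1 := hE1.smooth ℝ _ (convex_Icc 0 1) hi ρ hρ
  have h2 := hE2.smooth ℝ _ (convex_Icc 0 1) hi ρ _ hρ (SmoothFam.divGrad hI hρ hΦ)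
  simp only [poissonRHS, sum_dy]
  exact SmoothFam.divT hI fun i => hρ.mul ((h2.neg.pd hI i).add
    (SmoothFam.sum _ fun j _ => ((h1.pd hI j).pd hI i).mul (hΦ.pd hI j)))

theorem smoothFam_hjTerms (hE1 : IsFirstVariation E δE) (hE2 : IsSecondVariation δE δ2E)
    (hE3 : IsThirdVariation δ2E δ3E) (hF1 : IsFirstVariation F δF)
    (hρ : SmoothFam (Icc (0 : ℝ) 1) fun t => (ρ t).toTF) (hΦ : SmoothFam (Icc (0 : ℝ) 1) Φ)
    {Ψ : ℝ → TF d} (hΨ : SmoothFam (Icc (0 : ℝ) 1) Ψ) :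
    SmoothFam (Icc (0 : ℝ) 1) fun t => hjTerms δE δ2E δ3E δF (ρ t) (Φ t) (Ψ t) := by
  have hI := uniqueDiffOn_Icc (zero_lt_one (α := ℝ))
  have hi : (interior (Icc (0 : ℝ) 1)).Nonempty := by simp
  have hσ := SmoothFam.divGrad hI hρ hΦ
  have hst : SmoothFam (Icc (0 : ℝ) 1) fun t => stress (ρ t).toTF (Φ t) :=
    SmoothFam.sum _ fun i _ => SmoothFam.sum _ fun j _ =>
      ((((hρ.mul (hΦ.pd hI i)).mul (hΦ.pd hI j)).pd hI j).pd hI i)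
  have h1 := hE1.smooth ℝ _ (convex_Icc 0 1) hi ρ hρ
  have h2 := hE2.smooth ℝ _ (convex_Icc 0 1) hi ρ _ hρ hσ
  have h2' := hE2.smooth ℝ _ (convex_Icc 0 1) hi ρ _ hρ hst
  have h3 := hE3.smooth ℝ _ (convex_Icc 0 1) hi ρ _ _ hρ hσ hσ
  have hf := hF1.smooth ℝ _ (convex_Icc 0 1) hi ρ hρ
  have hc : ContDiffOn ℝ ∞ (fun _ : ℝ => (1 / 2 : ℝ)) (Icc 0 1) := contDiffOn_const
  exact (((((SmoothFam.smul hc h3).sub (SmoothFam.sum _ fun i _ =>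
    (h2.pd hI i).mul (hΦ.pd hI i))).add (SmoothFam.smul hc h2')).add
      (SmoothFam.smul hc (SmoothFam.hessForm hI h1 hΦ hΦ))).sub (SmoothFam.sum _ fun i _ =>
        (hΦ.pd hI i).mul (hΨ.pd hI i))).sub hf

/-- The Poisson equation fixes Ψ up to a function of time. Any smooth solution leaves a residual in
the Hamilton–Jacobi equation that depends on time alone, and adding a primitive of this residual
cancels it while keeping ∇Ψ and the Poisson equation. -/
theorem exists_hamiltonian_flow (hE : SmoothFunctional E) (hE1 : IsFirstVariation E δE)
    (hE2 : IsSecondVariation δE δ2E) (hE3 : IsThirdVariation δ2E δ3E) (hF : SmoothFunctional F)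
    (hF1 : IsFirstVariation F δF) (hcrit : IsCriticalPoint δE δ2E F ρ Φ) :
    ∃ Ψ : ℝ → TF d, SmoothFam (Icc (0 : ℝ) 1) Ψ ∧
      HamiltonJacobiEq δE δ2E δ3E δF ρ Φ Ψ ∧ PoissonEq δE δ2E ρ Φ Ψ := by
  have hI := uniqueDiffOn_Icc (zero_lt_one (α := ℝ))
  have hρ := hcrit.admissible.smooth_density
  have hΦ := hcrit.admissible.smooth_potential
  obtain ⟨Ψ₀, hs₀, hΨ₀⟩ := exists_divGrad_eq (convex_Icc 0 1) hI hρ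
    (smoothFam_poissonRHS hE1 hE2 hρ hΦ) fun t _ => intL_divT _
  obtain ⟨Ψ', hs', hΨ'⟩ := exists_timeDeriv hs₀
  have hH := smoothFam_hjTerms hE1 hE2 hE3 hF1 hρ hΦ hs₀
  set q : ℝ → TF d := fun t => hjTerms δE δ2E δ3E δF (ρ t) (Φ t) (Ψ₀ t) - Ψ' t with hq
  have hqm : ∀ t ∈ Icc (0 : ℝ) 1, q t = algebraMap ℝ (TF d) (intL d (q t)) := fun t ht =>
    eq_const_of_intL_mul_eq_zero fun φ hφ => intL_hjTerms_sub_mul_eq_zero hE hE1 hE2 hE3 hF hF1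
      hcrit hΨ₀ hs₀ hs' hΨ' hH hφ t ht
  obtain ⟨M, hMs, hM⟩ := exists_primitive ((hH.sub hs').intL (convex_Icc 0 1) hI)
  have hpd : ∀ t i, pd i (Ψ₀ t + algebraMap ℝ (TF d) (M t)) = pd i (Ψ₀ t) := fun t i => by
    rw [map_add, pd_algebraMap, add_zero]
  refine ⟨fun t => Ψ₀ t + algebraMap ℝ (TF d) (M t), hs₀.add (SmoothFam.algebraMap hMs),
    fun t ht x => ?_, fun t ht => ?_⟩
  · have h1 : dt (fun t => Ψ₀ t + algebraMap ℝ (TF d) (M t)) t x = Ψ' t x + intL d (q t) :=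
      dt_eq ht ((hΨ' t ht x).add (hM t ht))
    have h2 : q t x = intL d (q t) := by
      conv_lhs => rw [hqm t ht]
      rfl
    have h3 : q t x = hjTerms δE δ2E δ3E δF (ρ t) (Φ t) (Ψ₀ t) x - Ψ' t x := rfl
    rw [hjTerms_apply] at h3
    simp only [hpd]
    rw [h1]
    linarith
  · have h1 : divGrad (ρ t) (Ψ₀ t + algebraMap ℝ (TF d) (M t)) = divGrad (ρ t) (Ψ₀ t) := by
      simp only [divGrad, hpd]
    exact h1.trans (hΨ₀ t ht)

end Critical

end TransportHessian

end

theorem mainTheorem2 (d : ℕ)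
    (E : TransportHessian.Density d → ℝ)
    (δE : TransportHessian.Density d → TransportHessian.TF d)
    (δ2E : TransportHessian.Density d → TransportHessian.Kernel2 d)
    (δ3E : TransportHessian.Density d → TransportHessian.Kernel3 d)
    (hE : TransportHessian.SmoothFunctional E)
    (hE1 : TransportHessian.IsFirstVariation E δE)
    (hE2 : TransportHessian.IsSecondVariation δE δ2E)
    (hE3 : TransportHessian.IsThirdVariation δ2E δ3E)
    (F : TransportHessian.Density d → ℝ)
    (δF : TransportHessian.Density d → TransportHessian.TF d)
    (hF : TransportHessian.SmoothFunctional F)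
    (hF1 : TransportHessian.IsFirstVariation F δF)
    (ρ : ℝ → TransportHessian.Density d) (Φ : ℝ → TransportHessian.TF d)
    (hcrit : TransportHessian.IsCriticalPoint δE δ2E F ρ Φ) :
    ∃ Ψ : ℝ → TransportHessian.TF d,
      TransportHessian.SmoothFam (Set.Icc (0 : ℝ) 1) Ψ ∧
      TransportHessian.ContinuityEq ρ Φ ∧
      TransportHessian.HamiltonJacobiEq δE δ2E δ3E δF ρ Φ Ψ ∧
      TransportHessian.PoissonEq δE δ2E ρ Φ Ψ := by
  obtain ⟨Ψ, h1, h2, h3⟩ :=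
    TransportHessian.exists_hamiltonian_flow hE hE1 hE2 hE3 hF hF1 hcrit
  exact ⟨Ψ, h1, hcrit.admissible.continuity, h2, h3⟩
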